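/- **Setting.** Let $\mathbb G$ be a Carnot group of step $k\ge 1$ whose Lie algebra has the stratification $V_1\oplus\cdots\oplus V_k$, $[V_1,V_j]=V_{j+1}$ for $1\le j<k$, $[V_1,V_k]=\{0\}$, with $v_j:=\dim V_j\geq 1$. In exponential coordinates, with respect to a basis adapted to the strata, $\mathbb G=\mathbb R^{v_1}\times\cdots\times\mathbb R^{v_k}$ with the Baker–Campbell–Hausdorff group law; its identity is $0$, and $x^{-1}=-x$. Write $x=(x^{(1)},\dots,x^{(k)})$ with $x^{(j)}\in\mathbb R^{v_j}$, and put $$|x|_{\mathbb G}=\Big(\sum_{j=1}^k\|x^{(j)}\|^{2k!/j}\Big)^{1/(2k!)},\qquad B_\varepsilon(x)=\{y:|y^{-1}x|_{\mathbb G}<\varepsilon\},\qquad \overline{B_\varepsilon(x)}=\{y:|y^{-1}x|_{\mathbb G}\le\varepsilon\}.$$ Let $X_1,\dots,X_{v_1}$ be the left invariant vector fields that agree at $0$ with the coordinate directions of $\mathbb R^{v_1}$. Put $\nabla_{V_1}u=(X_1u,\dots,X_{v_1}u)$, $\operatorname{div}_{V_1}F=\sum_{i\le v_1}X_iF_i$,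 and $D^{2,*}_{V_1}u=\big(\tfrac12(X_iX_j+X_jX_i)u\big)_{i,j\le v_1}$. Where $\nabla_{V_1}u\ne0$, define $$\Delta^N_{p,\mathbb G}u=\frac{\operatorname{div}_{V_1}(|\nabla_{V_1}u|^{p-2}\nabla_{V_1}u)}{|\nabla_{V_1}u|^{p-2}}\quad(1<p<\infty),\qquad \Delta^N_{\infty,\mathbb G}u=\Big\langle D^{2,*}_{V_1}u\,\frac{\nabla_{V_1}u}{|\nabla_{V_1}u|},\frac{\nabla_{V_1}u}{|\nabla_{V_1}u|}\Big\rangle .$$ For $u$ continuous on $\overline{B_\varepsilon(x)}$, $\mu_p(\varepsilon,u)(x)$ denotes the real number that minimizes $\lambda\mapsto\|u-\lambda\|_{L^p(\overline{B_\varepsilon(x)})}$ over $\lambda\in\mathbb R$ ($L^p$ with respect to Lebesgue measure). With $\mathcal B(a,b)=\int_0^1t^{a-1}(1-t)^{b-1}\,dt$, put $$c(p,v_1,\dots,v_k)=\frac1{2(p+v_1)}\prod_{j=2}^{k}\frac{\mathcal B\Big(\frac{jv_j}{2k!},\frac{p+\sum_{i=1}^{j-1}iv_i}{2k!}+1\Big)}{\mathcal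 B\Big(\frac{jv_j}{2k!},\frac{p-2+\sum_{i=1}^{j-1}iv_i}{2k!}+1\Big)}\quad(1<p<\infty),\qquad c(\infty,v_1,\dots,v_k)=\frac12 .$$ **Lemma.** Let $1<p\le\infty$, let $x\in\mathbb G$, and write $c=c(p,v_1,\dots,v_k)$. (1) Let $\xi\in\mathbb R^{v_1}\setminus\{0\}$, $\eta\in\mathbb R^{v_2}$, let $A$ be a real symmetric $v_1\times v_1$ matrix, let $\varepsilon_0>0$, and let $q$ satisfy $$q(y)=q(x)+\langle\xi,(x^{-1}y)^{(1)}\rangle+\langle\eta,(x^{-1}y)^{(2)}\rangle+\tfrac12\langle A(x^{-1}y)^{(1)},(x^{-1}y)^{(1)}\rangle,\qquad y\in B_{\varepsilon_0}(x)$$ (without the term in $\eta$ if $k=1$). Then the minimizer $\mu_p(\varepsilon,q)(x)$ exists and is unique for $0<\varepsilon<\varepsilon_0$ and, as $\varepsilon\to0^+$, $$\mu_p(\varepsilon,q)(x)=q(x)+\varepsilon^2c\Big(\operatorname{tr}A+(p-2)\frac{\langle A\xi,\xi\rangle}{|\xi|^2}\Big)+o(\varepsilon^2)\quad\text{if }p<\infty,$$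 $$\mu_\infty(\varepsilon,q)(x)=q(x)+\varepsilon^2c\,\frac{\langle A\xi,\xi\rangle}{|\xi|^2}+o(\varepsilon^2)\quad\text{if }p=\infty .$$ (2) Let $\Omega\subset\mathbb G$ be open with $x\in\Omega$, and let $u\in C^2(\Omega)$ with $\nabla_{V_1}u(x)\ne0$. Then $\overline{B_\varepsilon(x)}\subset\Omega$ for all small $\varepsilon>0$, the minimizer $\mu_p(\varepsilon,u)(x)$ exists and is unique for every $\varepsilon>0$ with $\overline{B_\varepsilon(x)}\subset\Omega$, and $$\mu_p(\varepsilon,u)(x)=u(x)+c\,\Delta^N_{p,\mathbb G}u(x)\,\varepsilon^2+o(\varepsilon^2)\qquad\text{as }\varepsilon\to0^+.$$ -/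

import Mathlib

open MeasureTheory Filter Topology Asymptotics
open scoped ContDiff ENNReal Nat Matrix

noncomputable section

namespace Carnot

/-- The coordinate space `ℝ^{v₁} × ⋯ × ℝ^{v_k}`, with layers indexed by `1, …, k`.
Its measure `volume` is the Lebesgue measure (and its norm, a maximum of Euclidean norms,
is only used for the topology and for differentiation). -/
abbrev Coord (k : ℕ) (v : ℕ → ℕ) : Type :=
  (j : Finset.Icc 1 k) → EuclideanSpace ℝ (Fin (v j))

variable {k : ℕ} {v : ℕ → ℕ}

/-- The component `x^{(j)}` of `x` in the `j`-th layer (zero if there is no `j`-th layer). -/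
def layer (x : Coord k v) (j : ℕ) : EuclideanSpace ℝ (Fin (v j)) :=
  if h : j ∈ Finset.Icc 1 k then x ⟨j, h⟩ else 0

/-- The point whose `j`-th layer is `a` and whose other layers vanish. -/
def ofLayer (j : ℕ) (a : EuclideanSpace ℝ (Fin (v j))) : Coord k v :=
  if h : j ∈ Finset.Icc 1 k then Pi.single ⟨j, h⟩ a else 0

/-- The subspace `V_j` of vectors supported in the `j`-th layer; it is `{0}` for `j = k + 1`. -/
def stratum (k : ℕ) (v : ℕ → ℕ) (j : ℕ) : Submodule ℝ (Coord k v) where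
  carrier := {x | ∀ i : Finset.Icc 1 k, (i : ℕ) ≠ j → x i = 0}
  zero_mem' := fun _ _ => rfl
  add_mem' := fun ha hb i hi => by simp [ha i hi, hb i hi]
  smul_mem' := fun c _ ha i hi => by simp [ha i hi]

/-- The left invariant vector field `J(a)(x) = 𝒥_{τ_x}(0) a` of a group law, where
`τ_x(y) = x · y`. -/
def leftInvField (mul : Coord k v → Coord k v → Coord k v) (a x : Coord k v) : Coord k v :=
  fderiv ℝ (mul x) 0 a

/-- The Lie bracket on the tangent space at the identity `0`: the value at `0` of the commutator
of the left invariant vector fields. -/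
def lieBr (mul : Coord k v → Coord k v → Coord k v) (a b : Coord k v) : Coord k v :=
  VectorField.lieBracket ℝ (leftInvField mul a) (leftInvField mul b) 0

/-- A Carnot group of step `k` whose strata have dimensions `v₁, …, v_k`, in exponential
coordinates: a Lie group structure on `ℝ^{v₁} × ⋯ × ℝ^{v_k}` whose exponential map is the identity
(the lines `t ↦ t x` are the one-parameter subgroups; equivalently, the group law is the
Baker-Campbell-Hausdorff law of the Lie algebra) and whose Lie algebra is stratified by the layers.
The identity is `0` and the inverse of `x` is `-x`, see `zero_mul`, `mul_zero`, `neg_mul_self`,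
`mul_neg_self` below. -/
structure CarnotGroup (k : ℕ) (v : ℕ → ℕ) where
  one_le_step : 1 ≤ k
  dim_pos : ∀ j ∈ Finset.Icc 1 k, 0 < v j
  mul : Coord k v → Coord k v → Coord k v
  contDiff_mul : ContDiff ℝ ∞ (fun z : Coord k v × Coord k v => mul z.1 z.2)
  mul_assoc : ∀ x y z, mul (mul x y) z = mul x (mul y z)
  smul_mul_smul : ∀ (s t : ℝ) (x : Coord k v), mul (s • x) (t • x) = (s + t) • x
  /-- `[V_1, V_j] = V_{j+1}` for `1 ≤ j < k` and `[V_1, V_k] = {0}`. -/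
  span_lieBr : ∀ j ∈ Finset.Icc 1 k,
    Submodule.span ℝ {c | ∃ a ∈ stratum k v 1, ∃ b ∈ stratum k v j, lieBr mul a b = c} =
      stratum k v (j + 1)

namespace CarnotGroup

variable (G : CarnotGroup k v)

theorem zero_mul (x : Coord k v) : G.mul 0 x = x := by
  simpa using G.smul_mul_smul 0 1 x

theorem mul_zero (x : Coord k v) : G.mul x 0 = x := by
  simpa using G.smul_mul_smul 1 0 x

theorem neg_mul_self (x : Coord k v) : G.mul (-x) x = 0 := by
  simpa using G.smul_mul_smul (-1) 1 x

theorem mul_neg_self (x : Coord k v) : G.mul x (-x) = 0 := by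
  simpa using G.smul_mul_smul 1 (-1) x

/-- The homogeneous pseudonorm `(∑_j ‖x^{(j)}‖^{2 k! / j})^{1 / (2 k!)}`. -/
def gnorm (x : Coord k v) : ℝ :=
  (∑ j : Finset.Icc 1 k, ‖x j‖ ^ (2 * (k ! : ℝ) / (j : ℕ))) ^ (1 / (2 * (k ! : ℝ)))

/-- The pseudodistance `d(x, y) = |y⁻¹ · x|`. -/
def gdist (x y : Coord k v) : ℝ := gnorm (G.mul (-y) x)

/-- The pseudoball `B_r(x)`. -/
def ball (x : Coord k v) (r : ℝ) : Set (Coord k v) := {y | G.gdist x y < r}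

/-- The closed pseudoball. -/
def closedBall (x : Coord k v) (r : ℝ) : Set (Coord k v) := {y | G.gdist x y ≤ r}

/-- The horizontal derivative `X_i u`, where `X_i`, `i = 1, …, v₁`, are the first `v₁` fields of the
Jacobian basis. -/
def horizDeriv (i : Fin (v 1)) (u : Coord k v → ℝ) (x : Coord k v) : ℝ :=
  fderiv ℝ u x (leftInvField G.mul (ofLayer 1 (EuclideanSpace.single i 1)) x)

/-- The horizontal gradient `∇_{V₁} u`, in the frame `X_1, …, X_{v₁}`. -/
def horizGrad (u : Coord k v → ℝ) (x : Coord k v) : EuclideanSpace ℝ (Fin (v 1)) :=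
  WithLp.toLp 2 fun i => G.horizDeriv i u x

/-- The intrinsic divergence of a horizontal vector field `∑ F_i X_i`. -/
def horizDiv (F : Coord k v → EuclideanSpace ℝ (Fin (v 1))) (x : Coord k v) : ℝ :=
  ∑ i, G.horizDeriv i (fun y => F y i) x

/-- The symmetrized horizontal Hessian `((X_i X_j + X_j X_i) u / 2)_{ij}`. -/
def symHess (u : Coord k v → ℝ) (x : Coord k v) : Matrix (Fin (v 1)) (Fin (v 1)) ℝ :=
  Matrix.of fun i j =>
    (G.horizDeriv i (G.horizDeriv j u) x + G.horizDeriv j (G.horizDeriv i u) x) / 2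

end CarnotGroup

/-- `m` minimizes `t ↦ ‖u - t‖_{L^p(S)}` over the real numbers. -/
def IsLpMinimizer (p : ℝ≥0∞) (S : Set (Coord k v)) (u : Coord k v → ℝ) (m : ℝ) : Prop :=
  ∀ t : ℝ, eLpNorm (fun y => u y - m) p (volume.restrict S) ≤
    eLpNorm (fun y => u y - t) p (volume.restrict S)

/-- The quadratic form `⟨A ξ, ξ⟩`. -/
def quadForm {n : ℕ} (A : Matrix (Fin n) (Fin n) ℝ) (ξ : EuclideanSpace ℝ (Fin n)) : ℝ :=
  (A *ᵥ ξ.ofLp) ⬝ᵥ ξ.ofLp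

namespace CarnotGroup

variable (G : CarnotGroup k v)

/-- The subelliptic normalized `p`-Laplacian: `div(|∇u|^{p-2} ∇u) / |∇u|^{p-2}` for `p < ∞`, and
`⟨D² u ∇u/|∇u|, ∇u/|∇u|⟩` for `p = ∞`. -/
def normPLaplacian (p : ℝ≥0∞) (u : Coord k v → ℝ) (x : Coord k v) : ℝ :=
  if p = ⊤ then
    quadForm (G.symHess u x) (‖G.horizGrad u x‖⁻¹ • G.horizGrad u x)
  else
    G.horizDiv (fun y => ‖G.horizGrad u y‖ ^ (p.toReal - 2) • G.horizGrad u y) x /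
      ‖G.horizGrad u x‖ ^ (p.toReal - 2)

/-- The generalized median `μ_p(ε, u)(x)`: the minimizer of `t ↦ ‖u - t‖_{L^p}` on the closed
pseudoball of radius `ε` about `x`. -/
def median (p : ℝ≥0∞) (ε : ℝ) (u : Coord k v → ℝ) (x : Coord k v) : ℝ :=
  Classical.epsilon (IsLpMinimizer p (G.closedBall x ε) u)

end CarnotGroup

/-- Euler's Beta function. -/
def betaFn (a b : ℝ) : ℝ := ∫ t in (0 : ℝ)..1, t ^ (a - 1) * (1 - t) ^ (b - 1)

/-- The constant `c(p, v₁, …, v_k)`; for `p = ∞` it is `1 / 2`. -/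
def medianConst (p : ℝ≥0∞) (k : ℕ) (v : ℕ → ℕ) : ℝ :=
  if p = ⊤ then 1 / 2
  else
    1 / (2 * (p.toReal + v 1)) *
      ∏ j ∈ Finset.Icc 2 k,
        (betaFn (j * v j / (2 * (k ! : ℝ)))
            ((p.toReal + ∑ i ∈ Finset.Ico 1 j, (i * v i : ℝ)) / (2 * (k ! : ℝ)) + 1) /
          betaFn (j * v j / (2 * (k ! : ℝ)))
            ((p.toReal - 2 + ∑ i ∈ Finset.Ico 1 j, (i * v i : ℝ)) / (2 * (k ! : ℝ)) + 1))

/-- `tr A + (p - 2) ⟨A ξ, ξ⟩ / |ξ|²` for `p < ∞`, and `⟨A ξ, ξ⟩ / |ξ|²` for `p = ∞`. -/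
def normTrace {n : ℕ} (p : ℝ≥0∞) (A : Matrix (Fin n) (Fin n) ℝ)
    (ξ : EuclideanSpace ℝ (Fin n)) : ℝ :=
  if p = ⊤ then quadForm A ξ / ‖ξ‖ ^ 2
  else A.trace + (p.toReal - 2) * (quadForm A ξ / ‖ξ‖ ^ 2)

end Carnot

end

/-! ### The adjoint representation in exponential coordinates -/

noncomputable section

namespace Carnot.CarnotGroup

variable {k : ℕ} {v : ℕ → ℕ} (G : CarnotGroup k v)

/-! The closed pseudoball of radius ε about x is the image of the unit ball K = {gauge ≤ 1} under z
↦ x · δ_ε z, where δ_ε multiplies the j-th layer by ε^j. Left translations preserve Lebesgue measure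
and δ_ε scales it by ε^Q, with Q the homogeneous dimension. Hence μ_p(ε, u)(x) is the L^p minimizer,
over the fixed set K, of z ↦ u(x · δ_ε z) (`isLpMinimizer_closedBall_iff`). A Taylor expansion of
w(z) = u(x · z) at 0 gives u(x) + ε l(z) + ε² g(z) + o(ε²) uniformly on K, with l = ⟨ξ, z^{(1)}⟩ and
g = ⟨η, z^{(2)}⟩ + ½⟨A z^{(1)}, z^{(1)}⟩, where ξ is the horizontal gradient and A the symmetrized
horizontal Hessian (`eventually_abs_param_taylor_le`). In part (1) this expansion is exact.

For p < ∞ put φ(a) = |a|^{p-2} a. The sign of ∫_K φ(F - t) tells on which side of t the minimizer of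
F lies. At t = u(x) + ε²λ this integral is, after division by ε^{p-1}, ∫_K φ(l + ε(g - λ) + o(ε)).
Its leading term vanishes because l is odd and K is symmetric, and its first variation is (p-1)∫_K
|l|^{p-2}(g - λ). So λ tends to the mean of g with weight |l|^{p-2} (`IsLpMin.isLittleO`); the η
term is odd and drops out. For p = ∞ the minimizer is the midrange. On K the function l has a unique
maximum and a unique minimum, at ±ξ/|ξ| in the first layer, and to order ε² the extrema of the
expansion are its values there (`IsLpMin.isLittleO_top`).

The weighted mean of the quadratic form is found with Gaussians (`integral_unitBall_quadForm`). The
integral of a homogeneous function over {ρ ≤ 1}, for a homogeneous gauge ρ, is up to a Gamma factor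
its integral against e^{-ρ}. The function e^{-gauge} factors over the layers; in the first layer
‖y‖^{2k!} is traded for ‖y‖², and the resulting Gaussian integral factors over coordinates and
yields (tr A + (p-2)⟨Aξ,ξ⟩/|ξ|²)/2. The leftover Gamma factors are the telescoped product of Beta
quotients.

Lebesgue measure is left invariant because each Ad(x) is unipotent, the Lie algebra being graded. A
doubling identity then shows that the Jacobian determinant is the same at x and at 2x, hence equal
to its value 1 at 0 (`det_coframe`). -/

theorem neg_mul_cancel (x y : Coord k v) : G.mul (-x) (G.mul x y) = y := by
  rw [← G.mul_assoc, G.neg_mul_self, G.zero_mul]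

theorem mul_neg_cancel (x y : Coord k v) : G.mul x (G.mul (-x) y) = y := by
  rw [← G.mul_assoc, G.mul_neg_self, G.zero_mul]

theorem mul_left_cancel {x y z : Coord k v} (h : G.mul x y = G.mul x z) : y = z := by
  rw [← G.neg_mul_cancel x y, h, G.neg_mul_cancel]

theorem neg_mul_rev (x y : Coord k v) : -(G.mul x y) = G.mul (-y) (-x) := by
  apply G.mul_left_cancel (x := G.mul x y)
  rw [G.mul_neg_self, G.mul_assoc, G.mul_neg_cancel, G.mul_neg_self]

theorem contDiff_mul_comp {F : Type*} [NormedAddCommGroup F] [NormedSpace ℝ F]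
    {f g : F → Coord k v} {n : ℕ∞} (hf : ContDiff ℝ n f) (hg : ContDiff ℝ n g) :
    ContDiff ℝ n (fun z => G.mul (f z) (g z)) :=
  (G.contDiff_mul.of_le (mod_cast le_top)).comp (hf.prodMk hg)

theorem contDiff_mul_left (x : Coord k v) : ContDiff ℝ ∞ (G.mul x) :=
  G.contDiff_mul_comp contDiff_const contDiff_id

theorem differentiable_mul_left (x : Coord k v) : Differentiable ℝ (G.mul x) :=
  (G.contDiff_mul_left x).differentiable (by simp)

theorem hasFDerivAt_mul_left (x z : Coord k v) :
    HasFDerivAt (G.mul x) (fderiv ℝ (G.mul x) z) z :=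
  (G.differentiable_mul_left x z).hasFDerivAt

/-- The left invariant frame: the differential at `0` of the left translation by `x`. -/
def frame (x : Coord k v) : Coord k v →L[ℝ] Coord k v := fderiv ℝ (G.mul x) 0

theorem leftInvField_eq (a x : Coord k v) : leftInvField G.mul a x = G.frame x a := rfl

theorem contDiff_frame : ContDiff ℝ ∞ G.frame := by
  refine ContDiff.fderiv (m := ∞) (f := G.mul) (g := fun _ => (0 : Coord k v)) ?_
    contDiff_const (by simp)
  exact G.contDiff_mul

theorem differentiable_frame : Differentiable ℝ G.frame :=
  G.contDiff_frame.differentiable (by simp)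

@[simp] theorem frame_zero : G.frame 0 = ContinuousLinearMap.id ℝ _ := by
  have : G.mul 0 = id := funext fun x => G.zero_mul x
  rw [frame, this, fderiv_id]

/-- Translation by t • x shifts the parameter of the one-parameter subgroup of x, so the left
invariant field of x is constant along the line through x. This is the infinitesimal content of
exponential coordinates. -/
theorem frame_smul_self (t : ℝ) (x : Coord k v) : G.frame (t • x) x = x := by
  have h1 : HasFDerivAt (G.mul (t • x)) (G.frame (t • x)) ((0 : ℝ) • x) := by
    rw [zero_smul]; exact G.hasFDerivAt_mul_left _ _
  have h2 : HasDerivAt (fun s : ℝ => s • x) x 0 := by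
    simpa using (hasDerivAt_id (0 : ℝ)).smul_const x
  have h3 := h1.comp_hasDerivAt (0 : ℝ) h2
  have h4 : HasDerivAt (fun s : ℝ => (t + s) • x) x 0 := by
    simpa using ((hasDerivAt_id (0 : ℝ)).const_add t).smul_const x
  have h5 : (G.mul (t • x) ∘ fun s : ℝ => s • x) = fun s : ℝ => (t + s) • x :=
    funext fun s => G.smul_mul_smul t s x
  rw [h5] at h3
  exact h3.unique h4

/-- The mixed second derivative of the group law at the identity. -/
def bil : Coord k v →L[ℝ] Coord k v →L[ℝ] Coord k v := fderiv ℝ G.frame 0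

theorem hasFDerivAt_frame_zero : HasFDerivAt G.frame G.bil 0 :=
  (G.differentiable_frame 0).hasFDerivAt

theorem hasFDerivAt_frame_apply (b : Coord k v) :
    HasFDerivAt (fun x => G.frame x b) (G.bil.flip b) 0 :=
  (ContinuousLinearMap.apply ℝ (Coord k v) b).hasFDerivAt.comp (0 : Coord k v)
    G.hasFDerivAt_frame_zero

theorem hasDerivAt_frame_smul (x b : Coord k v) :
    HasDerivAt (fun t : ℝ => G.frame (t • x) b) (G.bil x b) 0 := by
  have h2 : HasDerivAt (fun s : ℝ => s • x) x 0 := by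
    simpa using (hasDerivAt_id (0 : ℝ)).smul_const x
  have h1 : HasFDerivAt (fun x => G.frame x b) (G.bil.flip b) ((0 : ℝ) • x) := by
    rw [zero_smul]; exact G.hasFDerivAt_frame_apply b
  exact h1.comp_hasDerivAt (0 : ℝ) h2

/-- Differentiate the constant t ↦ frame (t • x) x. The resulting antisymmetry of `bil` makes the
Lie bracket equal to twice `bil`, and later removes the first order terms from the symmetrized
Hessian. -/
theorem bil_self (x : Coord k v) : G.bil x x = 0 := by
  have h := G.hasDerivAt_frame_smul x x
  simp_rw [frame_smul_self] at h
  exact h.unique (hasDerivAt_const _ _)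

theorem bil_antisymm (x y : Coord k v) : G.bil x y = -G.bil y x := by
  have h := G.bil_self (x + y)
  simp only [map_add, add_apply, bil_self] at h
  rw [eq_neg_iff_add_eq_zero, add_comm]
  simpa using h

theorem lieBr_eq (a b : Coord k v) : lieBr G.mul a b = (2 : ℝ) • G.bil a b := by
  have h : ∀ c, fderiv ℝ (leftInvField G.mul c) 0 = G.bil.flip c := fun c =>
    (G.hasFDerivAt_frame_apply c).fderiv
  rw [lieBr, VectorField.lieBracket, h, h, leftInvField_eq, leftInvField_eq]
  simp only [frame_zero, ContinuousLinearMap.flip_apply, ContinuousLinearMap.id_apply]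
  rw [G.bil_antisymm b a, two_smul, sub_neg_eq_add]

/-- Conjugation by `y`. -/
def conj (y z : Coord k v) : Coord k v := G.mul (G.mul y z) (-y)

theorem contDiff_conj_comp {F : Type*} [NormedAddCommGroup F] [NormedSpace ℝ F]
    {f g : F → Coord k v} {n : ℕ∞} (hf : ContDiff ℝ n f) (hg : ContDiff ℝ n g) :
    ContDiff ℝ n (fun z => G.conj (f z) (g z)) :=
  G.contDiff_mul_comp (G.contDiff_mul_comp hf hg) hf.neg

theorem conj_mul (y a b : Coord k v) : G.conj y (G.mul a b) = G.mul (G.conj y a) (G.conj y b) := by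
  simp only [conj, G.mul_assoc, G.neg_mul_cancel]

theorem mul_self (a : Coord k v) : G.mul a a = (2 : ℝ) • a := by
  have := G.smul_mul_smul 1 1 a
  norm_num at this
  exact this

@[simp] theorem conj_zero_right (y : Coord k v) : G.conj y 0 = 0 := by
  simp [conj, G.mul_zero, G.mul_neg_self]

@[simp] theorem conj_zero_left (z : Coord k v) : G.conj 0 z = z := by
  simp [conj, G.mul_zero, G.zero_mul]

theorem conj_two_smul (y a : Coord k v) : G.conj y ((2 : ℝ) • a) = (2 : ℝ) • G.conj y a := by
  rw [← mul_self, conj_mul, mul_self]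

theorem conj_two_pow_smul (y a : Coord k v) (n : ℕ) :
    G.conj y ((2 : ℝ) ^ n • a) = (2 : ℝ) ^ n • G.conj y a := by
  induction n with
  | zero => simp
  | succ n ih => rw [pow_succ', mul_smul, conj_two_smul, ih, mul_smul]

/-- The adjoint representation. -/
def Ad (y : Coord k v) : Coord k v →L[ℝ] Coord k v := fderiv ℝ (G.conj y) 0

/-- Conjugation is a homomorphism and a · a = 2a, so it commutes with multiplication by 2^n. Its
difference quotients at 0 along the scales 2^{-n} are therefore constant, and conjugation equals its
own differential. -/
theorem Ad_apply (y z : Coord k v) : G.Ad y z = G.conj y z := by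
  have hd : HasFDerivAt (G.conj y) (G.Ad y) 0 :=
    (((G.contDiff_conj_comp (n := 1) contDiff_const contDiff_id).differentiable (by simp))
      0).hasFDerivAt
  have ht : Tendsto (fun n : ℕ => ‖(2 : ℝ) ^ n‖) atTop atTop := by
    simpa using tendsto_pow_atTop_atTop_of_one_lt (one_lt_two (α := ℝ))
  have h := hd.lim z ht
  refine tendsto_nhds_unique h ?_
  refine tendsto_const_nhds.congr fun n => ?_
  rw [zero_add, conj_zero_right, sub_zero, ← conj_two_pow_smul, smul_smul,
    mul_inv_cancel₀ (by positivity), one_smul]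

theorem Ad_mul (x y : Coord k v) : G.Ad (G.mul x y) = (G.Ad x).comp (G.Ad y) := by
  ext1 z
  simp only [ContinuousLinearMap.comp_apply, Ad_apply, conj, G.mul_assoc, G.neg_mul_rev]

/-- y · z = (y z y⁻¹) · y, and inversion turns the right factor y into a left translation: a · y =
-((-y) · (-a)). -/
theorem frame_eq_frame_neg_comp (y w : Coord k v) : G.frame y w = G.frame (-y) (G.Ad y w) := by
  have h1 : ∀ z, G.mul y z = -(G.mul (-y) (-(G.Ad y z))) := fun z => by
    rw [G.neg_mul_rev, neg_neg, neg_neg, Ad_apply, conj, G.mul_assoc, G.neg_mul_self, G.mul_zero]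
  have h2 : HasFDerivAt (G.mul y) (G.frame y) 0 := G.hasFDerivAt_mul_left _ _
  have h3 : HasFDerivAt (G.mul (-y)) (G.frame (-y)) (-(G.Ad y 0)) := by
    rw [map_zero, neg_zero]; exact G.hasFDerivAt_mul_left (-y) 0
  have h4 := (h3.comp (0 : Coord k v) (G.Ad y).hasFDerivAt.neg).neg
  have h5 : G.mul y = fun z => -(G.mul (-y) (-(G.Ad y z))) := funext h1
  rw [h5] at h2
  have h6 := h2.unique h4
  rw [h6]
  simp

/-- Differentiate frame (hx) w = frame (-hx) (Ad (hx) w) at h = 0. The left side gives `bil x w`,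
the right side gives -`bil x w` plus the derivative sought. -/
theorem hasDerivAt_Ad_smul_zero (x w : Coord k v) :
    HasDerivAt (fun h : ℝ => G.Ad (h • x) w) ((2 : ℝ) • G.bil x w) 0 := by
  have hd : DifferentiableAt ℝ (fun h : ℝ => G.Ad (h • x) w) 0 := by
    simp only [Ad_apply]
    exact (G.contDiff_conj_comp (n := 1) (contDiff_id.smul contDiff_const)
      contDiff_const).differentiable (by simp) 0
  have h1 : HasDerivAt (fun h : ℝ => G.frame (h • (-x))) (G.bil (-x)) 0 := by
    have h2 : HasDerivAt (fun s : ℝ => s • (-x)) (-x) 0 := by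
      simpa using (hasDerivAt_id (0 : ℝ)).smul_const (-x)
    have h1 : HasFDerivAt G.frame G.bil ((0 : ℝ) • (-x)) := by
      rw [zero_smul]; exact G.hasFDerivAt_frame_zero
    exact h1.comp_hasDerivAt (0 : ℝ) h2
  have h2 := h1.clm_apply hd.hasDerivAt
  have h3 := G.hasDerivAt_frame_smul x w
  have h4 : (fun t : ℝ => G.frame (t • x) w) = fun t : ℝ => G.frame (t • (-x)) (G.Ad (t • x) w) := by
    funext t
    rw [frame_eq_frame_neg_comp, smul_neg]
  rw [h4] at h3
  have h5 := h3.unique h2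
  have h6 : deriv (fun h : ℝ => G.Ad (h • x) w) 0 = (2 : ℝ) • G.bil x w := by
    simp only [zero_smul, frame_zero, ContinuousLinearMap.id_apply, map_neg, Ad_apply,
      conj_zero_left, neg_apply] at h5
    rw [two_smul]
    simp only [Ad_apply]
    nth_rewrite 1 [h5]
    abel
  exact h6 ▸ hd.hasDerivAt

/-- The adjoint representation of the Lie algebra. -/
def ad (x : Coord k v) : Coord k v →L[ℝ] Coord k v := (2 : ℝ) • G.bil x

theorem ad_apply (x w : Coord k v) : G.ad x w = (2 : ℝ) • G.bil x w := rfl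

theorem lieBr_eq_ad (a b : Coord k v) : lieBr G.mul a b = G.ad a b := G.lieBr_eq a b

theorem hasDerivAt_Ad_smul (x w : Coord k v) (h : ℝ) :
    HasDerivAt (fun h : ℝ => G.Ad (h • x) w) (G.Ad (h • x) (G.ad x w)) h := by
  have h1 : HasDerivAt (fun s : ℝ => G.Ad (s • x) w) (G.ad x w) (id h - h) := by
    rw [id, sub_self]; exact G.hasDerivAt_Ad_smul_zero x w
  have h2 : HasDerivAt (fun s : ℝ => G.Ad ((s - h) • x) w) (G.ad x w) h := by
    have h3 := HasDerivAt.scomp_of_eq h h1 ((hasDerivAt_id h).sub_const h) rfl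
    rwa [one_smul] at h3
  have h3 := (G.Ad (h • x)).hasFDerivAt.comp_hasDerivAt h h2
  refine h3.congr_of_eventuallyEq (Eventually.of_forall fun s => ?_)
  simp only [Function.comp]
  rw [← ContinuousLinearMap.comp_apply, ← Ad_mul, G.smul_mul_smul]
  simp

theorem Ad_zero : G.Ad 0 = ContinuousLinearMap.id ℝ _ := by
  ext1 z; simp [Ad_apply]

/-- The derivative of h ↦ Ad (hx) w is Ad (hx) (ad x w) = 0. This takes the place of the exponential
series of `ad x`. -/
theorem Ad_smul_of_ad_eq_zero {x w : Coord k v} (hw : G.ad x w = 0) (h : ℝ) :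
    G.Ad (h • x) w = w := by
  have hd : Differentiable ℝ (fun h : ℝ => G.Ad (h • x) w) := fun h =>
    (G.hasDerivAt_Ad_smul x w h).differentiableAt
  have := is_const_of_deriv_eq_zero hd (fun h => by
    rw [(G.hasDerivAt_Ad_smul x w h).deriv, hw, map_zero]) h 0
  simpa [Ad_zero] using this

theorem Ad_frame (y a b : Coord k v) : G.Ad y (G.frame a b) = G.frame (G.Ad y a) (G.Ad y b) := by
  have h1 : ∀ z, G.Ad y (G.mul a z) = G.mul (G.Ad y a) (G.Ad y z) := fun z => by
    simp only [Ad_apply, conj_mul]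
  have h2 := (G.Ad y).hasFDerivAt.comp (0 : Coord k v) (G.hasFDerivAt_mul_left a 0)
  have h3 : HasFDerivAt (G.mul (G.Ad y a)) (G.frame (G.Ad y a)) (G.Ad y 0) := by
    rw [map_zero]; exact G.hasFDerivAt_mul_left (G.Ad y a) 0
  have h4 := h3.comp (0 : Coord k v) (G.Ad y).hasFDerivAt
  have h5 : (⇑(G.Ad y) ∘ G.mul a) = (G.mul (G.Ad y a) ∘ ⇑(G.Ad y)) := funext h1
  rw [h5] at h2
  exact congrArg (fun L : Coord k v →L[ℝ] Coord k v => L b) (h2.unique h4)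

theorem Ad_bil (y a b : Coord k v) : G.Ad y (G.bil a b) = G.bil (G.Ad y a) (G.Ad y b) := by
  have h1 := (G.Ad y).hasFDerivAt.comp_hasDerivAt (0 : ℝ) (G.hasDerivAt_frame_smul a b)
  have h2 := G.hasDerivAt_frame_smul (G.Ad y a) (G.Ad y b)
  refine h1.unique (h2.congr_of_eventuallyEq (Eventually.of_forall fun t => ?_))
  simp only [Function.comp, Ad_frame, map_smul]

theorem Ad_ad (y a b : Coord k v) : G.Ad y (G.ad a b) = G.ad (G.Ad y a) (G.Ad y b) := by
  simp only [ad_apply, map_smul, Ad_bil]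

/-- The Jacobi identity, as the derivative at h = 0 of the fact that Ad (hx) respects `bil`. -/
theorem ad_bil (x a b : Coord k v) :
    G.ad x (G.bil a b) = G.bil (G.ad x a) b + G.bil a (G.ad x b) := by
  have h1 := G.hasDerivAt_Ad_smul_zero x (G.bil a b)
  have h2 := (G.bil.hasFDerivAt.comp_hasDerivAt (0 : ℝ)
    (G.hasDerivAt_Ad_smul_zero x a)).clm_apply (G.hasDerivAt_Ad_smul_zero x b)
  simp only [Ad_bil] at h1
  have h3 := h1.unique h2
  simpa [Ad_zero, ad_apply] using h3

end Carnot.CarnotGroup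

/-! ### Grading, unipotence and left invariance of Lebesgue measure -/

theorem LinearMap.det_one_add_of_isNilpotent {R M : Type*} [CommRing R] [IsDomain R]
    [AddCommGroup M] [Module R M] [Module.Free R M] [Module.Finite R M] {f : Module.End R M}
    (hf : IsNilpotent f) : LinearMap.det (1 + f) = 1 := by
  have h := (-f).det_eq_sign_charpoly_coeff
  have h1 : (-f).charpoly.eval 1 = 1 := by
    rw [hf.neg.charpoly_eq_X_pow_finrank]; simp
  rw [← h1, LinearMap.eval_charpoly]
  simp

namespace Carnot

variable {k : ℕ} {v : ℕ → ℕ}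

theorem eq_zero_of_mem_stratum {j : ℕ} {x : Coord k v} (hj : k < j) (hx : x ∈ stratum k v j) :
    x = 0 :=
  funext fun i => hx i (by have := Finset.mem_Icc.1 i.2; omega)

theorem single_mem_stratum (i : Finset.Icc 1 k) (a : EuclideanSpace ℝ (Fin (v i))) :
    (Pi.single i a : Coord k v) ∈ stratum k v i := fun _ hl =>
  Pi.single_eq_of_ne (M := fun i : Finset.Icc 1 k => EuclideanSpace ℝ (Fin (v i)))
    (fun h => hl (congrArg Subtype.val h)) a

namespace CarnotGroup

variable (G : CarnotGroup k v)

theorem bil_mem_of_mem_stratum_one {j : ℕ} (hj : 1 ≤ j) {a b : Coord k v}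
    (ha : a ∈ stratum k v 1) (hb : b ∈ stratum k v j) : G.bil a b ∈ stratum k v (j + 1) := by
  rcases le_or_gt j k with hjk | hjk
  · have h : lieBr G.mul a b ∈ stratum k v (j + 1) := by
      rw [← G.span_lieBr j (Finset.mem_Icc.2 ⟨hj, hjk⟩)]
      exact Submodule.subset_span ⟨a, ha, b, hb, rfl⟩
    rw [lieBr_eq] at h
    exact (Submodule.smul_mem_iff _ two_ne_zero).1 h
  · rw [eq_zero_of_mem_stratum hjk hb, map_zero]
    exact Submodule.zero_mem _

/-- The structure only controls brackets with V_1. Since V_{i+1} is spanned by [V_1, V_i], induction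
on i and the Jacobi identity [[a', b'], b] = [a', [b', b]] - [b', [a', b]], with a' in V_1 and b' in
V_i, give all degrees. -/
theorem bil_mem_stratum {i j : ℕ} (hi : 1 ≤ i) (hj : 1 ≤ j) {a b : Coord k v}
    (ha : a ∈ stratum k v i) (hb : b ∈ stratum k v j) : G.bil a b ∈ stratum k v (i + j) := by
  induction i, hi using Nat.le_induction generalizing j a b with
  | base => rw [add_comm]; exact G.bil_mem_of_mem_stratum_one hj ha hb
  | succ i hi ih =>
    rcases le_or_gt i k with hik | hik
    · rw [← G.span_lieBr i (Finset.mem_Icc.2 ⟨hi, hik⟩)] at ha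
      induction ha using Submodule.span_induction with
      | zero => simp
      | add x y _ _ hx hy =>
        rw [map_add, add_apply]
        exact Submodule.add_mem _ hx hy
      | smul c x _ hx =>
        rw [map_smul, smul_apply]
        exact Submodule.smul_mem _ c hx
      | mem c hc =>
        obtain ⟨a', ha', b', hb', rfl⟩ := hc
        have h1 := G.ad_bil a' b' b
        rw [lieBr_eq_ad, ← sub_eq_of_eq_add h1]
        refine Submodule.sub_mem _ ?_ ?_
        · have := G.bil_mem_of_mem_stratum_one (by omega) ha' (ih hj hb' hb)
          rw [show i + 1 + j = i + j + 1 by ring]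
          exact Submodule.smul_mem _ _ this
        · have := G.bil_mem_of_mem_stratum_one hj ha' hb
          rw [show i + 1 + j = i + (j + 1) by ring]
          exact ih (by omega) hb' (Submodule.smul_mem _ _ this)
    · rw [eq_zero_of_mem_stratum (by omega) ha]
      simp

/-- Every layer has degree at least 1, so bracketing with x raises the lowest degree that occurs in
z. After k brackets nothing is left. -/
theorem ad_apply_eq_zero (x : Coord k v) {j : ℕ} {z : Coord k v}
    (hz : ∀ i : Finset.Icc 1 k, (i : ℕ) < j → z i = 0) (i : Finset.Icc 1 k)
    (hi : (i : ℕ) < j + 1) : G.ad x z i = 0 := by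
  have hx : x = ∑ l, Pi.single l (x l) := (Finset.univ_sum_single x).symm
  have hz' : z = ∑ l, Pi.single l (z l) := (Finset.univ_sum_single z).symm
  rw [ad_apply, hx, hz']
  simp only [map_sum, _root_.sum_apply, Finset.smul_sum, Finset.sum_apply]
  refine Finset.sum_eq_zero fun m _ => Finset.sum_eq_zero fun l _ => ?_
  rcases lt_or_ge (m : ℕ) j with hm | hm
  · rw [hz m hm]; simp
  · have hl := (Finset.mem_Icc.1 l.2).1
    have := G.bil_mem_stratum hl (Finset.mem_Icc.1 m.2).1
      (single_mem_stratum l (x l)) (single_mem_stratum m (z m)) i (by omega)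
    rw [Pi.smul_apply, this, smul_zero]

theorem ad_pow_apply_eq_zero (x z : Coord k v) (m : ℕ) (i : Finset.Icc 1 k)
    (hi : (i : ℕ) < m + 1) : (((G.ad x : Coord k v →ₗ[ℝ] Coord k v)) ^ m) z i = 0 := by
  induction m generalizing i with
  | zero => exact absurd (Finset.mem_Icc.1 i.2).1 (by omega)
  | succ m ih =>
    rw [pow_succ', Module.End.mul_apply]
    exact G.ad_apply_eq_zero x (j := m + 1) (fun l hl => ih l hl) i hi

theorem ad_pow_step (x z : Coord k v) :
    (((G.ad x : Coord k v →ₗ[ℝ] Coord k v)) ^ k) z = 0 :=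
  funext fun i => G.ad_pow_apply_eq_zero x z k i (by have := Finset.mem_Icc.1 i.2; omega)

theorem Ad_self (x : Coord k v) : G.Ad x x = x := by
  rw [Ad_apply, conj, G.mul_assoc, G.mul_neg_self, G.mul_zero]

theorem ad_pow_Ad (x w : Coord k v) (m : ℕ) :
    (((G.ad x : Coord k v →ₗ[ℝ] Coord k v)) ^ m) (G.Ad x w) =
      G.Ad x ((((G.ad x : Coord k v →ₗ[ℝ] Coord k v)) ^ m) w) := by
  induction m with
  | zero => simp
  | succ m ih =>
    rw [pow_succ', Module.End.mul_apply, ih, Module.End.mul_apply]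
    simp only [ContinuousLinearMap.coe_coe, Ad_ad, Ad_self]

/-- If ad(x)^{m+1} w = 0, then Ad(x) fixes ad(x)^m w. As Ad(x) commutes with ad(x), the power
ad(x)^m annihilates (Ad(x) - 1) w, and induction applies to that vector. -/
theorem Ad_sub_one_pow_eq_zero (x : Coord k v) (m : ℕ) (w : Coord k v)
    (hw : (((G.ad x : Coord k v →ₗ[ℝ] Coord k v)) ^ m) w = 0) :
    (((G.Ad x : Coord k v →ₗ[ℝ] Coord k v) - 1) ^ m) w = 0 := by
  induction m generalizing w with
  | zero => simpa using hw
  | succ m ih =>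
    rw [pow_succ, Module.End.mul_apply]
    apply ih
    rw [pow_succ', Module.End.mul_apply] at hw
    rw [LinearMap.sub_apply, map_sub, ContinuousLinearMap.coe_coe, ad_pow_Ad,
      Module.End.one_apply, sub_eq_zero]
    simpa using G.Ad_smul_of_ad_eq_zero hw 1

theorem isNilpotent_Ad_sub_one (x : Coord k v) :
    IsNilpotent ((G.Ad x : Coord k v →ₗ[ℝ] Coord k v) - 1) :=
  ⟨k, LinearMap.ext fun w => G.Ad_sub_one_pow_eq_zero x k w (G.ad_pow_step x w)⟩

/-- The differential of the left translation by `-x` at `x`. -/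
def coframe (x : Coord k v) : Coord k v →L[ℝ] Coord k v := fderiv ℝ (G.mul (-x)) x

theorem continuous_coframe : Continuous G.coframe := by
  have : ContDiff ℝ 0 fun x => fderiv ℝ ((fun x => G.mul (-x)) x) (id x) :=
    ContDiff.fderiv (m := 1) (G.contDiff_mul_comp (n := 1) contDiff_fst.neg contDiff_snd)
      contDiff_id (by simp)
  exact this.continuous

theorem hasFDerivAt_mul_zero :
    HasFDerivAt (fun z : Coord k v × Coord k v => G.mul z.1 z.2)
      (ContinuousLinearMap.fst ℝ (Coord k v) (Coord k v) +
        ContinuousLinearMap.snd ℝ (Coord k v) (Coord k v)) (0, 0) := by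
  obtain ⟨L, hd⟩ : ∃ L : Coord k v × Coord k v →L[ℝ] Coord k v,
      HasFDerivAt (fun z : Coord k v × Coord k v => G.mul z.1 z.2) L (0, 0) :=
    G.contDiff_mul.differentiable (by simp) (0, 0)
  have h1 : ∀ a, L (a, 0) = a := fun a => by
    have h := HasFDerivAt.comp (g := fun z : Coord k v × Coord k v => G.mul z.1 z.2)
      (f := fun a : Coord k v => (a, (0 : Coord k v))) (0 : Coord k v) hd
      (hasFDerivAt_prodMk_left (𝕜 := ℝ) (0 : Coord k v) (0 : Coord k v))
    have h' : ((fun z : Coord k v × Coord k v => G.mul z.1 z.2) ∘ fun a => (a, 0)) = id :=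
      funext fun a => G.mul_zero a
    rw [h'] at h
    exact (congrArg (fun T : Coord k v →L[ℝ] Coord k v => T a) ((hasFDerivAt_id _).unique h)).symm
  have h2 : ∀ a, L (0, a) = a := fun a => by
    have h := HasFDerivAt.comp (g := fun z : Coord k v × Coord k v => G.mul z.1 z.2)
      (f := fun a : Coord k v => ((0 : Coord k v), a)) (0 : Coord k v) hd
      (hasFDerivAt_prodMk_right (𝕜 := ℝ) (0 : Coord k v) (0 : Coord k v))
    have h' : ((fun z : Coord k v × Coord k v => G.mul z.1 z.2) ∘ fun a => (0, a)) = id :=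
      funext fun a => G.zero_mul a
    rw [h'] at h
    exact (congrArg (fun T : Coord k v →L[ℝ] Coord k v => T a) ((hasFDerivAt_id _).unique h)).symm
  have h3 : L = ContinuousLinearMap.fst ℝ (Coord k v) (Coord k v) +
      ContinuousLinearMap.snd ℝ (Coord k v) (Coord k v) := by
    refine ContinuousLinearMap.ext fun z => ?_
    have : z = (z.1, 0) + (0, z.2) := by simp
    rw [this, map_add, map_add, h1, h2]
    simp
  exact h3 ▸ hd

/-- Since 2y = y · y, with b = (-x) · y one has (-2x) · (2y) = Ad(-x)(b) · b. At y = x both factors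
are 0, where the differential of the product is the sum of the two components. -/
theorem two_smul_coframe (x : Coord k v) :
    (2 : ℝ) • G.coframe ((2 : ℝ) • x) =
      ((1 : Coord k v →L[ℝ] Coord k v) + G.Ad (-x)).comp (G.coframe x) := by
  have hg : HasFDerivAt (G.mul (-x)) (G.coframe x) x := G.hasFDerivAt_mul_left _ _
  have h1 : HasFDerivAt (fun y => G.mul (-((2 : ℝ) • x)) ((2 : ℝ) • y))
      ((G.coframe ((2 : ℝ) • x)).comp ((2 : ℝ) • ContinuousLinearMap.id ℝ _)) x :=
    (G.hasFDerivAt_mul_left (-((2 : ℝ) • x)) ((2 : ℝ) • x)).comp x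
      ((hasFDerivAt_id x).const_smul (2 : ℝ))
  have h2 : ∀ y, G.mul (-((2 : ℝ) • x)) ((2 : ℝ) • y) =
      G.mul (G.Ad (-x) (G.mul (-x) y)) (G.mul (-x) y) := fun y => by
    rw [← G.mul_self, ← G.mul_self, neg_mul_rev, Ad_apply, conj, neg_neg]
    simp only [G.mul_assoc, G.mul_neg_cancel]
  have hp : HasFDerivAt (fun y => (G.Ad (-x) (G.mul (-x) y), G.mul (-x) y))
      (((G.Ad (-x)).comp (G.coframe x)).prod (G.coframe x)) x :=
    ((G.Ad (-x)).hasFDerivAt.comp x hg).prodMk hg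
  have h0 : HasFDerivAt (fun z : Coord k v × Coord k v => G.mul z.1 z.2)
      (ContinuousLinearMap.fst ℝ _ _ + ContinuousLinearMap.snd ℝ _ _)
      (G.Ad (-x) (G.mul (-x) x), G.mul (-x) x) := by
    rw [neg_mul_self, map_zero]; exact G.hasFDerivAt_mul_zero
  have h3 := h0.comp x hp
  have h4 : (fun y => G.mul (-((2 : ℝ) • x)) ((2 : ℝ) • y)) =
      ((fun z : Coord k v × Coord k v => G.mul z.1 z.2) ∘
        fun y => (G.Ad (-x) (G.mul (-x) y), G.mul (-x) y)) := funext h2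
  rw [h4] at h1
  have h5 := h1.unique h3
  refine ContinuousLinearMap.ext fun w => ?_
  have h6 := congrArg (fun T : Coord k v →L[ℝ] Coord k v => T w) h5
  simp only [ContinuousLinearMap.comp_apply, smul_apply, map_smul,
    ContinuousLinearMap.id_apply, add_apply, ContinuousLinearMap.coe_fst',
    ContinuousLinearMap.coe_snd', ContinuousLinearMap.prod_apply] at h6 ⊢
  rw [h6, add_comm]
  rfl

/-- After division by 2 the factor 1 + Ad(-x) is 1 + (Ad(-x) - 1)/2, which is unipotent. -/
theorem det_coframe_two_smul (x : Coord k v) :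
    (G.coframe ((2 : ℝ) • x)).det = (G.coframe x).det := by
  have h := G.two_smul_coframe x
  have hu : LinearMap.det ((1 : Module.End ℝ (Coord k v)) +
      (2⁻¹ : ℝ) • ((G.Ad (-x) : Coord k v →ₗ[ℝ] Coord k v) - 1)) = 1 :=
    LinearMap.det_one_add_of_isNilpotent ((G.isNilpotent_Ad_sub_one (-x)).smul _)
  have h1 : (G.coframe ((2 : ℝ) • x) : Coord k v →ₗ[ℝ] Coord k v) =
      ((1 : Module.End ℝ (Coord k v)) +
      (2⁻¹ : ℝ) • ((G.Ad (-x) : Coord k v →ₗ[ℝ] Coord k v) - 1)) ∘ₗ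
        (G.coframe x : Coord k v →ₗ[ℝ] Coord k v) := by
    refine LinearMap.ext fun w => ?_
    have h6 := congrArg (fun T : Coord k v →L[ℝ] Coord k v => (2⁻¹ : ℝ) • T w) h
    simp only [smul_apply, ContinuousLinearMap.comp_apply, add_apply,
      smul_smul, inv_mul_cancel₀ (two_ne_zero (α := ℝ)), one_smul] at h6
    change G.coframe ((2 : ℝ) • x) w = G.coframe x w +
      (2⁻¹ : ℝ) • (G.Ad (-x) (G.coframe x w) - G.coframe x w)
    rw [h6]
    change (2⁻¹ : ℝ) • (G.coframe x w + G.Ad (-x) (G.coframe x w)) = _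
    module
  rw [ContinuousLinearMap.det, h1, LinearMap.det_comp, hu, one_mul]

/-- The determinant is constant along x/2^n, which tends to 0, and translation by 0 is the identity.
-/
theorem det_coframe (x : Coord k v) : (G.coframe x).det = 1 := by
  have h1 : ∀ n : ℕ, (G.coframe (((2 : ℝ)⁻¹) ^ n • x)).det = (G.coframe x).det := fun n => by
    induction n with
    | zero => simp
    | succ n ih =>
      rw [← ih, ← det_coframe_two_smul, smul_smul]
      congr 3
      rw [pow_succ]; ring_nf
  have h2 : Tendsto (fun n : ℕ => ((2 : ℝ)⁻¹) ^ n • x) atTop (𝓝 ((0 : ℝ) • x)) :=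
    (tendsto_pow_atTop_nhds_zero_of_lt_one (by norm_num) (by norm_num)).smul_const x
  have h3 := ((ContinuousLinearMap.continuous_det.comp G.continuous_coframe).tendsto _).comp h2
  have h4 : Tendsto (fun _ : ℕ => (G.coframe x).det) atTop
      (𝓝 ((ContinuousLinearMap.det ∘ G.coframe) ((0 : ℝ) • x))) :=
    h3.congr fun n => h1 n
  have h5 := tendsto_nhds_unique tendsto_const_nhds h4
  rw [h5]
  have h6 : G.mul (-0) = id := by rw [neg_zero]; exact funext fun x => G.zero_mul x
  simp only [Function.comp, zero_smul, coframe, h6, fderiv_id]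
  exact LinearMap.det_id

theorem det_fderiv_mul_left (x z : Coord k v) : (fderiv ℝ (G.mul x) z).det = 1 := by
  have h1 := (G.hasFDerivAt_mul_left (-(G.mul x z)) (G.mul x z)).comp z
    (G.hasFDerivAt_mul_left x z)
  have h2 : G.mul (-(G.mul x z)) ∘ G.mul x = G.mul (-z) := funext fun y => by
    rw [Function.comp, neg_mul_rev, G.mul_assoc, neg_mul_cancel]
  rw [h2] at h1
  have h3 : G.coframe z = (G.coframe (G.mul x z)).comp (fderiv ℝ (G.mul x) z) := h1.fderiv
  have h4 := G.det_coframe z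
  rw [h3, ContinuousLinearMap.det, ContinuousLinearMap.toLinearMap_comp, LinearMap.det_comp] at h4
  have h5 := G.det_coframe (G.mul x z)
  rw [ContinuousLinearMap.det] at h5
  rwa [h5, one_mul] at h4

/-- Left translation as a homeomorphism. -/
def leftHomeo (x : Coord k v) : Coord k v ≃ₜ Coord k v where
  toFun := G.mul x
  invFun := G.mul (-x)
  left_inv := G.neg_mul_cancel x
  right_inv := G.mul_neg_cancel x
  continuous_toFun := (G.contDiff_mul_left x).continuous
  continuous_invFun := (G.contDiff_mul_left (-x)).continuous

theorem measurePreserving_mul_left (x : Coord k v) :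
    MeasurePreserving (G.mul x) volume volume := by
  refine ⟨(G.leftHomeo x).continuous.measurable, ?_⟩
  have h := map_withDensity_abs_det_fderiv_eq_addHaar (E := Coord k v) (s := Set.univ)
    (f := G.mul x) (f' := fun z => fderiv ℝ (G.mul x) z) volume
    MeasurableSet.univ.nullMeasurableSet
    (fun z _ => (G.hasFDerivAt_mul_left x z).hasFDerivWithinAt)
    (G.leftHomeo x).injective.injOn
  simp only [det_fderiv_mul_left, abs_one, ENNReal.ofReal_one, Measure.restrict_univ,
    Set.image_univ] at h
  rw [show (fun _ : Coord k v => (1 : ℝ≥0∞)) = 1 from rfl, withDensity_one] at h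
  rw [h, show Set.range (G.mul x) = Set.univ from (G.leftHomeo x).surjective.range_eq,
    Measure.restrict_univ]

end CarnotGroup

end Carnot

/-! ### Odd powers and L^p minimizers for 1 < p < ∞ -/

namespace Carnot

/-- The odd power `|a|^{P-2} a`. -/
def signedPow (P a : ℝ) : ℝ := |a| ^ (P - 2) * a

theorem measurable_signedPow (P : ℝ) : Measurable (signedPow P) := by
  unfold signedPow; fun_prop

theorem signedPow_neg (P a : ℝ) : signedPow P (-a) = -signedPow P a := by
  simp [signedPow]

theorem signedPow_mul_self {P : ℝ} (hP : 1 < P) (a : ℝ) : signedPow P a * a = |a| ^ P := by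
  rcases eq_or_ne a 0 with rfl | ha
  · simp [signedPow, Real.zero_rpow (by linarith : P ≠ 0)]
  · rw [signedPow, mul_assoc, ← abs_mul_abs_self a, ← pow_two, ← Real.rpow_natCast,
      ← Real.rpow_add (abs_pos.2 ha)]
    congr 1; push_cast; ring

theorem abs_signedPow {P : ℝ} (hP : 1 < P) (a : ℝ) : |signedPow P a| = |a| ^ (P - 1) := by
  rcases eq_or_ne a 0 with rfl | ha
  · simp [signedPow, Real.zero_rpow (by linarith : P - 1 ≠ 0)]
  · rw [signedPow, abs_mul, abs_of_nonneg (by positivity : 0 ≤ |a| ^ (P - 2))]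
    nth_rewrite 2 [← Real.rpow_one |a|]
    rw [← Real.rpow_add (abs_pos.2 ha)]
    congr 1; ring

/-- Young's inequality for b and |a|^{P-2} a: the conjugate power of the second factor is |a|^P.
Monotonicity of `signedPow` and the sign test for minimizers both follow from this form of
convexity. -/
theorem abs_rpow_subgradient {P : ℝ} (hP : 1 < P) (a b : ℝ) :
    |a| ^ P + P * signedPow P a * (b - a) ≤ |b| ^ P := by
  have hP0 : 0 < P := by linarith
  have hc : P.HolderConjugate (Real.conjExponent P) := Real.HolderConjugate.conjExponent hP
  have h := Real.young_inequality b (signedPow P a) hc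
  have h1 : |signedPow P a| ^ Real.conjExponent P = |a| ^ P := by
    rw [abs_signedPow hP, ← Real.rpow_mul (abs_nonneg a), Real.conjExponent,
      mul_div_cancel₀ _ (by linarith : P - 1 ≠ 0)]
  have h2 : 1 / Real.conjExponent P = 1 - 1 / P := by
    rw [one_div, one_div]; exact hc.one_sub_inv.symm
  rw [h1, div_eq_mul_one_div (|a| ^ P), h2] at h
  have h3 := mul_le_mul_of_nonneg_left h hP0.le
  have h4 : P * (|b| ^ P / P + |a| ^ P * (1 - 1 / P)) = |b| ^ P + (P - 1) * |a| ^ P := by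
    field_simp
  rw [h4] at h3
  have h5 := signedPow_mul_self hP a
  calc |a| ^ P + P * signedPow P a * (b - a)
      = |a| ^ P + P * (b * signedPow P a) - P * (signedPow P a * a) := by ring
    _ ≤ |b| ^ P := by rw [h5]; linarith

theorem signedPow_mono {P : ℝ} (hP : 1 < P) : Monotone (signedPow P) := by
  intro a b hab
  rcases hab.eq_or_lt with rfl | hlt
  · exact le_rfl
  have h1 := abs_rpow_subgradient hP a b
  have h2 := abs_rpow_subgradient hP b a
  have h3 : 0 ≤ P * ((signedPow P b - signedPow P a) * (b - a)) := by linarith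
  have h4 := (mul_nonneg_iff_of_pos_left (by linarith)).1 h3
  have h5 := (mul_nonneg_iff_of_pos_right (sub_pos.2 hlt)).1 h4
  linarith

theorem abs_rpow_midpoint_lt {P : ℝ} (hP : 1 < P) {a b : ℝ} (hab : a ≠ b) :
    |(a + b) / 2| ^ P < (|a| ^ P + |b| ^ P) / 2 := by
  have hP0 : 0 < P := by linarith
  rcases eq_or_ne |a| |b| with h | h
  · rcases abs_eq_abs.1 h with h' | h'
    · exact absurd h' hab
    · have hb : b ≠ 0 := fun hb => hab (by simp [h', hb])
      have : 0 < |b| ^ P := Real.rpow_pos_of_pos (abs_pos.2 hb) P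
      simp only [h', neg_add_cancel, zero_div, abs_zero, Real.zero_rpow hP0.ne', abs_neg]
      linarith
  · have h1 := (strictConvexOn_rpow hP).2 (abs_nonneg a) (abs_nonneg b) h
      (by norm_num : (0 : ℝ) < 1 / 2) (by norm_num : (0 : ℝ) < 1 / 2) (by norm_num)
    simp only [smul_eq_mul] at h1
    have h2 : |(a + b) / 2| ^ P ≤ (1 / 2 * |a| + 1 / 2 * |b|) ^ P := by
      refine Real.rpow_le_rpow (abs_nonneg _) ?_ hP0.le
      rw [abs_div, abs_two]
      linarith [abs_add_le a b]
    linarith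

theorem hasDerivAt_signedPow_of_ne {P : ℝ} {x : ℝ} (hx : x ≠ 0) :
    HasDerivAt (signedPow P) ((P - 1) * |x| ^ (P - 2)) x := by
  have h1 := ((hasDerivAt_abs hx).rpow_const (p := P - 2) (Or.inl (abs_ne_zero.2 hx))).mul
    (hasDerivAt_id x)
  refine h1.congr_deriv ?_
  have h2 : (SignType.sign x : ℝ) * x = |x| := sign_mul_self x
  have h3 : |x| ^ (P - 2 - 1) * |x| = |x| ^ (P - 2) := by
    rw [← Real.rpow_add_one (abs_ne_zero.2 hx)]; ring_nf
  simp only [id]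
  calc _ = (P - 2) * (|x| ^ (P - 2 - 1) * ((SignType.sign x : ℝ) * x)) + |x| ^ (P - 2) := by ring
    _ = _ := by rw [h2, h3]; ring

theorem hasDerivAt_signedPow {P : ℝ} (hP : 2 ≤ P) (x : ℝ) :
    HasDerivAt (signedPow P) ((P - 1) * |x| ^ (P - 2)) x := by
  rcases eq_or_ne x 0 with rfl | hx
  · rw [hasDerivAt_iff_tendsto_slope]
    -- At 0 the claimed derivative is 0 if P > 2, and 1 if P = 2 by the convention 0^0 = 1. In both
    -- cases it is the limit of the difference quotient |y|^{P-2}.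
    have h1 : (P - 1) * |(0 : ℝ)| ^ (P - 2) = |(0 : ℝ)| ^ (P - 2) := by
      rcases hP.eq_or_lt with rfl | hlt
      · norm_num
      · rw [abs_zero, Real.zero_rpow (by linarith), mul_zero]
    rw [h1]
    have hc : ContinuousAt (fun y : ℝ => |y| ^ (P - 2)) 0 :=
      (continuous_abs.rpow_const fun _ => Or.inr (by linarith)).continuousAt
    refine (hc.tendsto.mono_left nhdsWithin_le_nhds).congr' ?_
    filter_upwards [self_mem_nhdsWithin] with y hy
    have hy' : y ≠ 0 := hy
    simp [slope, signedPow]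
    field_simp
  · exact hasDerivAt_signedPow_of_ne hx

theorem abs_signedPow_sub_le_of_two_le {P : ℝ} (hP : 2 ≤ P) {a b C : ℝ} (ha : |a| ≤ C)
    (hb : |b| ≤ C) : |signedPow P b - signedPow P a| ≤ (P - 1) * C ^ (P - 2) * |b - a| := by
  have h := Convex.norm_image_sub_le_of_norm_hasDerivWithin_le (s := Set.Icc (-C) C)
    (f := signedPow P) (f' := fun x => (P - 1) * |x| ^ (P - 2)) (C := (P - 1) * C ^ (P - 2))
    (fun x _ => (hasDerivAt_signedPow hP x).hasDerivWithinAt)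
    (fun x hx => by
      have hxC : |x| ≤ C := abs_le.2 hx
      rw [Real.norm_eq_abs, abs_of_nonneg (mul_nonneg (by linarith) (by positivity))]
      exact mul_le_mul_of_nonneg_left
        (Real.rpow_le_rpow (abs_nonneg x) hxC (by linarith)) (by linarith))
    (convex_Icc _ _) (abs_le.1 ha) (abs_le.1 hb)
  simpa [Real.norm_eq_abs] using h

/-- For P < 2 the derivative blows up at 0. If |s| ≤ |a|/2, the segment stays at distance at least
|a|/2 from 0 and the mean value inequality applies. Otherwise |a + s| ≤ 3|s| and |a| ≤ 2|s| bound
the two values separately, which explains 5 = 3 + 2. The bound is linear in s, as needed to dominate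
difference quotients. -/
theorem abs_signedPow_add_sub_le_of_lt_two {P : ℝ} (hP : 1 < P) (hP2 : P < 2) {a : ℝ}
    (ha : a ≠ 0) (s : ℝ) :
    |signedPow P (a + s) - signedPow P a| ≤ 5 * (|a| / 2) ^ (P - 2) * |s| := by
  have ha' : 0 < |a| := abs_pos.2 ha
  rcases le_or_gt |s| (|a| / 2) with hs | hs
  · have hball : ∀ x ∈ Metric.closedBall a |s|, |a| / 2 ≤ |x| := fun x hx => by
      have h1 : |x - a| ≤ |s| := by simpa [Real.dist_eq] using hx
      have h2 := abs_sub_abs_le_abs_sub a x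
      rw [abs_sub_comm] at h2
      linarith
    have h := Convex.norm_image_sub_le_of_norm_hasDerivWithin_le (s := Metric.closedBall a |s|)
      (f := signedPow P) (f' := fun x => (P - 1) * |x| ^ (P - 2))
      (C := (P - 1) * (|a| / 2) ^ (P - 2)) (x := a) (y := a + s)
      (fun x hx => (hasDerivAt_signedPow_of_ne (abs_pos.1 (lt_of_lt_of_le (by positivity)
        (hball x hx)))).hasDerivWithinAt)
      (fun x hx => by
        rw [Real.norm_eq_abs, abs_of_nonneg (mul_nonneg (by linarith) (by positivity))]
        exact mul_le_mul_of_nonneg_left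
          (Real.rpow_le_rpow_of_nonpos (by positivity) (hball x hx) (by linarith)) (by linarith))
      (convex_closedBall _ _) (by simp) (by simp)
    rw [add_sub_cancel_left, Real.norm_eq_abs, Real.norm_eq_abs] at h
    refine h.trans ?_
    gcongr
    linarith
  · have hs0 : 0 < |s| := lt_trans (by positivity) hs
    have key : |s| ^ (P - 1) ≤ (|a| / 2) ^ (P - 2) * |s| := by
      have : |s| ^ (P - 1) = |s| ^ (P - 2) * |s| := by
        rw [← Real.rpow_add_one hs0.ne']; ring_nf
      rw [this]
      exact mul_le_mul_of_nonneg_right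
        (Real.rpow_le_rpow_of_nonpos (by positivity) hs.le (by linarith)) hs0.le
    have hc : ∀ c : ℝ, 1 ≤ c → ∀ y : ℝ, |y| ≤ c * |s| → |signedPow P y| ≤ c * |s| ^ (P - 1) := by
      intro c hc y hy
      rw [abs_signedPow hP]
      calc |y| ^ (P - 1) ≤ (c * |s|) ^ (P - 1) :=
            Real.rpow_le_rpow (abs_nonneg y) hy (by linarith)
        _ = c ^ (P - 1) * |s| ^ (P - 1) := Real.mul_rpow (by linarith) hs0.le
        _ ≤ c * |s| ^ (P - 1) := by
            gcongr
            nth_rewrite 2 [← Real.rpow_one c]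
            exact Real.rpow_le_rpow_of_exponent_le hc (by linarith)
    have h1 := hc 3 (by norm_num) (a + s) (by linarith [abs_add_le a s])
    have h2 := hc 2 (by norm_num) a (by linarith)
    have h3 := abs_sub (signedPow P (a + s)) (signedPow P a)
    linarith

section Minimizer

variable {X : Type*} [MeasurableSpace X]

/-- `m` minimizes `t ↦ ‖f - t‖_{L^p(μ)}` over the real numbers. -/
def IsLpMin (p : ℝ≥0∞) (μ : Measure X) (f : X → ℝ) (m : ℝ) : Prop :=
  ∀ t : ℝ, eLpNorm (fun y => f y - m) p μ ≤ eLpNorm (fun y => f y - t) p μ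

variable {μ : Measure X} [IsFiniteMeasure μ] {f : X → ℝ} {C : ℝ}

theorem integrable_comp_of_ae_bound (hf : AEStronglyMeasurable f μ) (hC : ∀ᵐ x ∂μ, |f x| ≤ C)
    {g : ℝ → ℝ} (hg : Measurable g) {D : ℝ} (hD : ∀ a, |a| ≤ C → |g a| ≤ D) :
    Integrable (fun x => g (f x)) μ := by
  refine Integrable.of_bound (hg.comp_aemeasurable hf.aemeasurable).aestronglyMeasurable D ?_
  filter_upwards [hC] with x hx using hD _ hx

theorem integrable_abs_sub_rpow {P : ℝ} (hP : 1 < P) (hf : AEStronglyMeasurable f μ)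
    (hC : ∀ᵐ x ∂μ, |f x| ≤ C) (t : ℝ) : Integrable (fun x => |f x - t| ^ P) μ := by
  refine integrable_comp_of_ae_bound hf hC (g := fun a => |a - t| ^ P) (by fun_prop)
    (D := (C + |t|) ^ P) fun a ha => ?_
  rw [abs_of_nonneg (by positivity)]
  exact Real.rpow_le_rpow (abs_nonneg _) ((abs_sub a t).trans (by linarith)) (by linarith)

theorem integrable_signedPow_sub {P : ℝ} (hP : 1 < P) (hf : AEStronglyMeasurable f μ)
    (hC : ∀ᵐ x ∂μ, |f x| ≤ C) (t : ℝ) : Integrable (fun x => signedPow P (f x - t)) μ := by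
  refine integrable_comp_of_ae_bound hf hC (g := fun a => signedPow P (a - t))
    ((measurable_signedPow P).comp (by fun_prop)) (D := (C + |t|) ^ (P - 1)) fun a ha => ?_
  rw [abs_signedPow hP]
  exact Real.rpow_le_rpow (abs_nonneg _) ((abs_sub a t).trans (by linarith)) (by linarith)

theorem memLp_sub_const (p : ℝ≥0∞) (hf : AEStronglyMeasurable f μ)
    (hC : ∀ᵐ x ∂μ, |f x| ≤ C) (t : ℝ) : MemLp (fun x => f x - t) p μ := by
  refine MemLp.of_bound (hf.sub aestronglyMeasurable_const) (C + |t|) ?_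
  filter_upwards [hC] with x hx
  exact (abs_sub _ _).trans (by linarith)

theorem isLpMin_iff {p : ℝ≥0∞} (hp : 1 < p) (hp' : p ≠ ⊤) (hf : AEStronglyMeasurable f μ)
    (hC : ∀ᵐ x ∂μ, |f x| ≤ C) (m : ℝ) : IsLpMin p μ f m ↔
      ∀ t, ∫ x, |f x - m| ^ p.toReal ∂μ ≤ ∫ x, |f x - t| ^ p.toReal ∂μ := by
  have hp0 : p ≠ 0 := (zero_lt_one.trans hp).ne'
  have hP : 0 < p.toReal := ENNReal.toReal_pos hp0 hp'
  have hnn : ∀ t, 0 ≤ ∫ x, |f x - t| ^ p.toReal ∂μ := fun t =>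
    integral_nonneg fun x => by positivity
  refine forall_congr' fun t => ?_
  rw [(memLp_sub_const p hf hC m).eLpNorm_eq_integral_rpow_norm hp0 hp',
    (memLp_sub_const p hf hC t).eLpNorm_eq_integral_rpow_norm hp0 hp']
  simp only [Real.norm_eq_abs]
  rw [ENNReal.ofReal_le_ofReal_iff (Real.rpow_nonneg (hnn t) _),
    Real.rpow_le_rpow_iff (hnn m) (hnn t) (inv_pos.2 hP)]

/-- Clamping t to [-C, C] does not increase the distance to any value of f of modulus at most C, so
a minimum of the continuous functional over this interval is global. Strict convexity at the
midpoint of two minimizers gives uniqueness. -/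
theorem existsUnique_isLpMin {p : ℝ≥0∞} (hp : 1 < p) (hp' : p ≠ ⊤) (hμ : μ ≠ 0)
    (hf : AEStronglyMeasurable f μ) (hC : ∀ᵐ x ∂μ, |f x| ≤ C) : ∃! m, IsLpMin p μ f m := by
  have hP : 1 < p.toReal := by
    rw [← ENNReal.toReal_one]
    exact (ENNReal.toReal_lt_toReal ENNReal.one_ne_top hp').2 hp
  have hC0 : 0 ≤ C := by
    have : (ae μ).NeBot := ae_neBot.2 hμ
    obtain ⟨x, hx⟩ := hC.exists
    exact (abs_nonneg _).trans hx
  set P := p.toReal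
  have hi := fun t => integrable_abs_sub_rpow hP hf hC t
  have hcont : Continuous fun t => ∫ x, |f x - t| ^ P ∂μ := by
    refine continuous_iff_continuousAt.2 fun t₀ => ?_
    refine continuousAt_of_dominated (bound := fun _ => (C + (|t₀| + 1)) ^ P)
      (Eventually.of_forall fun t => (hi t).aestronglyMeasurable) ?_ (integrable_const _) ?_
    · filter_upwards [Metric.ball_mem_nhds t₀ one_pos] with t ht
      filter_upwards [hC] with x hx
      have h1 : |t - t₀| < 1 := by simpa [Real.dist_eq] using ht
      have h2 := abs_sub_abs_le_abs_sub t t₀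
      rw [Real.norm_eq_abs, abs_of_nonneg (by positivity)]
      exact Real.rpow_le_rpow (abs_nonneg _) ((abs_sub _ t).trans (by linarith)) (by linarith)
    · refine Eventually.of_forall fun x => ?_
      exact ((continuous_const.sub continuous_id).abs.rpow_const
        fun _ => Or.inr (by linarith)).continuousAt
  obtain ⟨m, hm, hmin⟩ := (isCompact_Icc (a := -C) (b := C)).exists_isMinOn
    ⟨0, by constructor <;> linarith⟩ hcont.continuousOn
  have hmm : IsLpMin p μ f m := by
    rw [isLpMin_iff hp hp' hf hC]
    intro t
    have hproj : max (-C) (min C t) ∈ Set.Icc (-C) C :=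
      ⟨le_max_left _ _, max_le (by linarith) (min_le_left _ _)⟩
    refine (hmin hproj).trans ?_
    refine integral_mono_ae (hi _) (hi _) ?_
    filter_upwards [hC] with x hx
    refine Real.rpow_le_rpow (abs_nonneg _) ?_ (by linarith)
    have h1 := abs_le.1 hx
    rcases max_cases (-C) (min C t) with h | h <;> rcases min_cases C t with h' | h' <;>
      rw [← sq_le_sq] <;> nlinarith
  refine ⟨m, hmm, fun m' hm' => ?_⟩
  by_contra hne
  rw [isLpMin_iff hp hp' hf hC] at hmm hm'
  set s := (m + m') / 2
  have hlt : ∀ x, |f x - s| ^ P < (|f x - m| ^ P + |f x - m'| ^ P) / 2 := fun x => by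
    have h := abs_rpow_midpoint_lt hP (a := f x - m) (b := f x - m')
      (fun h => hne (by linarith))
    convert h using 3
    simp only [s]; ring
  have hgi : Integrable (fun x => (|f x - m| ^ P + |f x - m'| ^ P) / 2 - |f x - s| ^ P) μ :=
    (((hi m).add (hi m')).div_const 2).sub (hi s)
  have hpos : 0 < ∫ x, ((|f x - m| ^ P + |f x - m'| ^ P) / 2 - |f x - s| ^ P) ∂μ := by
    rw [integral_pos_iff_support_of_nonneg (fun x => (sub_pos.2 (hlt x)).le) hgi]
    have : Function.support
        (fun x => (|f x - m| ^ P + |f x - m'| ^ P) / 2 - |f x - s| ^ P) = Set.univ :=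
      Set.eq_univ_of_forall fun x => (sub_pos.2 (hlt x)).ne'
    rw [this]
    exact Measure.measure_univ_pos.2 hμ
  have hadd : Integrable (fun x => |f x - m| ^ P + |f x - m'| ^ P) μ := (hi m).add (hi m')
  rw [integral_sub (hadd.div_const 2) (hi s), integral_div,
    integral_add (hi m) (hi m')] at hpos
  have h1 := hmm s
  have h2 := hm' s
  linarith

/-- Integrate the subgradient inequality at f - t and compare with the minimality of m. The sign of
the integral then locates m relative to t, and no Euler-Lagrange equation has to be derived. -/
theorem IsLpMin.integral_mul_nonneg {p : ℝ≥0∞} (hp : 1 < p) (hp' : p ≠ ⊤)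
    (hf : AEStronglyMeasurable f μ) (hC : ∀ᵐ x ∂μ, |f x| ≤ C) {m : ℝ} (hm : IsLpMin p μ f m)
    (t : ℝ) : 0 ≤ (m - t) * ∫ x, signedPow p.toReal (f x - t) ∂μ := by
  have hP : 1 < p.toReal := by
    rw [← ENNReal.toReal_one]
    exact (ENNReal.toReal_lt_toReal ENNReal.one_ne_top hp').2 hp
  have h1 := (isLpMin_iff hp hp' hf hC m).1 hm t
  have h2 : ∫ x, (|f x - t| ^ p.toReal +
      p.toReal * signedPow p.toReal (f x - t) * (t - m)) ∂μ ≤ ∫ x, |f x - m| ^ p.toReal ∂μ := by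
    refine integral_mono ((integrable_abs_sub_rpow hP hf hC t).add
      (((integrable_signedPow_sub hP hf hC t).const_mul _).mul_const _))
      (integrable_abs_sub_rpow hP hf hC m) fun x => ?_
    have := abs_rpow_subgradient hP (f x - t) (f x - m)
    rwa [sub_sub_sub_cancel_left] at this
  rw [integral_add (integrable_abs_sub_rpow hP hf hC t)
    (((integrable_signedPow_sub hP hf hC t).const_mul _).mul_const _), integral_mul_const,
    integral_const_mul] at h2
  have h3 : p.toReal * (∫ x, signedPow p.toReal (f x - t) ∂μ) * (t - m) ≤ 0 := by linarith
  have h4 : 0 ≤ p.toReal * ((m - t) * ∫ x, signedPow p.toReal (f x - t) ∂μ) := by linarith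
  exact (mul_nonneg_iff_of_pos_left (by linarith)).1 h4

/-- Dominated convergence. For P < 2 the dominating function is a multiple of the singular weight
|l|^{P-2}, integrable by `hint`; for P ≥ 2 a constant suffices, by the Lipschitz bound on bounded
sets. -/
theorem tendsto_integral_signedPow_add {P : ℝ} (hP : 1 < P) {l h : X → ℝ}
    (hl : AEStronglyMeasurable l μ) (hh : AEStronglyMeasurable h μ) {Cl Ch : ℝ}
    (hCl : ∀ᵐ x ∂μ, |l x| ≤ Cl) (hCh : ∀ᵐ x ∂μ, |h x| ≤ Ch) (hl0 : ∀ᵐ x ∂μ, l x ≠ 0)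
    (hint : Integrable (fun x => |l x| ^ (P - 2)) μ) :
    Tendsto (fun ε : ℝ => ∫ x, (signedPow P (l x + ε * h x) - signedPow P (l x)) / ε ∂μ) (𝓝[>] 0)
      (𝓝 (∫ x, (P - 1) * (|l x| ^ (P - 2) * h x) ∂μ)) := by
  have hmeas : ∀ ε : ℝ, AEStronglyMeasurable
      (fun x => (signedPow P (l x + ε * h x) - signedPow P (l x)) / ε) μ := fun ε =>
    (((((measurable_signedPow P).comp_aemeasurable
      (hl.aemeasurable.add (hh.aemeasurable.const_mul ε))).sub
      ((measurable_signedPow P).comp_aemeasurable hl.aemeasurable)).div_const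
        ε)).aestronglyMeasurable
  have hlim : ∀ᵐ x ∂μ, Tendsto (fun ε : ℝ =>
      (signedPow P (l x + ε * h x) - signedPow P (l x)) / ε) (𝓝[>] 0)
      (𝓝 ((P - 1) * (|l x| ^ (P - 2) * h x))) := by
    filter_upwards [hl0] with x hx
    have h1 : HasDerivAt (fun ε : ℝ => l x + ε * h x) (h x) 0 := by
      simpa using ((hasDerivAt_id (0 : ℝ)).mul_const (h x)).const_add (l x)
    have h2 := (hasDerivAt_signedPow_of_ne (P := P) hx)
    have h3 := HasDerivAt.comp_of_eq (0 : ℝ) h2 h1 (by simp)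
    rw [hasDerivAt_iff_tendsto_slope_zero] at h3
    have h4 := h3.mono_left (nhdsWithin_mono (0 : ℝ) (s := Set.Ioi 0) fun y hy => ne_of_gt hy)
    rw [mul_assoc] at h4
    refine h4.congr fun ε => ?_
    simp [div_eq_inv_mul]
  rcases lt_or_ge P 2 with hP2 | hP2
  · refine tendsto_integral_filter_of_dominated_convergence
      (fun x => 5 * (2⁻¹ ^ (P - 2) * |l x| ^ (P - 2)) * Ch)
      (Eventually.of_forall hmeas) ?_ (((hint.const_mul _).const_mul _).mul_const _) hlim
    filter_upwards [self_mem_nhdsWithin] with ε hε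
    have hε' : 0 < ε := hε
    filter_upwards [hl0, hCh] with x hx hxC
    have h1 := abs_signedPow_add_sub_le_of_lt_two hP hP2 hx (ε * h x)
    rw [Real.norm_eq_abs, abs_div, abs_of_pos hε', div_le_iff₀ hε']
    refine h1.trans ?_
    rw [abs_mul, abs_of_pos hε', div_eq_inv_mul, Real.mul_rpow (by norm_num) (abs_nonneg _),
      mul_comm ε, ← mul_assoc]
    gcongr
  · refine tendsto_integral_filter_of_dominated_convergence
      (fun _ => (P - 1) * (Cl + Ch) ^ (P - 2) * Ch)
      (Eventually.of_forall hmeas) ?_ (integrable_const _) hlim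
    filter_upwards [self_mem_nhdsWithin, Ioo_mem_nhdsGT (zero_lt_one (α := ℝ))] with ε hε hε1
    have hε' : 0 < ε := hε
    filter_upwards [hCl, hCh] with x hx hxC
    have hCh0 : 0 ≤ Ch := (abs_nonneg _).trans hxC
    have hCl0 : 0 ≤ Cl := (abs_nonneg _).trans hx
    have h0 : |ε * h x| ≤ Ch := by
      rw [abs_mul, abs_of_pos hε']
      calc ε * |h x| ≤ 1 * |h x| := by gcongr; exact hε1.2.le
        _ ≤ Ch := by rwa [one_mul]
    have h1 := abs_signedPow_sub_le_of_two_le hP2 (a := l x) (b := l x + ε * h x) (C := Cl + Ch)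
      (by linarith) ((abs_add_le _ _).trans (by linarith))
    rw [Real.norm_eq_abs, abs_div, abs_of_pos hε', div_le_iff₀ hε']
    refine h1.trans ?_
    rw [add_sub_cancel_left, abs_mul, abs_of_pos hε', mul_comm ε, ← mul_assoc]
    have : 0 ≤ (P - 1) * (Cl + Ch) ^ (P - 2) := mul_nonneg (by linarith) (by positivity)
    gcongr

end Minimizer

end Carnot

/-! ### Second order asymptotics of minimizers on a fixed space -/

namespace Carnot

theorem signedPow_mul {P ε : ℝ} (hε : 0 < ε) (y : ℝ) :
    signedPow P (ε * y) = ε ^ (P - 1) * signedPow P y := by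
  have h : ε ^ (P - 1) = ε ^ (P - 2) * ε := by
    rw [← Real.rpow_add_one hε.ne']; ring_nf
  rw [signedPow, signedPow, abs_mul, abs_of_pos hε, Real.mul_rpow hε.le (abs_nonneg _), h]
  ring

/-- Where g < g(z) + δ the bound follows from l ≤ l(z). The other points of K form a compact set
that misses z, so there l ≤ l(z) - γ for some γ > 0, and for small ε this gap exceeds the variation
of ε g. -/
theorem eventually_add_mul_le_of_unique_max {X : Type*} [TopologicalSpace X] {K : Set X}
    (hKc : IsCompact K) {l g : X → ℝ}
    (hl : ContinuousOn l K) (hg : ContinuousOn g K) {z : X}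
    (hmax : ∀ x ∈ K, x ≠ z → l x < l z) {δ : ℝ} (hδ : 0 < δ) :
    ∀ᶠ ε in 𝓝[>] (0 : ℝ), ∀ x ∈ K, l x + ε * g x ≤ l z + ε * (g z + δ) := by
  have hle : ∀ x ∈ K, l x ≤ l z := fun x hx => by
    rcases eq_or_ne x z with rfl | hne
    · exact le_rfl
    · exact (hmax x hx hne).le
  obtain ⟨C, hC⟩ := hKc.exists_bound_of_continuousOn hg
  obtain ⟨γ, hγ, hS⟩ : ∃ γ > 0, ∀ x ∈ K, g z + δ ≤ g x → l x ≤ l z - γ := by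
    obtain ⟨T, hT, hTK⟩ := (continuousOn_iff_isClosed.1 hg) (Set.Ici (g z + δ)) isClosed_Ici
    have hSc : IsCompact (T ∩ K) := hKc.inter_left hT
    have hmemS : ∀ x, x ∈ T ∩ K ↔ x ∈ K ∧ g z + δ ≤ g x := fun x => by
      rw [← hTK]; simp [and_comm]
    rcases (T ∩ K).eq_empty_or_nonempty with hemp | hne
    · refine ⟨1, one_pos, fun x hx hgx => ?_⟩
      have : x ∈ T ∩ K := (hmemS x).2 ⟨hx, hgx⟩
      rw [hemp] at this
      exact absurd this (Set.notMem_empty x)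
    · obtain ⟨y, hy, hymax⟩ := hSc.exists_isMaxOn hne (hl.mono Set.inter_subset_right)
      have hyz : y ≠ z := by
        rintro rfl
        have := ((hmemS y).1 hy).2
        linarith
      refine ⟨l z - l y, sub_pos.2 (hmax y hy.2 hyz), fun x hx hgx => ?_⟩
      have : l x ≤ l y := hymax ((hmemS x).2 ⟨hx, hgx⟩)
      linarith
  have hD : 0 < |C| + |g z| + 1 := by positivity
  filter_upwards [Ioo_mem_nhdsGT (show 0 < γ / (|C| + |g z| + 1) by positivity)] with ε hε x hx
  have hε0 : 0 < ε := hε.1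
  rcases le_or_gt (g z + δ) (g x) with h | h
  · have h1 := hS x hx h
    have h2 : ε * (|C| + |g z| + 1) ≤ γ := ((lt_div_iff₀ hD).1 hε.2).le
    have h3 : g x ≤ |C| := (le_abs_self _).trans ((hC x hx).trans (le_abs_self C))
    have h4 : -|g z| ≤ g z := neg_abs_le _
    nlinarith
  · have := hle x hx
    nlinarith

section Minimizer

variable {X : Type*} [MeasurableSpace X] {μ : Measure X}

theorem IsLpMin.neg {p : ℝ≥0∞} {f : X → ℝ} {m : ℝ} (h : IsLpMin p μ f m) :
    IsLpMin p μ (fun x => -f x) (-m) := by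
  have key : ∀ s : ℝ, eLpNorm (fun y => -f y - s) p μ = eLpNorm (fun y => f y - -s) p μ := by
    intro s
    rw [← eLpNorm_neg]
    congr 1
    funext y
    simp only [Pi.neg_apply]
    ring
  intro t
  rw [key, key, neg_neg]
  exact h _

/-- By the sign test it suffices that ∫ φ(F ε - t) < 0 at t = a + ε²(L + c), with φ = `signedPow`.
By monotonicity F ε - t may be replaced by ε(l + ε h). Its zeroth order contribution vanishes by
`hodd`, and its first variation is negative by the choice of L. -/
theorem IsLpMin.eventually_le [IsFiniteMeasure μ] {p : ℝ≥0∞} (hp : 1 < p) (hp' : p ≠ ⊤)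
    (hμ : μ ≠ 0) {l g : X → ℝ} (hl : AEStronglyMeasurable l μ) (hg : AEStronglyMeasurable g μ)
    {Cl Cg : ℝ} (hCl : ∀ᵐ x ∂μ, |l x| ≤ Cl) (hCg : ∀ᵐ x ∂μ, |g x| ≤ Cg)
    (hl0 : ∀ᵐ x ∂μ, l x ≠ 0) (hint : Integrable (fun x => |l x| ^ (p.toReal - 2)) μ)
    (hodd : ∫ x, signedPow p.toReal (l x) ∂μ = 0) {L : ℝ}
    (hL : ∫ x, |l x| ^ (p.toReal - 2) * g x ∂μ = L * ∫ x, |l x| ^ (p.toReal - 2) ∂μ)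
    {a : ℝ} {F : ℝ → X → ℝ} (hF : ∀ᶠ ε in 𝓝[>] (0 : ℝ), AEStronglyMeasurable (F ε) μ)
    (happ : ∀ δ > 0, ∀ᶠ ε in 𝓝[>] (0 : ℝ), ∀ᵐ x ∂μ,
      |F ε x - (a + ε * l x + ε ^ 2 * g x)| ≤ δ * ε ^ 2)
    {m : ℝ → ℝ} (hm : ∀ᶠ ε in 𝓝[>] (0 : ℝ), IsLpMin p μ (F ε) (m ε)) {c : ℝ} (hc : 0 < c) :
    ∀ᶠ ε in 𝓝[>] (0 : ℝ), m ε - (a + ε ^ 2 * L) ≤ c * ε ^ 2 := by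
  have hP : 1 < p.toReal := by
    rw [← ENNReal.toReal_one]
    exact (ENNReal.toReal_lt_toReal ENNReal.one_ne_top hp').2 hp
  set P := p.toReal
  have hIpos : 0 < ∫ x, |l x| ^ (P - 2) ∂μ := by
    rw [integral_pos_iff_support_of_nonneg (fun x => by positivity) hint]
    refine lt_of_lt_of_le (Measure.measure_univ_pos.2 hμ) (measure_mono_ae ?_)
    filter_upwards [hl0] with x hx _
    exact (Real.rpow_pos_of_pos (abs_pos.2 hx) _).ne'
  have hgi : Integrable (fun x => |l x| ^ (P - 2) * g x) μ := by
    refine (hint.mul_const Cg).mono' (hint.aestronglyMeasurable.mul hg) ?_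
    filter_upwards [hCg] with x hx
    rw [Real.norm_eq_abs, abs_mul, abs_of_nonneg (by positivity : 0 ≤ |l x| ^ (P - 2))]
    gcongr
  -- Half of the slack c stays in h and makes the first variation negative; the other half absorbs
  -- the error in `happ`.
  set h : X → ℝ := fun x => g x - (L + c / 2) with hh
  have hhm : AEStronglyMeasurable h μ := hg.sub aestronglyMeasurable_const
  have hCh : ∀ᵐ x ∂μ, |h x| ≤ Cg + |L + c / 2| := by
    filter_upwards [hCg] with x hx
    exact (abs_sub _ _).trans (by linarith)
  have hlim := tendsto_integral_signedPow_add hP hl hhm hCl hCh hl0 hint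
  have hval : ∫ x, (P - 1) * (|l x| ^ (P - 2) * h x) ∂μ < 0 := by
    have : ∀ x, |l x| ^ (P - 2) * h x =
        |l x| ^ (P - 2) * g x - |l x| ^ (P - 2) * (L + c / 2) := fun x => by simp only [hh]; ring
    simp_rw [this]
    rw [integral_const_mul, integral_sub hgi (hint.mul_const _), hL, integral_mul_const]
    have : L * ∫ x, |l x| ^ (P - 2) ∂μ - (∫ x, |l x| ^ (P - 2) ∂μ) * (L + c / 2) =
      -(c / 2 * ∫ x, |l x| ^ (P - 2) ∂μ) := by ring
    rw [this]
    have : 0 < (P - 1) * (c / 2 * ∫ x, |l x| ^ (P - 2) ∂μ) := by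
      have : 0 < P - 1 := by linarith
      positivity
    linarith
  filter_upwards [hF, happ (c / 2) (by positivity), hm, hlim.eventually (gt_mem_nhds hval),
    self_mem_nhdsWithin] with ε hFε hε hmε hJ hε0
  have hε0 : 0 < ε := hε0
  have hFb : ∀ᵐ x ∂μ, |F ε x| ≤ c / 2 * ε ^ 2 + (|a| + ε * Cl + ε ^ 2 * Cg) := by
    filter_upwards [hε, hCl, hCg] with x hx h1 h2
    have h3 : |a + ε * l x + ε ^ 2 * g x| ≤ |a| + ε * Cl + ε ^ 2 * Cg := by
      refine (abs_add_le _ _).trans (add_le_add ((abs_add_le _ _).trans (add_le_add le_rfl ?_)) ?_)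
      · rw [abs_mul, abs_of_pos hε0]; gcongr
      · rw [abs_mul, abs_of_pos (by positivity : 0 < ε ^ 2)]; gcongr
    have h4 := abs_sub_abs_le_abs_sub (F ε x) (a + ε * l x + ε ^ 2 * g x)
    linarith
  have hlb : ∀ᵐ x ∂μ, |l x + ε * h x| ≤ Cl + ε * (Cg + |L + c / 2|) := by
    filter_upwards [hCl, hCh] with x h1 h2
    refine (abs_add_le _ _).trans (add_le_add h1 ?_)
    rw [abs_mul, abs_of_pos hε0]; gcongr
  set t := a + ε ^ 2 * (L + c) with ht
  have hi1 := integrable_signedPow_sub hP hFε hFb t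
  have hi2 : Integrable (fun x => signedPow P (l x + ε * h x)) μ := by
    simpa using integrable_signedPow_sub hP (hl.add (hhm.const_mul ε)) hlb 0
  have hi3 : Integrable (fun x => signedPow P (l x)) μ := by
    simpa using integrable_signedPow_sub hP hl hCl 0
  have hneg : ∫ x, signedPow P (F ε x - t) ∂μ < 0 := by
    calc ∫ x, signedPow P (F ε x - t) ∂μ
        ≤ ∫ x, ε ^ (P - 1) * signedPow P (l x + ε * h x) ∂μ := by
          refine integral_mono_ae hi1 (hi2.const_mul _) ?_
          filter_upwards [hε] with x hx
          rw [← signedPow_mul hε0]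
          refine signedPow_mono hP ?_
          have := (abs_le.1 hx).2
          simp only [hh, ht]
          nlinarith
      _ = ε ^ (P - 1) * (ε * ∫ x, (signedPow P (l x + ε * h x) - signedPow P (l x)) / ε ∂μ) := by
          rw [integral_const_mul, integral_div, integral_sub hi2 hi3, hodd, sub_zero,
            mul_div_cancel₀ _ hε0.ne']
      _ < 0 := by
          have : 0 < ε ^ (P - 1) := Real.rpow_pos_of_pos hε0 _
          exact mul_neg_of_pos_of_neg this (mul_neg_of_pos_of_neg hε0 hJ)
  have hfin := hmε.integral_mul_nonneg hp hp' hFε hFb t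
  have hmt : m ε ≤ t := by
    by_contra hcon
    have := mul_neg_of_pos_of_neg (sub_pos.2 (not_le.1 hcon)) hneg
    linarith
  rw [ht] at hmt
  linarith

/-- Second order asymptotics of the `L^p` minimizers of a family `a + ε l + ε² g + o(ε²)`,
`1 < p < ∞`. -/
theorem IsLpMin.isLittleO [IsFiniteMeasure μ] {p : ℝ≥0∞} (hp : 1 < p) (hp' : p ≠ ⊤)
    (hμ : μ ≠ 0) {l g : X → ℝ} (hl : AEStronglyMeasurable l μ) (hg : AEStronglyMeasurable g μ)
    {Cl Cg : ℝ} (hCl : ∀ᵐ x ∂μ, |l x| ≤ Cl) (hCg : ∀ᵐ x ∂μ, |g x| ≤ Cg)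
    (hl0 : ∀ᵐ x ∂μ, l x ≠ 0) (hint : Integrable (fun x => |l x| ^ (p.toReal - 2)) μ)
    (hodd : ∫ x, signedPow p.toReal (l x) ∂μ = 0) {L : ℝ}
    (hL : ∫ x, |l x| ^ (p.toReal - 2) * g x ∂μ = L * ∫ x, |l x| ^ (p.toReal - 2) ∂μ)
    {a : ℝ} {F : ℝ → X → ℝ} (hF : ∀ᶠ ε in 𝓝[>] (0 : ℝ), AEStronglyMeasurable (F ε) μ)
    (happ : ∀ δ > 0, ∀ᶠ ε in 𝓝[>] (0 : ℝ), ∀ᵐ x ∂μ,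
      |F ε x - (a + ε * l x + ε ^ 2 * g x)| ≤ δ * ε ^ 2)
    {m : ℝ → ℝ} (hm : ∀ᶠ ε in 𝓝[>] (0 : ℝ), IsLpMin p μ (F ε) (m ε)) :
    (fun ε : ℝ => m ε - (a + ε ^ 2 * L)) =o[𝓝[>] 0] (fun ε : ℝ => ε ^ 2) := by
  refine isLittleO_iff.2 fun c hc => ?_
  have h1 := IsLpMin.eventually_le hp hp' hμ hl hg hCl hCg hl0 hint hodd hL hF happ hm hc
  -- The lower bound is the upper bound for the negated data.
  have h2 := IsLpMin.eventually_le (l := fun x => -l x) (g := fun x => -g x) (L := -L) (a := -a)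
    (F := fun ε x => -F ε x) (m := fun ε => -m ε) (Cl := Cl) (Cg := Cg) hp hp' hμ hl.neg hg.neg
    (by simpa using hCl) (by simpa using hCg) (by simpa using hl0) (by simpa using hint)
    (by simp only [signedPow_neg, integral_neg, hodd, neg_zero])
    (by simp only [abs_neg, mul_neg, integral_neg, hL, neg_mul])
    (hF.mono fun ε h => h.neg)
    (fun δ hδ => (happ δ hδ).mono fun ε h => h.mono fun x hx => by
      rw [← abs_neg]; convert hx using 2; ring)
    (hm.mono fun ε h => h.neg) hc
  filter_upwards [h1, h2] with ε h1 h2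
  rw [Real.norm_eq_abs, Real.norm_eq_abs, abs_of_nonneg (by positivity : 0 ≤ ε ^ 2), abs_le]
  constructor <;> linarith

variable [TopologicalSpace X] {K : Set X}

/-- A strict inequality at a point of K persists nearby in K, and neighbourhoods of points of K have
positive measure. So an essential bound on a continuous function is a pointwise one. -/
theorem eLpNorm_top_le_iff_of_continuousOn (hK : ∀ᵐ x ∂μ, x ∈ K)
    (hsupp : ∀ x ∈ K, ∀ U ∈ 𝓝 x, μ U ≠ 0) {f : X → ℝ} (hf : ContinuousOn f K) {c : ℝ}
    (hc : 0 ≤ c) : eLpNorm f ⊤ μ ≤ ENNReal.ofReal c ↔ ∀ y ∈ K, |f y| ≤ c := by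
  constructor
  · intro h y hy
    by_contra hcon
    have hlt : c < |f y| := not_le.1 hcon
    have hae : ∀ᵐ x ∂μ, |f x| ≤ c := by
      rw [eLpNorm_exponent_top] at h
      filter_upwards [ae_le_eLpNormEssSup (f := f) (μ := μ)] with x hx
      have := hx.trans h
      rwa [Real.enorm_eq_ofReal_abs, ENNReal.ofReal_le_ofReal_iff hc] at this
    have hnh : ∀ᶠ x in 𝓝[K] y, c < |f x| :=
      (hf y hy).abs.eventually (lt_mem_nhds hlt)
    obtain ⟨U, hU, hUK⟩ := mem_nhdsWithin_iff_exists_mem_nhds_inter.1 hnh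
    refine hsupp y hy U hU (measure_mono_null (t := {x | ¬ (x ∈ K ∧ |f x| ≤ c)}) ?_ ?_)
    · intro x hx hx'
      exact absurd hx'.2 (not_le.2 (hUK ⟨hx, hx'.1⟩))
    · exact hK.and hae
  · intro h
    rw [eLpNorm_exponent_top]
    refine eLpNormEssSup_le_of_ae_enorm_bound ?_
    filter_upwards [hK] with x hx
    rw [Real.enorm_eq_ofReal_abs]
    exact ENNReal.ofReal_le_ofReal (h x hx)

/-- The uniform distance from t to f is at least the distance from t to either extreme value, so the
midrange is the only optimal constant. -/
theorem isLpMin_top_iff (hK : ∀ᵐ x ∂μ, x ∈ K)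
    (hsupp : ∀ x ∈ K, ∀ U ∈ 𝓝 x, μ U ≠ 0) {f : X → ℝ} (hf : ContinuousOn f K) {y z : X}
    (hy : y ∈ K) (hz : z ∈ K) (hmax : ∀ x ∈ K, f x ≤ f y) (hmin : ∀ x ∈ K, f z ≤ f x) {m : ℝ} :
    IsLpMin ⊤ μ f m ↔ m = (f y + f z) / 2 := by
  have hr : 0 ≤ (f y - f z) / 2 := by linarith [hmax z hz]
  have hft : ∀ t : ℝ, ContinuousOn (fun x => f x - t) K := fun t => hf.sub continuousOn_const
  have hmid : eLpNorm (fun x => f x - (f y + f z) / 2) ⊤ μ ≤ ENNReal.ofReal ((f y - f z) / 2) := by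
    rw [eLpNorm_top_le_iff_of_continuousOn hK hsupp (hft _) hr]
    intro x hx
    have h1 := hmax x hx
    have h2 := hmin x hx
    rw [abs_le]; constructor <;> linarith
  constructor
  · intro h
    have h1 := (eLpNorm_top_le_iff_of_continuousOn hK hsupp (hft m) hr).1 ((h _).trans hmid)
    have h2 := (abs_le.1 (h1 y hy)).2
    have h3 := (abs_le.1 (h1 z hz)).1
    linarith
  · rintro rfl t
    refine hmid.trans ?_
    by_contra hcon
    have hlt := not_le.1 hcon
    set e := eLpNorm (fun x => f x - t) ⊤ μ with he
    have hefin : e ≠ ⊤ := (hlt.trans ENNReal.ofReal_lt_top).ne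
    have h1 : ∀ x ∈ K, |f x - t| ≤ e.toReal := by
      rw [← eLpNorm_top_le_iff_of_continuousOn hK hsupp (hft t) ENNReal.toReal_nonneg,
        ENNReal.ofReal_toReal hefin]
    have h2 := (abs_le.1 (h1 y hy)).2
    have h3 := (abs_le.1 (h1 z hz)).1
    have h4 : e.toReal < (f y - f z) / 2 := (ENNReal.lt_ofReal_iff_toReal_lt hefin).1 hlt
    linarith

theorem existsUnique_isLpMin_top (hKc : IsCompact K) (hKn : K.Nonempty) (hK : ∀ᵐ x ∂μ, x ∈ K)
    (hsupp : ∀ x ∈ K, ∀ U ∈ 𝓝 x, μ U ≠ 0) {f : X → ℝ} (hf : ContinuousOn f K) :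
    ∃! m, IsLpMin ⊤ μ f m := by
  obtain ⟨y, hy, hmax⟩ := hKc.exists_isMaxOn hKn hf
  obtain ⟨z, hz, hmin⟩ := hKc.exists_isMinOn hKn hf
  have h := fun m => isLpMin_top_iff hK hsupp hf hy hz (fun x hx => hmax hx)
    (fun x hx => hmin hx) (m := m)
  exact ⟨_, (h _).2 rfl, fun m hm => (h m).1 hm⟩

/-- Second order asymptotics of the `L^∞` minimizers of a family `a + ε l + ε² g + o(ε²)`, where
`l` has a unique maximum and a unique minimum. -/
theorem IsLpMin.isLittleO_top (hKc : IsCompact K) (hK : ∀ᵐ x ∂μ, x ∈ K)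
    (hsupp : ∀ x ∈ K, ∀ U ∈ 𝓝 x, μ U ≠ 0) {l g : X → ℝ}
    (hl : ContinuousOn l K) (hg : ContinuousOn g K) {z₁ z₂ : X} (hz₁ : z₁ ∈ K) (hz₂ : z₂ ∈ K)
    (hmax : ∀ x ∈ K, x ≠ z₁ → l x < l z₁) (hmin : ∀ x ∈ K, x ≠ z₂ → l z₂ < l x)
    (hl12 : l z₁ + l z₂ = 0) {L : ℝ} (hL : g z₁ + g z₂ = 2 * L)
    {a : ℝ} {F : ℝ → X → ℝ} (hF : ∀ᶠ ε in 𝓝[>] (0 : ℝ), ContinuousOn (F ε) K)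
    (happ : ∀ δ > 0, ∀ᶠ ε in 𝓝[>] (0 : ℝ), ∀ x ∈ K,
      |F ε x - (a + ε * l x + ε ^ 2 * g x)| ≤ δ * ε ^ 2)
    {m : ℝ → ℝ} (hm : ∀ᶠ ε in 𝓝[>] (0 : ℝ), IsLpMin ⊤ μ (F ε) (m ε)) :
    (fun ε : ℝ => m ε - (a + ε ^ 2 * L)) =o[𝓝[>] 0] (fun ε : ℝ => ε ^ 2) := by
  refine isLittleO_iff.2 fun c hc => ?_
  have hc2 : 0 < c / 2 := by positivity
  have h1 := eventually_add_mul_le_of_unique_max hKc hl hg hmax hc2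
  have h2 := eventually_add_mul_le_of_unique_max hKc hl.neg hg.neg (z := z₂)
    (fun x hx hne => neg_lt_neg (hmin x hx hne)) hc2
  filter_upwards [hF, happ _ hc2, hm, h1, h2, self_mem_nhdsWithin] with ε hFε hε hmε h1 h2 hε0
  have hε0 : 0 < ε := hε0
  obtain ⟨y, hy, hymax⟩ := hKc.exists_isMaxOn ⟨z₁, hz₁⟩ hFε
  obtain ⟨z, hz, hzmin⟩ := hKc.exists_isMinOn ⟨z₁, hz₁⟩ hFε
  have hmid := (isLpMin_top_iff hK hsupp hFε hy hz (fun x hx => hymax hx)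
    (fun x hx => hzmin hx)).1 hmε
  -- The maximum of F ε is at least its value at z₁, and by the expansion and `h1` it exceeds the
  -- predicted value there by at most c ε²; the minimum is treated in the same way at z₂. Hence the
  -- midrange agrees with the average of the two predicted values up to c ε².
  have e1 := (abs_le.1 (hε y hy)).2
  have e2 := (abs_le.1 (hε z hz)).1
  have e3 := (abs_le.1 (hε z₁ hz₁)).1
  have e4 := (abs_le.1 (hε z₂ hz₂)).2
  have e5 : F ε z₁ ≤ F ε y := hymax hz₁
  have e6 : F ε z ≤ F ε z₂ := hzmin hz₂
  have e7 := mul_le_mul_of_nonneg_left (h1 y hy) hε0.le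
  have e8 := mul_le_mul_of_nonneg_left (h2 z hz) hε0.le
  simp only [Pi.neg_apply] at e8
  have e9 : ε * l z₁ + ε * l z₂ = 0 := by rw [← mul_add, hl12, mul_zero]
  have e10 : ε ^ 2 * g z₁ + ε ^ 2 * g z₂ = 2 * (ε ^ 2 * L) := by rw [← mul_add, hL]; ring
  rw [Real.norm_eq_abs, Real.norm_eq_abs, abs_of_nonneg (by positivity : 0 ≤ ε ^ 2), abs_le, hmid]
  ring_nf at *
  constructor <;> linarith

end Minimizer

end Carnot

/-! ### Homogeneous functions, Gamma factors and Gaussian moments -/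

namespace Carnot

section Homogeneous

variable {X : Type*} [MeasurableSpace X]

/-- A one-parameter family of maps `T r`, `r > 0`, that scales the measure `μ` by `r^Q` and the
function `ρ` by `r^M`. -/
structure IsDilation (μ : Measure X) (T : ℝ → X → X) (ρ : X → ℝ) (M Q : ℝ) : Prop where
  pos : 0 < M
  measurable : ∀ r, Measurable (T r)
  measurable_gauge : Measurable ρ
  gauge_nonneg : ∀ x, 0 ≤ ρ x
  gauge_map : ∀ r > 0, ∀ x, ρ (T r x) = r ^ M * ρ x
  measure_map : ∀ r > 0, μ = ENNReal.ofReal (r ^ Q) • μ.map (T r)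

namespace IsDilation

variable {μ : Measure X} {T : ℝ → X → X} {ρ : X → ℝ} {M Q s : ℝ}

theorem setLIntegral_eq (h : IsDilation μ T ρ M Q) {F : X → ℝ≥0∞} (hF : Measurable F)
    (hFT : ∀ r > 0, ∀ x, F (T r x) = ENNReal.ofReal (r ^ s) * F x) {τ : ℝ} (hτ : 0 < τ) :
    ∫⁻ x in {x | ρ x ≤ τ}, F x ∂μ =
      ENNReal.ofReal (τ ^ ((s + Q) / M)) * ∫⁻ x in {x | ρ x ≤ 1}, F x ∂μ := by
  -- For this r the map T r pulls {ρ ≤ τ} back to {ρ ≤ 1}.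
  set r := τ ^ (1 / M) with hr
  have hr0 : 0 < r := Real.rpow_pos_of_pos hτ _
  have hrM : r ^ M = τ := by
    rw [hr, ← Real.rpow_mul hτ.le, one_div_mul_cancel h.pos.ne', Real.rpow_one]
  have hset : ∀ c : ℝ, MeasurableSet {x | ρ x ≤ c} := fun c =>
    measurableSet_le h.measurable_gauge measurable_const
  have hpre : T r ⁻¹' {x | ρ x ≤ τ} = {x | ρ x ≤ 1} := by
    ext x
    rw [Set.mem_preimage, Set.mem_ofPred_eq, Set.mem_ofPred_eq, h.gauge_map r hr0, hrM]
    constructor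
    · intro hx
      by_contra hcon
      nlinarith [not_le.1 hcon]
    · intro hx
      nlinarith
  nth_rewrite 1 [h.measure_map r hr0]
  rw [Measure.restrict_smul, lintegral_smul_measure, setLIntegral_map (hset τ) hF (h.measurable r),
    hpre]
  simp_rw [hFT r hr0]
  rw [lintegral_const_mul _ hF, smul_eq_mul, ← mul_assoc, ← ENNReal.ofReal_mul (by positivity),
    ← Real.rpow_add hr0, hr, ← Real.rpow_mul hτ.le]
  congr 3
  ring

/-- Write e^{-ρ} as the integral of e^{-τ} over τ > ρ and exchange the integrals. Scaling turns the
integral of F over {ρ ≤ τ} into τ^{(s+Q)/M} times the one over {ρ ≤ 1}. What remains is a Gamma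
integral, convergent by `hs`. -/
theorem lintegral_mul_exp_neg (h : IsDilation μ T ρ M Q) [SFinite μ] (hs : 0 < s + Q + M)
    {F : X → ℝ≥0∞} (hF : Measurable F)
    (hFT : ∀ r > 0, ∀ x, F (T r x) = ENNReal.ofReal (r ^ s) * F x) :
    ∫⁻ x, F x * ENNReal.ofReal (Real.exp (-ρ x)) ∂μ =
      ENNReal.ofReal (Real.Gamma ((s + Q) / M + 1)) * ∫⁻ x in {x | ρ x ≤ 1}, F x ∂μ := by
  have hexp : ∀ x, ENNReal.ofReal (Real.exp (-ρ x)) =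
      ∫⁻ τ in Set.Ioi 0, Set.indicator {τ | ρ x ≤ τ} (fun τ => ENNReal.ofReal (Real.exp (-τ))) τ := by
    intro x
    have hms : MeasurableSet {τ : ℝ | ρ x ≤ τ} := measurableSet_Ici
    rw [setLIntegral_indicator hms]
    have h1 : ({τ : ℝ | ρ x ≤ τ} ∩ Set.Ioi 0 : Set ℝ) =ᵐ[volume] Set.Ioi (ρ x) := by
      have h2 : ({τ : ℝ | ρ x ≤ τ} ∩ Set.Ioi 0 : Set ℝ) =ᵐ[volume]
          (Set.Ici (ρ x) ∩ Set.Ici 0 : Set ℝ) :=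
        (ae_eq_refl _).inter Ioi_ae_eq_Ici
      rw [Set.Ici_inter_Ici, sup_eq_left.2 (h.gauge_nonneg x)] at h2
      exact h2.trans Ioi_ae_eq_Ici.symm
    rw [setLIntegral_congr h1, ← ofReal_integral_eq_lintegral_ofReal
      (integrableOn_exp_neg_Ioi _) (Eventually.of_forall fun τ => (Real.exp_pos _).le),
      integral_exp_neg_Ioi]
  have hjm : Measurable (fun z : X × ℝ => F z.1 *
      Set.indicator {τ | ρ z.1 ≤ τ} (fun τ => ENNReal.ofReal (Real.exp (-τ))) z.2) := by
    refine (hF.comp measurable_fst).mul ?_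
    have : (fun z : X × ℝ =>
        Set.indicator {τ | ρ z.1 ≤ τ} (fun τ => ENNReal.ofReal (Real.exp (-τ))) z.2) =
        Set.indicator {z : X × ℝ | ρ z.1 ≤ z.2} (fun z => ENNReal.ofReal (Real.exp (-z.2))) := by
      funext z
      simp only [Set.indicator, Set.mem_ofPred_eq]
    rw [this]
    exact (Measurable.ennreal_ofReal (by fun_prop)).indicator
      (measurableSet_le (h.measurable_gauge.comp measurable_fst) measurable_snd)
  calc ∫⁻ x, F x * ENNReal.ofReal (Real.exp (-ρ x)) ∂μ
      = ∫⁻ x, (∫⁻ τ in Set.Ioi 0, F x *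
          Set.indicator {τ | ρ x ≤ τ} (fun τ => ENNReal.ofReal (Real.exp (-τ))) τ) ∂μ := by
        refine lintegral_congr fun x => ?_
        rw [hexp x, lintegral_const_mul]
        exact (Measurable.ennreal_ofReal (by fun_prop)).indicator
          (measurableSet_le measurable_const measurable_id)
    _ = ∫⁻ τ in Set.Ioi 0, (∫⁻ x, F x *
          Set.indicator {τ | ρ x ≤ τ} (fun τ => ENNReal.ofReal (Real.exp (-τ))) τ ∂μ) :=
        lintegral_lintegral_swap hjm.aemeasurable
    _ = ∫⁻ τ in Set.Ioi 0, ENNReal.ofReal (Real.exp (-τ) * τ ^ ((s + Q) / M)) *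
          ∫⁻ x in {x | ρ x ≤ 1}, F x ∂μ := by
        refine setLIntegral_congr_fun measurableSet_Ioi fun τ hτ => ?_
        have hτ : 0 < τ := hτ
        have h1 : ∀ x, F x *
            Set.indicator {τ | ρ x ≤ τ} (fun τ => ENNReal.ofReal (Real.exp (-τ))) τ =
            Set.indicator {x | ρ x ≤ τ} F x * ENNReal.ofReal (Real.exp (-τ)) := fun x => by
          by_cases hx : ρ x ≤ τ <;> simp [Set.indicator, hx]
        simp_rw [h1]
        rw [lintegral_mul_const _ (hF.indicator (measurableSet_le h.measurable_gauge
          measurable_const)), lintegral_indicator (measurableSet_le h.measurable_gauge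
          measurable_const), h.setLIntegral_eq hF hFT hτ, ENNReal.ofReal_mul (Real.exp_pos _).le]
        ring
    _ = _ := by
        have hs' : 0 < (s + Q) / M + 1 := by
          have : (s + Q) / M + 1 = (s + Q + M) / M := by field_simp [h.pos.ne']
          rw [this]; exact div_pos hs h.pos
        have hG := Real.GammaIntegral_convergent hs'
        have hG2 := Real.Gamma_eq_integral hs'
        rw [add_sub_cancel_right] at hG hG2
        rw [lintegral_mul_const _ (by fun_prop), hG2, ofReal_integral_eq_lintegral_ofReal hG]
        filter_upwards [ae_restrict_mem measurableSet_Ioi] with τ hτ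
        have : (0 : ℝ) < τ := hτ
        simp only [Pi.zero_apply]
        positivity

/-- The Gamma factor is positive and finite, so the two integrals of |F| are finite together. -/
theorem integrableOn_iff (h : IsDilation μ T ρ M Q) [SFinite μ] (hs : 0 < s + Q + M)
    {F : X → ℝ} (hF : Measurable F) (hFT : ∀ r > 0, ∀ x, F (T r x) = r ^ s * F x) :
    Integrable (fun x => F x * Real.exp (-ρ x)) μ ↔ IntegrableOn F {x | ρ x ≤ 1} μ := by
  have hm : Measurable fun x => F x * Real.exp (-ρ x) := hF.mul h.measurable_gauge.neg.exp
  have h1 := h.lintegral_mul_exp_neg (s := s) hs (F := fun x => ‖F x‖ₑ) hF.enorm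
    fun r hr x => by
      rw [hFT r hr, enorm_mul, Real.enorm_of_nonneg (by positivity)]
  have hs' : 0 < (s + Q) / M + 1 := by
    have : (s + Q) / M + 1 = (s + Q + M) / M := by field_simp [h.pos.ne']
    rw [this]; exact div_pos hs h.pos
  have hG : ENNReal.ofReal (Real.Gamma ((s + Q) / M + 1)) ≠ 0 := by
    rw [Ne, ENNReal.ofReal_eq_zero, not_le]; exact Real.Gamma_pos_of_pos hs'
  rw [Integrable, IntegrableOn, Integrable, and_iff_right hm.aestronglyMeasurable,
    and_iff_right hF.aestronglyMeasurable, HasFiniteIntegral, HasFiniteIntegral]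
  have h2 : ∫⁻ x, ‖F x * Real.exp (-ρ x)‖ₑ ∂μ =
      ∫⁻ x, ‖F x‖ₑ * ENNReal.ofReal (Real.exp (-ρ x)) ∂μ := by
    refine lintegral_congr fun x => ?_
    rw [enorm_mul, Real.enorm_of_nonneg (Real.exp_pos _).le]
  rw [h2, h1, ENNReal.mul_lt_top_iff]
  simp only [ENNReal.ofReal_lt_top, true_and, hG, false_or]
  constructor
  · rintro (h | h)
    · exact h
    · rw [h]; exact ENNReal.zero_lt_top
  · exact Or.inl

theorem integral_mul_exp_neg (h : IsDilation μ T ρ M Q) [SFinite μ] (hs : 0 < s + Q + M)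
    {F : X → ℝ} (hF : Measurable F) (hFT : ∀ r > 0, ∀ x, F (T r x) = r ^ s * F x)
    (hi : IntegrableOn F {x | ρ x ≤ 1} μ) :
    ∫ x, F x * Real.exp (-ρ x) ∂μ =
      Real.Gamma ((s + Q) / M + 1) * ∫ x in {x | ρ x ≤ 1}, F x ∂μ := by
  have hs' : 0 < (s + Q) / M + 1 := by
    have : (s + Q) / M + 1 = (s + Q + M) / M := by field_simp [h.pos.ne']
    rw [this]; exact div_pos hs h.pos
  have key : ∀ H : X → ℝ, Measurable H → (∀ r > 0, ∀ x, H (T r x) = r ^ s * H x) →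
      (∫⁻ x, ENNReal.ofReal (H x * Real.exp (-ρ x)) ∂μ).toReal =
        Real.Gamma ((s + Q) / M + 1) *
          (∫⁻ x in {x | ρ x ≤ 1}, ENNReal.ofReal (H x) ∂μ).toReal := by
    intro H hH hHT
    have := h.lintegral_mul_exp_neg (s := s) hs (F := fun x => ENNReal.ofReal (H x))
      hH.ennreal_ofReal fun r hr x => by
        rw [hHT r hr, ENNReal.ofReal_mul (by positivity)]
    simp_rw [ENNReal.ofReal_mul' (Real.exp_pos _).le]
    rw [this, ENNReal.toReal_mul, ENNReal.toReal_ofReal (Real.Gamma_pos_of_pos hs').le]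
  rw [integral_eq_lintegral_pos_part_sub_lintegral_neg_part ((h.integrableOn_iff hs hF hFT).2 hi),
    integral_eq_lintegral_pos_part_sub_lintegral_neg_part hi, key F hF hFT, mul_sub]
  congr 1
  have := key (fun x => -F x) hF.neg fun r hr x => by rw [hFT r hr, mul_neg]
  simp_rw [neg_mul] at this
  exact this

end IsDilation

theorem isDilation_smul (E : Type*) [NormedAddCommGroup E] [NormedSpace ℝ E]
    [FiniteDimensional ℝ E] [MeasurableSpace E] [BorelSpace E] (μ : Measure E)
    [μ.IsAddHaarMeasure] {M : ℝ} (hM : 0 < M) :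
    IsDilation μ (fun r x => r • x) (fun x : E => ‖x‖ ^ M) M (Module.finrank ℝ E) where
  pos := hM
  measurable r := by fun_prop
  measurable_gauge := by fun_prop
  gauge_nonneg x := by positivity
  gauge_map r hr x := by
    rw [norm_smul, Real.norm_of_nonneg hr.le, Real.mul_rpow hr.le (norm_nonneg x)]
  measure_map r hr := by
    rw [Measure.map_addHaar_smul μ hr.ne', smul_smul, ← ENNReal.ofReal_mul (by positivity),
      Real.rpow_natCast, abs_of_pos (by positivity), mul_inv_cancel₀ (by positivity),
      ENNReal.ofReal_one, one_smul]

theorem setOf_norm_rpow_le_one {E : Type*} [NormedAddCommGroup E] {M : ℝ} (hM : 0 < M) :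
    {x : E | ‖x‖ ^ M ≤ 1} = Metric.closedBall 0 1 := by
  ext x
  rw [Set.mem_ofPred_eq, mem_closedBall_zero_iff, ← Real.one_rpow M,
    Real.rpow_le_rpow_iff (norm_nonneg x) zero_le_one hM, Real.one_rpow]

end Homogeneous

section Gaussian

theorem integrable_comp_abs {f : ℝ → ℝ} (hf : IntegrableOn f (Set.Ioi 0)) :
    Integrable fun x => f |x| := by
  have h1 : IntegrableOn (fun x => f |x|) (Set.Ioi 0) :=
    hf.congr_fun (fun x hx => by rw [abs_of_pos hx]) measurableSet_Ioi
  have h2 : IntegrableOn (fun x => f |x|) (Set.Iio 0) := by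
    have := (Measure.measurePreserving_neg (volume : Measure ℝ)).integrableOn_comp_preimage
      (MeasurableEquiv.neg ℝ).measurableEmbedding (f := fun x => f |x|) (s := Set.Ioi 0)
    have h3 := this.2 h1
    have h4 : (Neg.neg ⁻¹' Set.Ioi (0 : ℝ)) = Set.Iio 0 := by ext; simp
    rw [h4] at h3
    simpa [Function.comp_def] using h3
  have h3 : IntegrableOn (fun x => f |x|) (Set.Iic 0) :=
    (integrableOn_Iic_iff_integrableOn_Iio (by simp)).2 h2
  rw [← integrableOn_univ, ← Set.Iic_union_Ioi (a := (0 : ℝ))]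
  exact h3.union h1

theorem integrable_abs_rpow_mul_exp_neg_sq {s : ℝ} (hs : -1 < s) :
    Integrable fun x : ℝ => |x| ^ s * Real.exp (-x ^ 2) := by
  have := integrable_comp_abs (integrableOn_rpow_mul_exp_neg_rpow hs two_pos)
  simpa using this

theorem integral_abs_rpow_mul_exp_neg_sq {s : ℝ} (hs : -1 < s) :
    ∫ x : ℝ, |x| ^ s * Real.exp (-x ^ 2) = Real.Gamma ((s + 1) / 2) := by
  have h1 := integral_comp_abs (f := fun x : ℝ => x ^ s * Real.exp (-x ^ (2 : ℝ)))
  rw [integral_rpow_mul_exp_neg_rpow two_pos hs] at h1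
  simp only [Real.rpow_two, sq_abs] at h1
  rw [h1]; ring

/-- The weight `|x|^s e^{-x²}` on the line. -/
def gaussWeight (s x : ℝ) : ℝ := |x| ^ s * Real.exp (-x ^ 2)

theorem integrable_gaussWeight {s : ℝ} (hs : -1 < s) : Integrable (gaussWeight s) :=
  integrable_abs_rpow_mul_exp_neg_sq hs

theorem abs_rpow_add_two {s : ℝ} (hs : -1 < s) (x : ℝ) : |x| ^ s * (x * x) = |x| ^ (s + 2) := by
  rcases eq_or_ne x 0 with rfl | hx
  · simp [Real.zero_rpow (by linarith : s + 2 ≠ 0)]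
  · rw [Real.rpow_add (abs_pos.2 hx), Real.rpow_two, sq_abs, pow_two]

theorem gaussWeight_add_two {s : ℝ} (hs : -1 < s) (x : ℝ) :
    x * x * gaussWeight s x = gaussWeight (s + 2) x := by
  rw [gaussWeight, gaussWeight, ← abs_rpow_add_two hs]; ring

theorem integral_sq_mul_gaussWeight {s : ℝ} (hs : -1 < s) :
    ∫ x, x * x * gaussWeight s x = (s + 1) / 2 * ∫ x, gaussWeight s x := by
  simp_rw [gaussWeight_add_two hs]
  simp only [gaussWeight]
  rw [integral_abs_rpow_mul_exp_neg_sq hs, integral_abs_rpow_mul_exp_neg_sq (by linarith),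
    ← Real.Gamma_add_one (by linarith : (s + 1) / 2 ≠ 0)]
  congr 1; ring

theorem integrable_sq_mul_gaussWeight {s : ℝ} (hs : -1 < s) :
    Integrable fun x => x * x * gaussWeight s x := by
  simp_rw [gaussWeight_add_two hs]
  exact integrable_gaussWeight (by linarith)

theorem integral_mul_gaussWeight (s : ℝ) : ∫ x, x * gaussWeight s x = 0 := by
  have h := integral_neg_eq_self (fun x => x * gaussWeight s x) volume
  have h2 : ∀ x, -x * gaussWeight s (-x) = -(x * gaussWeight s x) := fun x => by
    simp [gaussWeight]
  simp_rw [h2] at h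
  rw [integral_neg] at h
  linarith

theorem integrable_mul_gaussWeight {s : ℝ} (hs : -1 < s) :
    Integrable fun x => x * gaussWeight s x := by
  refine ((integrable_gaussWeight hs).add (integrable_sq_mul_gaussWeight hs)).mono' ?_ ?_
  · have : Measurable fun x => x * gaussWeight s x := by unfold gaussWeight; fun_prop
    exact this.aestronglyMeasurable
  · refine Eventually.of_forall fun x => ?_
    have h0 : 0 ≤ gaussWeight s x := by unfold gaussWeight; positivity
    rw [norm_mul, Real.norm_of_nonneg h0, Real.norm_eq_abs, Pi.add_apply]
    have : |x| ≤ 1 + x * x := by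
      rw [← abs_mul_abs_self x]; nlinarith [sq_nonneg (|x| - 1)]
    nlinarith

variable {ι : Type*} [Fintype ι] [DecidableEq ι]

/-- Distributes x_i x_j over the coordinates, so that second moments of a product weight become
products of one-dimensional integrals, also for i = j. -/
theorem prod_ite_mul_ite (i j : ι) (w : ι → ℝ → ℝ) (x : ι → ℝ) :
    ∏ l, (fun t => (if l = i then t else 1) * (if l = j then t else 1) * w l t) (x l) =
      x i * x j * ∏ l, w l (x l) := by
  simp only [Finset.prod_mul_distrib, Finset.prod_ite_eq', Finset.mem_univ, if_true]

theorem integrable_coord_mul_coord_mul_prod (i j : ι) {s : ι → ℝ} (hs : ∀ l, -1 < s l) :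
    Integrable fun x : ι → ℝ => x i * x j * ∏ l, gaussWeight (s l) (x l) := by
  simp_rw [← prod_ite_mul_ite i j (fun l => gaussWeight (s l))]
  refine Integrable.fintype_prod (𝕜 := ℝ) (μ := fun _ : ι => (volume : Measure ℝ))
    (f := fun l t => (if l = i then t else 1) * (if l = j then t else 1) * gaussWeight (s l) t)
    fun l => ?_
  rcases eq_or_ne l i with rfl | h1 <;> rcases eq_or_ne l j with rfl | h2
  · simpa using integrable_sq_mul_gaussWeight (hs l)
  · simpa [h2] using integrable_mul_gaussWeight (hs l)
  · simpa [h1] using integrable_mul_gaussWeight (hs l)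
  · simpa [h1, h2] using integrable_gaussWeight (hs l)

/-- Off the diagonal a factor with odd integrand vanishes. On the diagonal the recursion of the
Gamma function produces (s + 1)/2. -/
theorem integral_coord_mul_coord_mul_prod (i j : ι) {s : ι → ℝ} (hs : ∀ l, -1 < s l) :
    ∫ x : ι → ℝ, x i * x j * ∏ l, gaussWeight (s l) (x l) =
      (if i = j then (s i + 1) / 2 else 0) * ∫ x : ι → ℝ, ∏ l, gaussWeight (s l) (x l) := by
  simp_rw [← prod_ite_mul_ite i j (fun l => gaussWeight (s l))]
  have e1 := integral_fintype_prod_eq_prod (fun l t => (if l = i then t else 1) *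
    (if l = j then t else 1) * gaussWeight (s l) t) (μ := fun _ : ι => (volume : Measure ℝ))
  have e2 := integral_fintype_prod_eq_prod (fun l t => gaussWeight (s l) t)
    (μ := fun _ : ι => (volume : Measure ℝ))
  rw [← volume_pi] at e1 e2
  rw [e1, e2]
  rcases eq_or_ne i j with rfl | hij
  · rw [if_pos rfl, ← Finset.mul_prod_erase _ _ (Finset.mem_univ i),
      ← Finset.mul_prod_erase _ (fun l => ∫ t, gaussWeight (s l) t) (Finset.mem_univ i)]
    simp only [if_true]
    rw [integral_sq_mul_gaussWeight (hs i), mul_assoc]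
    congr 2
    refine Finset.prod_congr rfl fun l hl => ?_
    simp [(Finset.mem_erase.1 hl).1]
  · rw [if_neg hij, zero_mul]
    refine Finset.prod_eq_zero (Finset.mem_univ i) ?_
    simp only [if_true, if_neg hij, mul_one]
    exact integral_mul_gaussWeight _

end Gaussian

end Carnot

/-! ### Telescoping Beta quotients; Gaussian means of quadratic forms -/

namespace Carnot

section Beta

theorem betaFn_eq {a b : ℝ} (ha : 0 < a) (hb : 0 < b) :
    betaFn a b = Real.Gamma a * Real.Gamma b / Real.Gamma (a + b) := by
  have h := ProbabilityTheory.beta_eq_betaIntegralReal a b ha hb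
  rw [ProbabilityTheory.beta] at h
  rw [h, betaFn, Complex.betaIntegral]
  have h1 : ∫ x in (0 : ℝ)..1, (x : ℂ) ^ ((a : ℂ) - 1) * (1 - (x : ℂ)) ^ ((b : ℂ) - 1) =
      ∫ x in (0 : ℝ)..1, ((x ^ (a - 1) * (1 - x) ^ (b - 1) : ℝ) : ℂ) := by
    refine intervalIntegral.integral_congr fun x hx => ?_
    rw [Set.uIcc_of_le zero_le_one] at hx
    rw [Complex.ofReal_mul, Complex.ofReal_cpow hx.1, Complex.ofReal_cpow (by linarith [hx.2])]
    push_cast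
    rfl
  rw [h1, intervalIntegral.integral_ofReal, Complex.ofReal_re]

/-- In B(a, b) = Γ(a)Γ(b)/Γ(a+b) the factor Γ(a) cancels from each quotient. Adding a = j v_j / M to
b extends the sum inside b by the term i = j, so the sum a + b at index j is the second argument at
index j + 1, and the product telescopes. The induction runs over the upper index K with M fixed,
although M depends on the step in the application. -/
theorem prod_betaFn_div_betaFn (v : ℕ → ℕ) {P M : ℝ} (hP : 1 < P) (hM : 0 < M) {K : ℕ}
    (hK : 1 ≤ K) (hv : ∀ j ∈ Finset.Icc 1 K, 0 < v j) :
    ∏ j ∈ Finset.Icc 2 K,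
        (betaFn (j * v j / M) ((P + ∑ i ∈ Finset.Ico 1 j, (i * v i : ℝ)) / M + 1) /
          betaFn (j * v j / M) ((P - 2 + ∑ i ∈ Finset.Ico 1 j, (i * v i : ℝ)) / M + 1)) =
      Real.Gamma ((P + v 1) / M + 1) / Real.Gamma ((P - 2 + v 1) / M + 1) *
        (Real.Gamma ((P - 2 + ∑ i ∈ Finset.Ico 1 (K + 1), (i * v i : ℝ)) / M + 1) /
          Real.Gamma ((P + ∑ i ∈ Finset.Ico 1 (K + 1), (i * v i : ℝ)) / M + 1)) := by
  induction K, hK using Nat.le_induction with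
  | base =>
    have h1 : (1 : ℝ) ≤ v 1 := by exact_mod_cast hv 1 (by simp)
    have e1 : Real.Gamma ((P + v 1) / M + 1) ≠ 0 := (Real.Gamma_pos_of_pos (by
      have : 0 < (P + v 1) / M := div_pos (by linarith) hM
      linarith)).ne'
    have e2 : Real.Gamma ((P - 2 + v 1) / M + 1) ≠ 0 := (Real.Gamma_pos_of_pos (by
      have : 0 < (P - 2 + v 1) / M := div_pos (by linarith) hM
      linarith)).ne'
    simp only [Nat.reduceAdd, Nat.Ico_succ_singleton, Finset.sum_singleton, Nat.cast_one, one_mul]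
    generalize Real.Gamma ((P + v 1) / M + 1) = x at *
    generalize Real.Gamma ((P - 2 + v 1) / M + 1) = y at *
    simp
    field_simp
  | succ K hK ih =>
    have hS1 : (1 : ℝ) ≤ ∑ i ∈ Finset.Ico 1 (K + 1), (i * v i : ℝ) := by
      have h1 : (1 : ℝ) ≤ v 1 := by exact_mod_cast hv 1 (by simp)
      have := Finset.single_le_sum (f := fun i : ℕ => (i * v i : ℝ)) (s := Finset.Ico 1 (K + 1))
        (fun i _ => by positivity) (Finset.mem_Ico.2 ⟨le_refl 1, by omega⟩)
      simp only [Nat.cast_one, one_mul] at this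
      linarith
    have hvK : (0 : ℝ) < v (K + 1) := by
      exact_mod_cast hv (K + 1) (Finset.mem_Icc.2 ⟨by omega, le_refl _⟩)
    rw [← Finset.insert_Icc_right_eq_Icc_add_one (by omega : 2 ≤ K + 1),
      Finset.prod_insert (by simp),
      ih fun j hj => hv j (Finset.Icc_subset_Icc_right (Nat.le_succ K) hj),
      Finset.sum_Ico_succ_top (by omega : 1 ≤ K + 1)]
    set S := ∑ i ∈ Finset.Ico 1 (K + 1), (i * v i : ℝ)
    have hK0 : (0 : ℝ) < ((K + 1 : ℕ) : ℝ) := by positivity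
    have ha : 0 < ((K + 1 : ℕ) : ℝ) * v (K + 1) / M := by positivity
    have hb : 0 < (P + S) / M + 1 := by
      have : 0 < (P + S) / M := div_pos (by linarith) hM
      linarith
    have hb' : 0 < (P - 2 + S) / M + 1 := by
      have : 0 < (P - 2 + S) / M := div_pos (by linarith) hM
      linarith
    rw [betaFn_eq ha hb, betaFn_eq ha hb',
      show ((K + 1 : ℕ) : ℝ) * v (K + 1) / M + ((P + S) / M + 1) =
        (P + (S + ((K + 1 : ℕ) : ℝ) * v (K + 1))) / M + 1 by ring,
      show ((K + 1 : ℕ) : ℝ) * v (K + 1) / M + ((P - 2 + S) / M + 1) =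
        (P - 2 + (S + ((K + 1 : ℕ) : ℝ) * v (K + 1))) / M + 1 by ring]
    have g1 := (Real.Gamma_pos_of_pos ha).ne'
    have g2 := (Real.Gamma_pos_of_pos hb).ne'
    have g3 := (Real.Gamma_pos_of_pos hb').ne'
    have g4 : Real.Gamma ((P + (S + ((K + 1 : ℕ) : ℝ) * v (K + 1))) / M + 1) ≠ 0 :=
      (Real.Gamma_pos_of_pos (by
        have : 0 < (P + (S + ((K + 1 : ℕ) : ℝ) * v (K + 1))) / M :=
          div_pos (by nlinarith [mul_pos hK0 hvK]) hM
        linarith)).ne'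
    have g5 : Real.Gamma ((P - 2 + (S + ((K + 1 : ℕ) : ℝ) * v (K + 1))) / M + 1) ≠ 0 :=
      (Real.Gamma_pos_of_pos (by
        have : 0 < (P - 2 + (S + ((K + 1 : ℕ) : ℝ) * v (K + 1))) / M :=
          div_pos (by nlinarith [mul_pos hK0 hvK]) hM
        linarith)).ne'
    generalize Real.Gamma ((P + (S + ((K + 1 : ℕ) : ℝ) * v (K + 1))) / M + 1) = x at *
    generalize Real.Gamma ((P - 2 + (S + ((K + 1 : ℕ) : ℝ) * v (K + 1))) / M + 1) = y at *
    generalize Real.Gamma ((P + S) / M + 1) = z at *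
    generalize Real.Gamma ((P - 2 + S) / M + 1) = w at *
    generalize Real.Gamma (((K + 1 : ℕ) : ℝ) * v (K + 1) / M) = a at *
    field_simp

end Beta

section QuadForm

variable {n : ℕ}

theorem quadForm_smul (A : Matrix (Fin n) (Fin n) ℝ) (r : ℝ) (x : EuclideanSpace ℝ (Fin n)) :
    quadForm A (r • x) = r ^ 2 * quadForm A x := by
  simp only [quadForm, WithLp.ofLp_smul, Matrix.mulVec_smul, smul_dotProduct, dotProduct_smul,
    smul_eq_mul]
  ring

theorem quadForm_eq_sum (A : Matrix (Fin n) (Fin n) ℝ) (x : EuclideanSpace ℝ (Fin n)) :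
    quadForm A x = ∑ i, ∑ j, A i j * (x i * x j) := by
  simp only [quadForm, dotProduct, Matrix.mulVec, Finset.sum_mul]
  refine Finset.sum_congr rfl fun i _ => Finset.sum_congr rfl fun j _ => ?_
  ring

@[fun_prop]
theorem continuous_quadForm (A : Matrix (Fin n) (Fin n) ℝ) : Continuous (quadForm A) := by
  have : quadForm A = fun x => ∑ i, ∑ j, A i j * (x i * x j) := funext (quadForm_eq_sum A)
  rw [this]
  fun_prop

theorem quadForm_eq_inner (A : Matrix (Fin n) (Fin n) ℝ) (x : EuclideanSpace ℝ (Fin n)) :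
    quadForm A x = inner ℝ x (Matrix.toEuclideanLin A x) := by
  rw [EuclideanSpace.inner_eq_star_dotProduct]
  simp [quadForm]

theorem quadForm_orthonormalBasis (A : Matrix (Fin n) (Fin n) ℝ)
    (b : OrthonormalBasis (Fin n) ℝ (EuclideanSpace ℝ (Fin n))) (x : EuclideanSpace ℝ (Fin n)) :
    quadForm A x = ∑ i, ∑ j, b.repr x i * b.repr x j *
      inner ℝ (b i) (Matrix.toEuclideanLin A (b j)) := by
  rw [quadForm_eq_inner]
  conv_lhs => rw [← b.sum_repr x]
  simp only [map_sum, map_smul, sum_inner, inner_sum, inner_smul_left, inner_smul_right,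
    RCLike.conj_to_real, Finset.mul_sum]
  rw [Finset.sum_comm]
  refine Finset.sum_congr rfl fun i _ => Finset.sum_congr rfl fun j _ => ?_
  ring

theorem sum_quadForm_orthonormalBasis (A : Matrix (Fin n) (Fin n) ℝ)
    (b : OrthonormalBasis (Fin n) ℝ (EuclideanSpace ℝ (Fin n))) :
    ∑ i, quadForm A (b i) = A.trace := by
  simp_rw [quadForm_eq_inner]
  rw [← LinearMap.trace_eq_sum_inner, Matrix.toEuclideanLin_eq_toLin_orthonormal,
    Matrix.trace_toLin_eq]

/-- In an orthonormal basis containing e the weight is a product of one-variable weights, with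
exponent s along e and 0 in the other directions. Only the diagonal second moments survive: (s +
1)/2 along e and 1/2 elsewhere. They add up to half the trace plus s/2 times the value at e. -/
theorem gaussian_integral_quadForm (A : Matrix (Fin n) (Fin n) ℝ) {e : EuclideanSpace ℝ (Fin n)}
    (he : ‖e‖ = 1) {s : ℝ} (hs : -1 < s) :
    Integrable (fun x => |inner ℝ e x| ^ s * Real.exp (-‖x‖ ^ 2)) ∧
    Integrable (fun x => |inner ℝ e x| ^ s * quadForm A x * Real.exp (-‖x‖ ^ 2)) ∧
    ∫ x, |inner ℝ e x| ^ s * quadForm A x * Real.exp (-‖x‖ ^ 2) =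
      (A.trace + s * quadForm A e) / 2 * ∫ x, |inner ℝ e x| ^ s * Real.exp (-‖x‖ ^ 2) := by
  obtain ⟨i₀⟩ : Nonempty (Fin n) := by
    by_contra h
    rw [not_nonempty_iff] at h
    rw [Subsingleton.elim e 0, norm_zero] at he
    exact zero_ne_one he
  obtain ⟨b, hb⟩ := Orthonormal.exists_orthonormalBasis_extension_of_card_eq (𝕜 := ℝ)
    (E := EuclideanSpace ℝ (Fin n)) (ι := Fin n) (by simp) (v := fun _ => e) (s := {i₀})
    (by
      rw [orthonormal_iff_ite]
      rintro ⟨i, hi⟩ ⟨j, hj⟩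
      have : i = j := by rw [Set.mem_singleton_iff.1 hi, Set.mem_singleton_iff.1 hj]
      simp [this, he])
  have hbe : b i₀ = e := hb i₀ rfl
  set t : Fin n → ℝ := fun l => if l = i₀ then s else 0 with ht
  have hts : ∀ l, -1 < t l := fun l => by
    simp only [ht]; split_ifs
    · exact hs
    · norm_num
  set T : EuclideanSpace ℝ (Fin n) → Fin n → ℝ := fun x => WithLp.ofLp (b.repr x) with hT
  have hTm : MeasurePreserving T volume volume :=
    (PiLp.volume_preserving_ofLp (Fin n)).comp b.measurePreserving_repr
  have hTe : MeasurableEmbedding T :=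
    (MeasurableEquiv.toLp 2 (Fin n → ℝ)).symm.measurableEmbedding.comp
      b.repr.toHomeomorph.measurableEmbedding
  have hw : ∀ x, |inner ℝ e x| ^ s * Real.exp (-‖x‖ ^ 2) = ∏ l, gaussWeight (t l) (T x l) := by
    intro x
    simp only [gaussWeight, Finset.prod_mul_distrib, hT, ht]
    rw [← Real.exp_sum, Finset.prod_eq_single i₀ (fun l _ hl => by simp [hl]) (by simp)]
    simp only [if_true]
    rw [← hbe, ← b.repr_apply_apply, ← b.repr.norm_map x, EuclideanSpace.norm_sq_eq]
    simp
  have hq : ∀ x, |inner ℝ e x| ^ s * quadForm A x * Real.exp (-‖x‖ ^ 2) =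
      ∑ i, ∑ j, inner ℝ (b i) (Matrix.toEuclideanLin A (b j)) *
        (T x i * T x j * ∏ l, gaussWeight (t l) (T x l)) := by
    intro x
    rw [mul_right_comm, hw, quadForm_orthonormalBasis A b x, Finset.mul_sum]
    refine Finset.sum_congr rfl fun i _ => ?_
    rw [Finset.mul_sum]
    refine Finset.sum_congr rfl fun j _ => ?_
    simp only [hT]; ring
  have hi0 : Integrable (fun y : Fin n → ℝ => ∏ l, gaussWeight (t l) (y l)) :=
    Integrable.fintype_prod (𝕜 := ℝ) (μ := fun _ : Fin n => (volume : Measure ℝ))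
      (f := fun l y => gaussWeight (t l) y) fun l => integrable_gaussWeight (hts l)
  have hij := fun i j => (integrable_coord_mul_coord_mul_prod i j hts).const_mul
    (inner ℝ (b i) (Matrix.toEuclideanLin A (b j)))
  have hsum : Integrable (fun y : Fin n → ℝ => ∑ i, ∑ j,
      inner ℝ (b i) (Matrix.toEuclideanLin A (b j)) *
        (y i * y j * ∏ l, gaussWeight (t l) (y l))) :=
    integrable_finsetSum _ fun i _ => integrable_finsetSum _ fun j _ => hij i j
  refine ⟨?_, ?_, ?_⟩
  · simp_rw [hw]
    exact (hTm.integrable_comp_emb hTe).2 hi0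
  · simp_rw [hq]
    exact (hTm.integrable_comp_emb hTe).2 hsum
  · simp_rw [hq, hw]
    rw [hTm.integral_comp hTe (fun y => ∑ i, ∑ j,
      inner ℝ (b i) (Matrix.toEuclideanLin A (b j)) *
        (y i * y j * ∏ l, gaussWeight (t l) (y l))),
      hTm.integral_comp hTe (fun y => ∏ l, gaussWeight (t l) (y l)),
      integral_finsetSum _ fun i _ => integrable_finsetSum _ fun j _ => hij i j]
    simp_rw [integral_finsetSum _ fun j _ => hij _ j, integral_const_mul,
      integral_coord_mul_coord_mul_prod _ _ hts]
    simp only [← mul_assoc, ← Finset.sum_mul]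
    congr 1
    simp only [mul_ite, mul_zero, Finset.sum_ite_eq, Finset.mem_univ, if_true]
    rw [← sum_quadForm_orthonormalBasis A b, ← hbe]
    simp_rw [← quadForm_eq_inner]
    have : ∀ i, quadForm A (b i) * ((t i + 1) / 2) =
        quadForm A (b i) / 2 + (if i = i₀ then s * quadForm A (b i) / 2 else 0) := by
      intro i
      simp only [ht]; split_ifs <;> ring
    simp_rw [this]
    rw [Finset.sum_add_distrib, Finset.sum_ite_eq', if_pos (Finset.mem_univ _), ← Finset.sum_div]
    ring

end QuadForm

end Carnot

/-! ### The gauge, its dilations and the unit ball -/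

namespace Carnot

variable {k : ℕ} {v : ℕ → ℕ}

/-- The gauge `∑_j ‖x^{(j)}‖^{2 k! / j}`, a power of the homogeneous pseudonorm. -/
def gauge (x : Coord k v) : ℝ :=
  ∑ j : Finset.Icc 1 k, ‖x j‖ ^ (2 * (k ! : ℝ) / (j : ℕ))

/-- The homogeneous dimension. -/
def homDim (k : ℕ) (v : ℕ → ℕ) : ℝ := ∑ i ∈ Finset.Ico 1 (k + 1), (i * v i : ℝ)

/-- The dilation that multiplies the `j`-th layer by `r ^ j`. -/
def dil (r : ℝ) : Coord k v →L[ℝ] Coord k v :=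
  ContinuousLinearMap.pi fun j => r ^ (j : ℕ) • ContinuousLinearMap.proj j

@[simp] theorem dil_apply (r : ℝ) (x : Coord k v) (j : Finset.Icc 1 k) :
    dil r x j = r ^ (j : ℕ) • x j := rfl

theorem layer_index_pos (j : Finset.Icc 1 k) : (0 : ℝ) < ((j : ℕ) : ℝ) := by
  exact_mod_cast (Finset.mem_Icc.1 j.2).1

theorem two_mul_factorial_pos (k : ℕ) : (0 : ℝ) < 2 * (k ! : ℝ) := by positivity

theorem gauge_exponent_pos (j : Finset.Icc 1 k) : (0 : ℝ) < 2 * (k ! : ℝ) / (j : ℕ) :=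
  div_pos (two_mul_factorial_pos k) (layer_index_pos j)

theorem gauge_nonneg (x : Coord k v) : 0 ≤ gauge x :=
  Finset.sum_nonneg fun j _ => by positivity

theorem gauge_neg (x : Coord k v) : gauge (-x) = gauge x := by
  simp [gauge]

@[fun_prop]
theorem continuous_gauge : Continuous (gauge : Coord k v → ℝ) := by
  refine continuous_finsetSum _ fun j _ => ?_
  exact (continuous_apply j).norm.rpow_const fun _ => Or.inr (gauge_exponent_pos j).le

theorem gauge_dil {r : ℝ} (hr : 0 ≤ r) (x : Coord k v) :
    gauge (dil r x) = r ^ (2 * (k ! : ℝ)) * gauge x := by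
  rw [gauge, gauge, Finset.mul_sum]
  refine Finset.sum_congr rfl fun j _ => ?_
  rw [dil_apply, norm_smul, norm_pow, Real.norm_of_nonneg hr,
    Real.mul_rpow (by positivity) (norm_nonneg _), ← Real.rpow_natCast, ← Real.rpow_mul hr,
    mul_div_cancel₀ _ (layer_index_pos j).ne']

theorem rpow_homDim {r : ℝ} (hr : 0 < r) :
    r ^ homDim k v = ∏ j : Finset.Icc 1 k, (r ^ (j : ℕ)) ^ (v j) := by
  have h1 : homDim k v = ∑ j : Finset.Icc 1 k, (((j : ℕ) * v j : ℕ) : ℝ) := by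
    rw [homDim, Finset.sum_coe_sort (Finset.Icc 1 k) (fun i => ((i * v i : ℕ) : ℝ))]
    refine Finset.sum_congr ?_ fun i _ => by push_cast; rfl
    ext i; simp only [Finset.mem_Ico, Finset.mem_Icc, Nat.lt_add_one_iff]
  rw [h1, Real.rpow_sum_of_pos hr]
  refine Finset.prod_congr rfl fun j _ => ?_
  rw [Real.rpow_natCast, pow_mul]

theorem isDilation_gauge (k : ℕ) (v : ℕ → ℕ) :
    IsDilation (volume : Measure (Coord k v)) (fun r x => dil r x) gauge (2 * (k ! : ℝ))
      (homDim k v) where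
  pos := two_mul_factorial_pos k
  measurable r := (dil r).continuous.measurable
  measurable_gauge := continuous_gauge.measurable
  gauge_nonneg := gauge_nonneg
  gauge_map r hr x := gauge_dil hr.le x
  measure_map r hr := by
    rw [volume_pi]
    refine Measure.pi_eq fun s hs => ?_
    have hpre : (fun x : Coord k v => dil r x) ⁻¹' (Set.univ.pi s) =
        Set.univ.pi fun j : Finset.Icc 1 k => (fun y => r ^ (j : ℕ) • y) ⁻¹' s j := by
      ext x; simp [Set.mem_pi]
    rw [Measure.smul_apply, Measure.map_apply (dil r).continuous.measurable
      (MeasurableSet.univ_pi hs), hpre, Measure.pi_pi, smul_eq_mul]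
    have h1 : ∀ j : Finset.Icc 1 k, volume ((fun y => r ^ (j : ℕ) • y) ⁻¹' s j) =
        ENNReal.ofReal (((r ^ (j : ℕ)) ^ (v j))⁻¹) * volume (s j) := fun j => by
      have hp : 0 < r ^ (j : ℕ) := pow_pos hr _
      rw [Measure.addHaar_preimage_smul _ hp.ne', finrank_euclideanSpace_fin,
        abs_of_pos (by positivity)]
    simp_rw [h1]
    rw [Finset.prod_mul_distrib, ← ENNReal.ofReal_prod_of_nonneg (fun j _ => by positivity),
      ← mul_assoc, ← ENNReal.ofReal_mul (by positivity), rpow_homDim hr, Finset.prod_inv_distrib,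
      mul_inv_cancel₀ (Finset.prod_pos fun j _ => by positivity).ne', ENNReal.ofReal_one, one_mul]

/-- The closed unit ball of the homogeneous pseudonorm. -/
def unitBall (k : ℕ) (v : ℕ → ℕ) : Set (Coord k v) := {x | gauge x ≤ 1}

theorem mem_unitBall {x : Coord k v} : x ∈ unitBall k v ↔ gauge x ≤ 1 := Iff.rfl

theorem norm_le_one_of_mem_unitBall {x : Coord k v} (hx : x ∈ unitBall k v)
    (j : Finset.Icc 1 k) : ‖x j‖ ≤ 1 := by
  have h1 : ‖x j‖ ^ (2 * (k ! : ℝ) / (j : ℕ)) ≤ 1 :=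
    (Finset.single_le_sum (f := fun j : Finset.Icc 1 k => ‖x j‖ ^ (2 * (k ! : ℝ) / (j : ℕ)))
      (fun j _ => by positivity) (Finset.mem_univ j)).trans hx
  rwa [← Real.one_rpow (2 * (k ! : ℝ) / (j : ℕ)),
    Real.rpow_le_rpow_iff (norm_nonneg _) zero_le_one (gauge_exponent_pos j)] at h1

theorem unitBall_subset_closedBall : unitBall k v ⊆ Metric.closedBall 0 1 := fun x hx => by
  rw [mem_closedBall_zero_iff, pi_norm_le_iff_of_nonneg zero_le_one]
  exact norm_le_one_of_mem_unitBall hx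

theorem isCompact_unitBall : IsCompact (unitBall k v) :=
  (isCompact_closedBall (0 : Coord k v) 1).of_isClosed_subset
    (isClosed_le continuous_gauge continuous_const) unitBall_subset_closedBall

theorem measurableSet_unitBall : MeasurableSet (unitBall k v) :=
  isCompact_unitBall.measurableSet

theorem gauge_zero : gauge (0 : Coord k v) = 0 :=
  Finset.sum_eq_zero fun j _ => by
    rw [Pi.zero_apply, norm_zero, Real.zero_rpow (gauge_exponent_pos j).ne']

theorem zero_mem_unitBall : (0 : Coord k v) ∈ unitBall k v := by
  rw [mem_unitBall, gauge_zero]; exact zero_le_one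

theorem neg_mem_unitBall {x : Coord k v} (hx : x ∈ unitBall k v) : -x ∈ unitBall k v := by
  rwa [mem_unitBall, gauge_neg]

instance isFiniteMeasure_unitBall :
    IsFiniteMeasure ((volume : Measure (Coord k v)).restrict (unitBall k v)) :=
  ⟨by rw [Measure.restrict_apply_univ]; exact isCompact_unitBall.measure_lt_top⟩

/-- A point of the unit ball is the limit of its dilates with t < 1, which lie in the open set
{gauge < 1}. This is the support condition under which the L^∞ norm sees every point of the ball. -/
theorem measure_nhds_inter_unitBall_ne_zero {x : Coord k v} (hx : x ∈ unitBall k v)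
    {U : Set (Coord k v)} (hU : U ∈ 𝓝 x) :
    (volume : Measure (Coord k v)).restrict (unitBall k v) U ≠ 0 := by
  have hdil : Tendsto (fun t : ℝ => dil t x) (𝓝[<] 1) (𝓝 x) := by
    have : Continuous fun t : ℝ => dil t x := continuous_pi fun j => by
      simp only [dil_apply]; fun_prop
    have h1 := this.tendsto 1
    have h2 : dil 1 x = x := funext fun j => by simp
    rw [h2] at h1
    exact h1.mono_left nhdsWithin_le_nhds
  obtain ⟨V, hVU, hV, hxV⟩ := mem_nhds_iff.1 hU
  obtain ⟨t, htV, ht⟩ := ((hdil.eventually (hV.mem_nhds hxV)).and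
    (Ioo_mem_nhdsLT (zero_lt_one (α := ℝ)))).exists
  have hg : gauge (dil t x) < 1 := by
    rw [gauge_dil ht.1.le]
    have h1 : t ^ (2 * (k ! : ℝ)) < 1 :=
      Real.rpow_lt_one ht.1.le ht.2 (two_mul_factorial_pos k)
    have h2 : (0 : ℝ) ≤ t ^ (2 * (k ! : ℝ)) := Real.rpow_nonneg ht.1.le _
    have h3 := mem_unitBall.1 hx
    nlinarith [gauge_nonneg x]
  have hopen : IsOpen (V ∩ {y | gauge y < 1}) :=
    hV.inter (isOpen_lt continuous_gauge continuous_const)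
  have hpos := hopen.measure_pos volume ⟨dil t x, htV, hg⟩
  refine (hpos.trans_le ?_).ne'
  rw [Measure.restrict_apply' measurableSet_unitBall]
  refine measure_mono fun y hy => ⟨hVU hy.1, ?_⟩
  have : gauge y < 1 := hy.2
  exact this.le

theorem restrict_unitBall_ne_zero :
    (volume : Measure (Coord k v)).restrict (unitBall k v) ≠ 0 := fun h =>
  measure_nhds_inter_unitBall_ne_zero (zero_mem_unitBall (k := k) (v := v)) univ_mem
    (by rw [h]; rfl)

theorem layer_eq {j : ℕ} (h : j ∈ Finset.Icc 1 k) (x : Coord k v) : layer x j = x ⟨j, h⟩ :=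
  dif_pos h

@[fun_prop]
theorem continuous_layer (j : ℕ) : Continuous fun x : Coord k v => layer x j := by
  by_cases h : j ∈ Finset.Icc 1 k
  · simp only [layer_eq h]; fun_prop
  · simp only [layer, h, dif_neg, not_false_iff]; fun_prop

theorem layer_dil (r : ℝ) (x : Coord k v) (j : ℕ) : layer (dil r x) j = r ^ j • layer x j := by
  by_cases h : j ∈ Finset.Icc 1 k
  · simp only [layer_eq h, dil_apply]
  · simp only [layer, h, dif_neg, not_false_iff, smul_zero]

theorem layer_neg (x : Coord k v) (j : ℕ) : layer (-x) j = -layer x j := by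
  by_cases h : j ∈ Finset.Icc 1 k
  · simp only [layer_eq h, Pi.neg_apply]
  · simp only [layer, h, dif_neg, not_false_iff, neg_zero]

theorem homDim_ge_one (hk : 1 ≤ k) (hv : 0 < v 1) : 1 ≤ homDim k v := by
  have hv' : (1 : ℝ) ≤ v 1 := by exact_mod_cast hv
  have := Finset.single_le_sum (f := fun i : ℕ => (i * v i : ℝ)) (s := Finset.Ico 1 (k + 1))
    (fun i _ => by positivity) (Finset.mem_Ico.2 ⟨le_refl 1, by omega⟩)
  simp only [Nat.cast_one, one_mul] at this
  exact hv'.trans this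

section LayerOne

theorem integrable_exp_neg_norm_rpow (n : ℕ) {M : ℝ} (hM : 0 < M) :
    Integrable (fun y : EuclideanSpace ℝ (Fin n) => Real.exp (-‖y‖ ^ M)) := by
  have hD := isDilation_smul (EuclideanSpace ℝ (Fin n)) volume hM
  have hs : 0 < 0 + (Module.finrank ℝ (EuclideanSpace ℝ (Fin n)) : ℝ) + M := by positivity
  have hi := (hD.integrableOn_iff (s := 0) hs (F := fun _ => 1) measurable_const
    (by simp)).2 (by
      rw [setOf_norm_rpow_le_one hM]
      exact integrableOn_const (isCompact_closedBall _ _).measure_lt_top.ne)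
  simpa only [one_mul] using hi

/-- The factor that the layers other than the first contribute to a Gaussian type integral. -/
def higherLayerMass (k : ℕ) (v : ℕ → ℕ) (i : Finset.Icc 1 k) : ℝ :=
  ∏ j ∈ Finset.univ.erase i,
    ∫ y : EuclideanSpace ℝ (Fin (v j)), Real.exp (-‖y‖ ^ (2 * (k ! : ℝ) / (j : ℕ)))

theorem integral_layer_mul_exp_neg_gauge (i : Finset.Icc 1 k)
    {F : EuclideanSpace ℝ (Fin (v i)) → ℝ}
    (hF : Integrable fun y => F y * Real.exp (-‖y‖ ^ (2 * (k ! : ℝ) / (i : ℕ)))) :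
    Integrable (fun x : Coord k v => F (x i) * Real.exp (-gauge x)) ∧
      ∫ x : Coord k v, F (x i) * Real.exp (-gauge x) =
        (∫ y, F y * Real.exp (-‖y‖ ^ (2 * (k ! : ℝ) / (i : ℕ)))) * higherLayerMass k v i := by
  set f : (j : Finset.Icc 1 k) → EuclideanSpace ℝ (Fin (v j)) → ℝ :=
    Function.update (fun j y => Real.exp (-‖y‖ ^ (2 * (k ! : ℝ) / (j : ℕ)))) i
      (fun y => F y * Real.exp (-‖y‖ ^ (2 * (k ! : ℝ) / (i : ℕ)))) with hf
  have hfi : f i = fun y => F y * Real.exp (-‖y‖ ^ (2 * (k ! : ℝ) / (i : ℕ))) := by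
    rw [hf, Function.update_self]
  have hfj : ∀ j ≠ i, f j = fun y => Real.exp (-‖y‖ ^ (2 * (k ! : ℝ) / (j : ℕ))) := fun j hj => by
    rw [hf, Function.update_of_ne hj]
  have hprod : ∀ x : Coord k v, F (x i) * Real.exp (-gauge x) = ∏ j, f j (x j) := by
    intro x
    rw [← Finset.mul_prod_erase _ _ (Finset.mem_univ i), hfi, gauge, ← Finset.sum_neg_distrib,
      Real.exp_sum, ← Finset.mul_prod_erase _ _ (Finset.mem_univ i), ← mul_assoc]
    congr 1
    exact Finset.prod_congr rfl fun j hj => by rw [hfj j (Finset.mem_erase.1 hj).1]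
  have hfint : ∀ j, Integrable (f j) := fun j => by
    rcases eq_or_ne j i with rfl | hj
    · rw [hfi]; exact hF
    · rw [hfj j hj]; exact integrable_exp_neg_norm_rpow _ (gauge_exponent_pos j)
  simp_rw [hprod]
  refine ⟨Integrable.fintype_prod_dep (𝕜 := ℝ) hfint, ?_⟩
  rw [volume_pi, integral_fintype_prod_eq_prod, ← Finset.mul_prod_erase _ _ (Finset.mem_univ i),
    hfi, higherLayerMass]
  congr 1
  exact Finset.prod_congr rfl fun j hj => by rw [hfj j (Finset.mem_erase.1 hj).1]

/-- The integral over the unit ball of a function of the first layer, homogeneous of degree `s`,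
in terms of a Gaussian integral. -/
theorem integral_unitBall_of_homogeneous (hk : 1 ∈ Finset.Icc 1 k) (hv : 0 < v 1) {s : ℝ}
    (hs : -1 < s) {F : EuclideanSpace ℝ (Fin (v 1)) → ℝ} (hF : Measurable F)
    (hFs : ∀ r > 0, ∀ y, F (r • y) = r ^ s * F y)
    (hi : Integrable fun y => F y * Real.exp (-‖y‖ ^ 2)) :
    IntegrableOn (fun x : Coord k v => F (layer x 1)) (unitBall k v) ∧
    Real.Gamma ((s + homDim k v) / (2 * (k ! : ℝ)) + 1) * Real.Gamma ((s + v 1) / 2 + 1) *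
        ∫ x in unitBall k v, F (layer x 1) =
      higherLayerMass k v ⟨1, hk⟩ * Real.Gamma ((s + v 1) / (2 * (k ! : ℝ)) + 1) *
        ∫ y, F y * Real.exp (-‖y‖ ^ 2) := by
  have hM := two_mul_factorial_pos k
  have hv' : (1 : ℝ) ≤ v 1 := by exact_mod_cast hv
  have hQ := homDim_ge_one (Finset.mem_Icc.1 hk).2 hv
  -- The Gamma identity is used for ‖y‖² and for ‖y‖^{2k!} on the first layer, and for the gauge on
  -- the whole space. The first two have the same unit ball; eliminating the integral over it trades
  -- the exponent 2k! for 2.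
  have hD2 := isDilation_smul (EuclideanSpace ℝ (Fin (v 1))) volume (two_pos (α := ℝ))
  have hDM := isDilation_smul (EuclideanSpace ℝ (Fin (v 1))) volume hM
  rw [finrank_euclideanSpace_fin] at hD2 hDM
  have hDG := isDilation_gauge k v
  have hi2 : Integrable fun y => F y * Real.exp (-‖y‖ ^ (2 : ℝ)) := by simpa using hi
  have hb := (hD2.integrableOn_iff (by linarith) hF hFs).1 hi2
  rw [setOf_norm_rpow_le_one two_pos] at hb
  have e2 := hD2.integral_mul_exp_neg (by linarith) hF hFs
    (by rwa [setOf_norm_rpow_le_one two_pos])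
  rw [setOf_norm_rpow_le_one two_pos] at e2
  have hiM := (hDM.integrableOn_iff (by linarith) hF hFs).2
    (by rwa [setOf_norm_rpow_le_one hM])
  have eM := hDM.integral_mul_exp_neg (by linarith) hF hFs
    (by rwa [setOf_norm_rpow_le_one hM])
  rw [setOf_norm_rpow_le_one hM] at eM
  obtain ⟨hiG, eG⟩ := integral_layer_mul_exp_neg_gauge (v := v) ⟨1, hk⟩ (F := F) (by simpa using hiM)
  have hFm : Measurable fun x : Coord k v => F (x ⟨1, hk⟩) := hF.comp (measurable_pi_apply _)
  have hFd : ∀ r > 0, ∀ x : Coord k v, F (dil r x ⟨1, hk⟩) = r ^ s * F (x ⟨1, hk⟩) :=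
    fun r hr x => by rw [dil_apply, pow_one, hFs r hr]
  have hK := (hDG.integrableOn_iff (by linarith) hFm hFd).1 hiG
  have eK := hDG.integral_mul_exp_neg (by linarith) hFm hFd hK
  simp only [layer_eq hk]
  refine ⟨hK, ?_⟩
  simp only [Nat.cast_one, div_one] at eG
  simp only [Real.rpow_two] at e2
  change ∫ x : Coord k v, F (x ⟨1, hk⟩) * Real.exp (-gauge x) =
    _ * ∫ x in unitBall k v, F (x ⟨1, hk⟩) at eK
  rw [eK, eM] at eG
  rw [e2]
  linear_combination Real.Gamma ((s + v 1) / 2 + 1) * eG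

end LayerOne

end Carnot

/-! ### The weighted mean and the extremal points on the unit ball -/

namespace Carnot

variable {k : ℕ} {v : ℕ → ℕ}

theorem measurePreserving_neg_coord :
    MeasurePreserving (Neg.neg : Coord k v → Coord k v) volume volume := by
  refine ⟨measurable_neg, ?_⟩
  have h := Measure.map_addHaar_smul (volume : Measure (Coord k v)) (r := -1) (by norm_num)
  simpa [abs_inv, abs_pow] using h

theorem setIntegral_unitBall_eq_zero_of_odd {f : Coord k v → ℝ} (hf : ∀ x, f (-x) = -f x) :
    ∫ x in unitBall k v, f x = 0 := by
  have h := (measurePreserving_neg_coord (k := k) (v := v)).setIntegral_preimage_emb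
    (MeasurableEquiv.neg (Coord k v)).measurableEmbedding f (unitBall k v)
  have hpre : Neg.neg ⁻¹' unitBall k v = unitBall k v := by
    ext x; rw [Set.mem_preimage, mem_unitBall, gauge_neg, mem_unitBall]
  rw [hpre] at h
  simp_rw [hf] at h
  rw [integral_neg] at h
  linarith

/-- The first order part `⟨ξ, x^{(1)}⟩` of a function at the identity. -/
def linPart (ξ : EuclideanSpace ℝ (Fin (v 1))) (x : Coord k v) : ℝ := inner ℝ ξ (layer x 1)

/-- The second order part `⟨η, x^{(2)}⟩ + ⟨A x^{(1)}, x^{(1)}⟩ / 2` of a function at the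
identity. -/
def quadPart (η : EuclideanSpace ℝ (Fin (v 2))) (A : Matrix (Fin (v 1)) (Fin (v 1)) ℝ)
    (x : Coord k v) : ℝ :=
  inner ℝ η (layer x 2) + 1 / 2 * quadForm A (layer x 1)

@[fun_prop]
theorem continuous_linPart (ξ : EuclideanSpace ℝ (Fin (v 1))) :
    Continuous (linPart ξ : Coord k v → ℝ) := by
  unfold linPart; fun_prop

@[fun_prop]
theorem continuous_quadPart (η : EuclideanSpace ℝ (Fin (v 2)))
    (A : Matrix (Fin (v 1)) (Fin (v 1)) ℝ) : Continuous (quadPart η A : Coord k v → ℝ) := by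
  unfold quadPart; fun_prop

theorem linPart_neg (ξ : EuclideanSpace ℝ (Fin (v 1))) (x : Coord k v) :
    linPart ξ (-x) = -linPart ξ x := by
  rw [linPart, layer_neg, inner_neg_right, linPart]

theorem ae_linPart_ne_zero (hk : 1 ∈ Finset.Icc 1 k) {ξ : EuclideanSpace ℝ (Fin (v 1))}
    (hξ : ξ ≠ 0) : ∀ᵐ x : Coord k v, linPart ξ x ≠ 0 := by
  set T : Coord k v →ₗ[ℝ] ℝ :=
    (innerSL ℝ ξ : EuclideanSpace ℝ (Fin (v 1)) →ₗ[ℝ] ℝ).comp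
      (LinearMap.proj (⟨1, hk⟩ : Finset.Icc 1 k)) with hT
  have hTx : ∀ x, T x = linPart ξ x := fun x => by
    rw [linPart, layer_eq hk]; rfl
  have hne : LinearMap.ker T ≠ ⊤ := by
    intro h
    have h1 : T (Pi.single (⟨1, hk⟩ : Finset.Icc 1 k) ξ) = 0 := by
      rw [← LinearMap.mem_ker, h]; exact Submodule.mem_top
    rw [hTx, linPart, layer_eq hk, Pi.single_eq_same, inner_self_eq_zero] at h1
    exact hξ h1
  have h0 := Measure.addHaar_submodule (volume : Measure (Coord k v)) _ hne
  rw [ae_iff]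
  convert h0 using 2
  ext x
  simp [hTx]

theorem abs_inner_rpow_eq {n : ℕ} {ξ : EuclideanSpace ℝ (Fin n)} (hξ : ξ ≠ 0) (s : ℝ)
    (y : EuclideanSpace ℝ (Fin n)) :
    |inner ℝ ξ y| ^ s = ‖ξ‖ ^ s * |inner ℝ (‖ξ‖⁻¹ • ξ) y| ^ s := by
  have h : inner ℝ ξ y = ‖ξ‖ * inner ℝ (‖ξ‖⁻¹ • ξ) y := by
    rw [inner_smul_left, RCLike.conj_to_real, mul_inv_cancel_left₀ (norm_ne_zero_iff.2 hξ)]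
  rw [h, abs_mul, abs_norm, Real.mul_rpow (norm_nonneg _) (abs_nonneg _)]

theorem quadForm_normalize {n : ℕ} (A : Matrix (Fin n) (Fin n) ℝ) (ξ : EuclideanSpace ℝ (Fin n)) :
    quadForm A (‖ξ‖⁻¹ • ξ) = quadForm A ξ / ‖ξ‖ ^ 2 := by
  rw [quadForm_smul, inv_pow, inv_mul_eq_div]

theorem medianConst_eq {p : ℝ≥0∞} (hp' : p ≠ ⊤) (hP : 1 < p.toReal) (hk : 1 ≤ k)
    (hv : ∀ j ∈ Finset.Icc 1 k, 0 < v j) :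
    medianConst p k v = 1 / (2 * (p.toReal + v 1)) *
      (Real.Gamma ((p.toReal + v 1) / (2 * (k ! : ℝ)) + 1) /
          Real.Gamma ((p.toReal - 2 + v 1) / (2 * (k ! : ℝ)) + 1) *
        (Real.Gamma ((p.toReal - 2 + homDim k v) / (2 * (k ! : ℝ)) + 1) /
          Real.Gamma ((p.toReal + homDim k v) / (2 * (k ! : ℝ)) + 1))) := by
  rw [medianConst, if_neg hp', prod_betaFn_div_betaFn v hP (two_mul_factorial_pos k) hk hv]
  rfl

/-- The unit ball formula is applied in the degrees P - 2 and P. The quotient of the Gaussian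
integrals is half the normalized trace, and the remaining Gamma factors are those of `medianConst`.
-/
theorem integral_unitBall_quadForm {p : ℝ≥0∞} (hp' : p ≠ ⊤) (hP : 1 < p.toReal) (hk : 1 ≤ k)
    (hv : ∀ j ∈ Finset.Icc 1 k, 0 < v j) {ξ : EuclideanSpace ℝ (Fin (v 1))} (hξ : ξ ≠ 0)
    (A : Matrix (Fin (v 1)) (Fin (v 1)) ℝ) :
    IntegrableOn (fun x : Coord k v => |linPart ξ x| ^ (p.toReal - 2)) (unitBall k v) ∧
    ∫ x in unitBall k v, |linPart ξ x| ^ (p.toReal - 2) * quadForm A (layer x 1) =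
      2 * (medianConst p k v * normTrace p A ξ) *
        ∫ x in unitBall k v, |linPart ξ x| ^ (p.toReal - 2) := by
  rw [medianConst_eq hp' hP hk hv, normTrace, if_neg hp']
  set P := p.toReal
  have hk1 : 1 ∈ Finset.Icc 1 k := Finset.mem_Icc.2 ⟨le_rfl, hk⟩
  have hv1 := hv 1 hk1
  have hv1' : (1 : ℝ) ≤ v 1 := by exact_mod_cast hv1
  have hM := two_mul_factorial_pos k
  have hQ := homDim_ge_one hk hv1
  have hξn : 0 < ‖ξ‖ := norm_pos_iff.2 hξ
  set e := ‖ξ‖⁻¹ • ξ with he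
  have hen : ‖e‖ = 1 := by
    rw [he, norm_smul, norm_inv, norm_norm, inv_mul_cancel₀ hξn.ne']
  have hs : -1 < P - 2 := by linarith
  obtain ⟨g1, g2, g3⟩ := gaussian_integral_quadForm A hen hs
  have hscale : ∀ r > 0, ∀ y : EuclideanSpace ℝ (Fin (v 1)),
      |inner ℝ ξ (r • y)| ^ (P - 2) = r ^ (P - 2) * |inner ℝ ξ y| ^ (P - 2) := fun r hr y => by
    rw [inner_smul_right, abs_mul, abs_of_pos hr, Real.mul_rpow hr.le (abs_nonneg _)]
  have i1 : Integrable fun y : EuclideanSpace ℝ (Fin (v 1)) =>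
      |inner ℝ ξ y| ^ (P - 2) * Real.exp (-‖y‖ ^ 2) := by
    simp_rw [abs_inner_rpow_eq hξ, mul_assoc]
    exact g1.const_mul _
  have i2 : Integrable fun y : EuclideanSpace ℝ (Fin (v 1)) =>
      |inner ℝ ξ y| ^ (P - 2) * quadForm A y * Real.exp (-‖y‖ ^ 2) := by
    simp_rw [abs_inner_rpow_eq hξ, mul_assoc]
    simp_rw [mul_assoc] at g2
    exact g2.const_mul _
  have i3 : ∫ y : EuclideanSpace ℝ (Fin (v 1)),
      |inner ℝ ξ y| ^ (P - 2) * quadForm A y * Real.exp (-‖y‖ ^ 2) =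
      (A.trace + (P - 2) * (quadForm A ξ / ‖ξ‖ ^ 2)) / 2 *
        ∫ y : EuclideanSpace ℝ (Fin (v 1)), |inner ℝ ξ y| ^ (P - 2) * Real.exp (-‖y‖ ^ 2) := by
    simp_rw [abs_inner_rpow_eq hξ, mul_assoc]
    simp_rw [mul_assoc] at g3
    rw [integral_const_mul, integral_const_mul, g3, quadForm_normalize]
    ring
  obtain ⟨k1, k2⟩ := integral_unitBall_of_homogeneous (k := k) hk1 hv1 hs
    (F := fun y => |inner ℝ ξ y| ^ (P - 2))
    ((by fun_prop : Measurable fun y : EuclideanSpace ℝ (Fin (v 1)) =>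
      |inner ℝ ξ y| ^ (P - 2))) hscale i1
  obtain ⟨-, k4⟩ := integral_unitBall_of_homogeneous (k := k) hk1 hv1 (s := P) (by linarith)
    (F := fun y => |inner ℝ ξ y| ^ (P - 2) * quadForm A y)
    ((by fun_prop : Measurable fun y : EuclideanSpace ℝ (Fin (v 1)) =>
      |inner ℝ ξ y| ^ (P - 2)).mul (continuous_quadForm A).measurable)
    (fun r hr y => by
      rw [hscale r hr, quadForm_smul]
      have : r ^ P = r ^ (P - 2) * r ^ 2 := by
        rw [← Real.rpow_two, ← Real.rpow_add hr]; ring_nf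
      rw [this]; ring) i2
  refine ⟨k1, ?_⟩
  rw [i3] at k4
  change Real.Gamma ((P - 2 + homDim k v) / (2 * (k ! : ℝ)) + 1) *
    Real.Gamma ((P - 2 + v 1) / 2 + 1) *
    ∫ x in unitBall k v, |linPart ξ x| ^ (P - 2) = _ at k2
  change Real.Gamma ((P + homDim k v) / (2 * (k ! : ℝ)) + 1) * Real.Gamma ((P + v 1) / 2 + 1) *
    ∫ x in unitBall k v, |linPart ξ x| ^ (P - 2) * quadForm A (layer x 1) = _ at k4
  have hGpos : ∀ a : ℝ, 0 < P - 2 + a → ∀ c > 0, 0 < Real.Gamma ((P - 2 + a) / c + 1) :=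
    fun a ha c hc => Real.Gamma_pos_of_pos (by
      have : 0 < (P - 2 + a) / c := div_pos ha hc
      linarith)
  have hGpos' : ∀ a : ℝ, 0 < P + a → ∀ c > 0, 0 < Real.Gamma ((P + a) / c + 1) :=
    fun a ha c hc => Real.Gamma_pos_of_pos (by
      have : 0 < (P + a) / c := div_pos ha hc
      linarith)
  -- Source of the factor 1/(P + v₁) in the constant.
  have hGrec : Real.Gamma ((P + v 1) / 2 + 1) =
      (P + v 1) / 2 * Real.Gamma ((P - 2 + v 1) / 2 + 1) := by
    rw [Real.Gamma_add_one (by linarith : (P + v 1) / 2 ≠ 0)]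
    congr 2; ring
  rw [hGrec] at k4
  have n1 := (hGpos (homDim k v) (by linarith) _ hM).ne'
  have n2 := (hGpos (v 1) (by linarith) 2 two_pos).ne'
  have n3 := (hGpos (v 1) (by linarith) _ hM).ne'
  have n4 := (hGpos' (homDim k v) (by linarith) _ hM).ne'
  have n5 : P + (v 1 : ℝ) ≠ 0 := by linarith
  generalize Real.Gamma ((P - 2 + homDim k v) / (2 * (k ! : ℝ)) + 1) = a1 at *
  generalize Real.Gamma ((P - 2 + v 1) / 2 + 1) = a2 at *
  generalize Real.Gamma ((P - 2 + v 1) / (2 * (k ! : ℝ)) + 1) = a3 at *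
  generalize Real.Gamma ((P + homDim k v) / (2 * (k ! : ℝ)) + 1) = a4 at *
  generalize Real.Gamma ((P + v 1) / (2 * (k ! : ℝ)) + 1) = a5 at *
  generalize (∫ x in unitBall k v, |linPart ξ x| ^ (P - 2) * quadForm A (layer x 1)) = I2 at *
  generalize (∫ x in unitBall k v, |linPart ξ x| ^ (P - 2)) = I1 at *
  generalize (∫ y : EuclideanSpace ℝ (Fin (v 1)),
    |inner ℝ ξ y| ^ (P - 2) * Real.exp (-‖y‖ ^ 2)) = g at *
  generalize quadForm A ξ / ‖ξ‖ ^ 2 = q at *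
  -- Both integrals contain the same Gaussian integral and higher layer mass in their numerators, so
  -- neither quantity has to be shown nonzero.
  have hI1 : I1 = higherLayerMass k v ⟨1, hk1⟩ * a3 * g / (a1 * a2) := by
    rw [eq_div_iff (mul_ne_zero n1 n2)]; linear_combination k2
  have hI2 : I2 = higherLayerMass k v ⟨1, hk1⟩ * a5 * ((A.trace + (P - 2) * q) / 2 * g) /
      (a4 * ((P + v 1) / 2 * a2)) := by
    rw [eq_div_iff (mul_ne_zero n4 (mul_ne_zero (div_ne_zero n5 two_ne_zero) n2))]
    linear_combination k4
  rw [hI1, hI2]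
  field_simp

/-- The point of the unit ball at which `⟨ξ, x^{(1)}⟩` is maximal. -/
def maxPoint (hk : 1 ∈ Finset.Icc 1 k) (ξ : EuclideanSpace ℝ (Fin (v 1))) : Coord k v :=
  Pi.single (⟨1, hk⟩ : Finset.Icc 1 k) (‖ξ‖⁻¹ • ξ)

theorem layer_one_maxPoint (hk : 1 ∈ Finset.Icc 1 k) (ξ : EuclideanSpace ℝ (Fin (v 1))) :
    layer (maxPoint hk ξ : Coord k v) 1 = ‖ξ‖⁻¹ • ξ := by
  rw [layer_eq hk, maxPoint, Pi.single_eq_same]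

theorem layer_two_maxPoint (hk : 1 ∈ Finset.Icc 1 k) (ξ : EuclideanSpace ℝ (Fin (v 1))) :
    layer (maxPoint hk ξ : Coord k v) 2 = 0 := by
  by_cases h : 2 ∈ Finset.Icc 1 k
  · rw [layer_eq h, maxPoint]
    exact Pi.single_eq_of_ne (M := fun i : Finset.Icc 1 k => EuclideanSpace ℝ (Fin (v i)))
      (fun h => by simp at h) _
  · simp only [layer, h, dif_neg, not_false_iff]

theorem linPart_maxPoint (hk : 1 ∈ Finset.Icc 1 k) {ξ : EuclideanSpace ℝ (Fin (v 1))}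
    (hξ : ξ ≠ 0) : linPart ξ (maxPoint hk ξ : Coord k v) = ‖ξ‖ := by
  rw [linPart, layer_one_maxPoint, inner_smul_right, real_inner_self_eq_norm_sq, pow_two,
    inv_mul_cancel_left₀ (norm_ne_zero_iff.2 hξ)]

theorem gauge_eq_add (hk : 1 ∈ Finset.Icc 1 k) (x : Coord k v) :
    gauge x = ‖layer x 1‖ ^ (2 * (k ! : ℝ)) +
      ∑ j ∈ Finset.univ.erase (⟨1, hk⟩ : Finset.Icc 1 k), ‖x j‖ ^ (2 * (k ! : ℝ) / (j : ℕ)) := by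
  rw [gauge, ← Finset.add_sum_erase _ _ (Finset.mem_univ (⟨1, hk⟩ : Finset.Icc 1 k)), layer_eq hk]
  simp

theorem maxPoint_mem (hk : 1 ∈ Finset.Icc 1 k) {ξ : EuclideanSpace ℝ (Fin (v 1))}
    (hξ : ξ ≠ 0) : (maxPoint hk ξ : Coord k v) ∈ unitBall k v := by
  rw [mem_unitBall, gauge_eq_add hk, layer_one_maxPoint, norm_smul, norm_inv, norm_norm,
    inv_mul_cancel₀ (norm_ne_zero_iff.2 hξ), Real.one_rpow]
  rw [Finset.sum_eq_zero, add_zero]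
  intro j hj
  have : (maxPoint hk ξ : Coord k v) j = 0 :=
    Pi.single_eq_of_ne (M := fun i : Finset.Icc 1 k => EuclideanSpace ℝ (Fin (v i)))
      (Finset.mem_erase.1 hj).1 _
  rw [this, norm_zero, Real.zero_rpow (gauge_exponent_pos j).ne']

/-- Equality in the Cauchy-Schwarz inequality forces the first layer to be ξ/|ξ|. This already uses
up the whole gauge, so all other layers vanish. -/
theorem linPart_lt_of_ne_maxPoint (hk : 1 ∈ Finset.Icc 1 k) {ξ : EuclideanSpace ℝ (Fin (v 1))}
    (hξ : ξ ≠ 0) {x : Coord k v} (hx : x ∈ unitBall k v) (hne : x ≠ maxPoint hk ξ) :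
    linPart ξ x < linPart ξ (maxPoint hk ξ : Coord k v) := by
  have hξn : 0 < ‖ξ‖ := norm_pos_iff.2 hξ
  by_contra hcon
  rw [linPart_maxPoint hk hξ, not_lt] at hcon
  apply hne
  have h1 : ‖layer x 1‖ ≤ 1 := by
    rw [layer_eq hk]; exact norm_le_one_of_mem_unitBall hx _
  set e := ‖ξ‖⁻¹ • ξ with he
  have hen : ‖e‖ = 1 := by
    rw [he, norm_smul, norm_inv, norm_norm, inv_mul_cancel₀ hξn.ne']
  have h2 : 1 ≤ inner ℝ e (layer x 1) := by
    rw [he, inner_smul_left, RCLike.conj_to_real, inv_mul_eq_div, le_div_iff₀ hξn, one_mul]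
    exact hcon
  have h3 : layer x 1 = e := by
    have h4 := norm_sub_sq_real e (layer x 1)
    have h5 : ‖e - layer x 1‖ ^ 2 ≤ 0 := by
      rw [h4, hen]
      nlinarith [norm_nonneg (layer x 1)]
    have h6 : ‖e - layer x 1‖ = 0 := by nlinarith [norm_nonneg (e - layer x 1)]
    exact (sub_eq_zero.1 (norm_eq_zero.1 h6)).symm
  have h7 := mem_unitBall.1 hx
  rw [gauge_eq_add hk, h3, hen, Real.one_rpow] at h7
  have h8 : ∑ j ∈ Finset.univ.erase (⟨1, hk⟩ : Finset.Icc 1 k),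
      ‖x j‖ ^ (2 * (k ! : ℝ) / (j : ℕ)) = 0 :=
    le_antisymm (by linarith) (Finset.sum_nonneg fun j _ => by positivity)
  rw [Finset.sum_eq_zero_iff_of_nonneg fun j _ => by positivity] at h8
  funext j
  rcases eq_or_ne j ⟨1, hk⟩ with rfl | hj
  · rw [← layer_eq hk x, ← layer_eq hk (maxPoint hk ξ), layer_one_maxPoint, h3]
  · have h9 := h8 j (Finset.mem_erase.2 ⟨hj, Finset.mem_univ j⟩)
    rw [Real.rpow_eq_zero (norm_nonneg _) (gauge_exponent_pos j).ne', norm_eq_zero] at h9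
    rw [h9]
    exact (Pi.single_eq_of_ne (M := fun i : Finset.Icc 1 k => EuclideanSpace ℝ (Fin (v i)))
      hj _).symm

theorem quadPart_maxPoint (hk : 1 ∈ Finset.Icc 1 k) (ξ : EuclideanSpace ℝ (Fin (v 1)))
    (η : EuclideanSpace ℝ (Fin (v 2))) (A : Matrix (Fin (v 1)) (Fin (v 1)) ℝ) :
    quadPart η A (maxPoint hk ξ : Coord k v) = 1 / 2 * (quadForm A ξ / ‖ξ‖ ^ 2) := by
  rw [quadPart, layer_two_maxPoint, layer_one_maxPoint, inner_zero_right, zero_add,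
    quadForm_normalize]

theorem quadPart_neg_maxPoint (hk : 1 ∈ Finset.Icc 1 k) (ξ : EuclideanSpace ℝ (Fin (v 1)))
    (η : EuclideanSpace ℝ (Fin (v 2))) (A : Matrix (Fin (v 1)) (Fin (v 1)) ℝ) :
    quadPart η A (-(maxPoint hk ξ : Coord k v)) = 1 / 2 * (quadForm A ξ / ‖ξ‖ ^ 2) := by
  rw [quadPart, layer_neg, layer_neg, layer_two_maxPoint, layer_one_maxPoint, neg_zero,
    inner_zero_right, zero_add, ← neg_one_smul ℝ (‖ξ‖⁻¹ • ξ), quadForm_smul, quadForm_normalize]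
  ring

theorem existsUnique_isLpMin_unitBall {p : ℝ≥0∞} (hp : 1 < p) {f : Coord k v → ℝ}
    (hf : ContinuousOn f (unitBall k v)) :
    ∃! m, IsLpMin p ((volume : Measure (Coord k v)).restrict (unitBall k v)) f m := by
  by_cases hp' : p = ⊤
  · subst hp'
    exact existsUnique_isLpMin_top isCompact_unitBall ⟨0, zero_mem_unitBall⟩
      (ae_restrict_mem measurableSet_unitBall)
      (fun x hx U hU => measure_nhds_inter_unitBall_ne_zero hx hU) hf
  · obtain ⟨C, hC⟩ := isCompact_unitBall.exists_bound_of_continuousOn hf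
    refine existsUnique_isLpMin (C := C) hp hp' restrict_unitBall_ne_zero
      (hf.aestronglyMeasurable measurableSet_unitBall) ?_
    filter_upwards [ae_restrict_mem measurableSet_unitBall] with x hx using hC x hx

/-- Second order asymptotics of the `L^p` minimizers over the unit ball. -/
theorem isLpMin_unitBall_isLittleO {p : ℝ≥0∞} (hp : 1 < p) (hk : 1 ≤ k)
    (hv : ∀ j ∈ Finset.Icc 1 k, 0 < v j) {ξ : EuclideanSpace ℝ (Fin (v 1))} (hξ : ξ ≠ 0)
    (η : EuclideanSpace ℝ (Fin (v 2))) (A : Matrix (Fin (v 1)) (Fin (v 1)) ℝ)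
    {a : ℝ} {F : ℝ → Coord k v → ℝ}
    (hF : ∀ᶠ ε in 𝓝[>] (0 : ℝ), ContinuousOn (F ε) (unitBall k v))
    (happ : ∀ δ > 0, ∀ᶠ ε in 𝓝[>] (0 : ℝ), ∀ x ∈ unitBall k v,
      |F ε x - (a + ε * linPart ξ x + ε ^ 2 * quadPart η A x)| ≤ δ * ε ^ 2)
    {m : ℝ → ℝ} (hm : ∀ᶠ ε in 𝓝[>] (0 : ℝ),
      IsLpMin p ((volume : Measure (Coord k v)).restrict (unitBall k v)) (F ε) (m ε)) :
    (fun ε : ℝ => m ε - (a + ε ^ 2 * (medianConst p k v * normTrace p A ξ)))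
      =o[𝓝[>] 0] (fun ε : ℝ => ε ^ 2) := by
  have hk1 : 1 ∈ Finset.Icc 1 k := Finset.mem_Icc.2 ⟨le_rfl, hk⟩
  by_cases hp' : p = ⊤
  · subst hp'
    refine IsLpMin.isLittleO_top isCompact_unitBall (ae_restrict_mem measurableSet_unitBall)
      (fun x hx U hU => measure_nhds_inter_unitBall_ne_zero hx hU)
      (l := linPart ξ) (g := quadPart η A) (continuous_linPart ξ).continuousOn
      (continuous_quadPart η A).continuousOn (z₁ := maxPoint hk1 ξ) (z₂ := -maxPoint hk1 ξ)
      (maxPoint_mem hk1 hξ) (neg_mem_unitBall (maxPoint_mem hk1 hξ))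
      (fun x hx hne => linPart_lt_of_ne_maxPoint hk1 hξ hx hne)
      (fun x hx hne => ?_) ?_ ?_ hF happ hm
    · have := linPart_lt_of_ne_maxPoint hk1 hξ (neg_mem_unitBall hx)
        (fun h => hne (by rw [← h, neg_neg]))
      rw [linPart_neg] at this ⊢
      linarith
    · rw [linPart_neg]; ring
    · rw [quadPart_maxPoint, quadPart_neg_maxPoint, medianConst, if_pos rfl, normTrace, if_pos rfl]
      ring
  · have hP : 1 < p.toReal := by
      rw [← ENNReal.toReal_one]
      exact (ENNReal.toReal_lt_toReal ENNReal.one_ne_top hp').2 hp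
    obtain ⟨hi, hq⟩ := integral_unitBall_quadForm hp' hP hk hv hξ A
    obtain ⟨Cl, hCl⟩ := isCompact_unitBall.exists_bound_of_continuousOn
      (continuous_linPart (k := k) ξ).continuousOn
    obtain ⟨Cg, hCg⟩ := isCompact_unitBall.exists_bound_of_continuousOn
      (continuous_quadPart (k := k) η A).continuousOn
    have hae := ae_restrict_mem (μ := (volume : Measure (Coord k v))) measurableSet_unitBall
    have hbdd : ∀ f : Coord k v → ℝ, Continuous f →
        IntegrableOn (fun x => |linPart ξ x| ^ (p.toReal - 2) * f x) (unitBall k v) := by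
      intro f hf
      obtain ⟨C, hC⟩ := isCompact_unitBall.exists_bound_of_continuousOn hf.continuousOn
      exact hi.mul_bdd hf.aestronglyMeasurable (hae.mono hC)
    refine IsLpMin.isLittleO hp hp' restrict_unitBall_ne_zero (l := linPart ξ)
      (g := quadPart η A) (continuous_linPart ξ).aestronglyMeasurable
      (continuous_quadPart η A).aestronglyMeasurable (hae.mono hCl) (hae.mono hCg)
      (ae_restrict_of_ae (ae_linPart_ne_zero hk1 hξ)) hi
      (setIntegral_unitBall_eq_zero_of_odd fun x => by rw [linPart_neg, signedPow_neg])
      ?_ (hF.mono fun ε h => h.aestronglyMeasurable measurableSet_unitBall)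
      (fun δ hδ => (happ δ hδ).mono fun ε h => hae.mono h) hm
    -- The η term is odd under x ↦ -x and integrates to zero; the quadratic term has been computed
    -- in `hq`.
    have hsplit : ∀ x : Coord k v, |linPart ξ x| ^ (p.toReal - 2) * quadPart η A x =
        |linPart ξ x| ^ (p.toReal - 2) * inner ℝ η (layer x 2) +
          1 / 2 * (|linPart ξ x| ^ (p.toReal - 2) * quadForm A (layer x 1)) := fun x => by
      rw [quadPart]; ring
    simp_rw [hsplit]
    rw [integral_add (hbdd _ (by fun_prop)) ((hbdd _ (by fun_prop)).const_mul _),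
      integral_const_mul, hq, setIntegral_unitBall_eq_zero_of_odd fun x => by
        rw [linPart_neg, abs_neg, layer_neg, inner_neg_right, mul_neg]]
    ring

end Carnot

/-! ### Transfer from pseudoballs to the unit ball -/

namespace Carnot

variable {k : ℕ} {v : ℕ → ℕ}

theorem dil_dil_inv {r : ℝ} (hr : r ≠ 0) (x : Coord k v) : dil r (dil r⁻¹ x) = x := by
  funext j
  rw [dil_apply, dil_apply, smul_smul, ← mul_pow, mul_inv_cancel₀ hr, one_pow, one_smul]

theorem dil_injective {r : ℝ} (hr : r ≠ 0) :
    Function.Injective (dil r : Coord k v → Coord k v) := fun x y h => by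
  have := congrArg (dil r⁻¹) h
  rwa [← inv_inv r, inv_inv r⁻¹, dil_dil_inv (inv_ne_zero hr), dil_dil_inv (inv_ne_zero hr)]
    at this

theorem norm_dil_le {r : ℝ} (hr : 0 ≤ r) (hr1 : r ≤ 1) {x : Coord k v} (hx : x ∈ unitBall k v) :
    ‖dil r x‖ ≤ r := by
  rw [pi_norm_le_iff_of_nonneg hr]
  intro j
  rw [dil_apply, norm_smul, norm_pow, Real.norm_of_nonneg hr]
  calc r ^ (j : ℕ) * ‖x j‖ ≤ r ^ (1 : ℕ) * 1 :=
        mul_le_mul (pow_le_pow_of_le_one hr hr1 (Finset.mem_Icc.1 j.2).1)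
          (norm_le_one_of_mem_unitBall hx j) (norm_nonneg _) (by positivity)
    _ = r := by ring

namespace CarnotGroup

theorem gnorm_eq (x : Coord k v) : gnorm x = gauge x ^ (1 / (2 * (k ! : ℝ))) := rfl

theorem gnorm_rpow (x : Coord k v) : gnorm x ^ (2 * (k ! : ℝ)) = gauge x := by
  rw [gnorm_eq, ← Real.rpow_mul (gauge_nonneg x),
    one_div_mul_cancel (two_mul_factorial_pos k).ne', Real.rpow_one]

theorem gnorm_nonneg (x : Coord k v) : 0 ≤ gnorm x :=
  Real.rpow_nonneg (gauge_nonneg x) _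

theorem gnorm_le_iff {x : Coord k v} {r : ℝ} (hr : 0 ≤ r) :
    gnorm x ≤ r ↔ gauge x ≤ r ^ (2 * (k ! : ℝ)) := by
  rw [← gnorm_rpow, Real.rpow_le_rpow_iff (gnorm_nonneg x) hr (two_mul_factorial_pos k)]

variable (G : CarnotGroup k v)

theorem gdist_eq (x y : Coord k v) : G.gdist x y = gnorm (G.mul (-x) y) := by
  rw [gdist, gnorm_eq, gnorm_eq, ← gauge_neg, neg_mul_rev, neg_neg]

/-- The parametrization `z ↦ x · δ_ε z` of the pseudoball of radius `ε` about `x` by the unit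
ball. -/
def param (x : Coord k v) (ε : ℝ) (z : Coord k v) : Coord k v := G.mul x (dil ε z)

theorem gdist_param (x z : Coord k v) (ε : ℝ) : G.gdist x (G.param x ε z) = gnorm (dil ε z) := by
  rw [gdist_eq, param, neg_mul_cancel]

theorem param_preimage_closedBall (x : Coord k v) {ε : ℝ} (hε : 0 < ε) :
    G.param x ε ⁻¹' G.closedBall x ε = unitBall k v := by
  ext z
  change G.gdist x (G.param x ε z) ≤ ε ↔ _
  rw [gdist_param, gnorm_le_iff hε.le, gauge_dil hε.le, mem_unitBall]
  exact mul_le_iff_le_one_right (Real.rpow_pos_of_pos hε _)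

theorem param_surjective (x : Coord k v) {ε : ℝ} (hε : 0 < ε) :
    Function.Surjective (G.param x ε) := fun y =>
  ⟨dil ε⁻¹ (G.mul (-x) y), by rw [param, dil_dil_inv hε.ne', mul_neg_cancel]⟩

theorem continuous_param (x : Coord k v) (ε : ℝ) : Continuous (G.param x ε) :=
  (G.contDiff_mul_left x).continuous.comp (dil ε).continuous

theorem measurableEmbedding_param (x : Coord k v) {ε : ℝ} (hε : 0 < ε) :
    MeasurableEmbedding (G.param x ε) :=
  (G.continuous_param x ε).measurableEmbedding
    ((G.leftHomeo x).injective.comp (dil_injective hε.ne'))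

theorem restrict_closedBall_eq (x : Coord k v) {ε : ℝ} (hε : 0 < ε) :
    (volume : Measure (Coord k v)).restrict (G.closedBall x ε) =
      ENNReal.ofReal (ε ^ homDim k v) •
        (volume.restrict (unitBall k v)).map (G.param x ε) := by
  have h1 : (volume : Measure (Coord k v)) =
      ENNReal.ofReal (ε ^ homDim k v) • volume.map (G.param x ε) := by
    have h2 := congrArg (Measure.map (G.mul x)) ((isDilation_gauge k v).measure_map ε hε)
    rw [(G.measurePreserving_mul_left x).map_eq, Measure.map_smul,
      Measure.map_map (G.measurePreserving_mul_left x).measurable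
        (dil ε).continuous.measurable] at h2
    exact h2
  conv_lhs => rw [h1]
  rw [Measure.restrict_smul, (G.measurableEmbedding_param x hε).restrict_map,
    G.param_preimage_closedBall x hε]

/-- The restricted measure is a constant times the image of Lebesgue measure on the unit ball. The
constant multiplies all the L^p norms alike, with exponent 0 for p = ∞, and does not affect
minimizers. -/
theorem isLpMinimizer_closedBall_iff (x : Coord k v) {ε : ℝ} (hε : 0 < ε) (p : ℝ≥0∞)
    (u : Coord k v → ℝ) (m : ℝ) :
    IsLpMinimizer p (G.closedBall x ε) u m ↔
      IsLpMin p ((volume : Measure (Coord k v)).restrict (unitBall k v))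
        (fun z => u (G.param x ε z)) m := by
  have hc : ENNReal.ofReal (ε ^ homDim k v) ≠ 0 := by
    rw [Ne, ENNReal.ofReal_eq_zero, not_le]; exact Real.rpow_pos_of_pos hε _
  have key : ∀ t : ℝ, eLpNorm (fun y => u y - t) p (volume.restrict (G.closedBall x ε)) =
      ENNReal.ofReal (ε ^ homDim k v) ^ (1 / p).toReal *
        eLpNorm (fun z => u (G.param x ε z) - t) p (volume.restrict (unitBall k v)) := fun t => by
    rw [G.restrict_closedBall_eq x hε, eLpNorm_smul_measure_of_ne_zero hc,
      (G.measurableEmbedding_param x hε).eLpNorm_map_measure, smul_eq_mul]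
    rfl
  refine forall_congr' fun t => ?_
  rw [key, key]
  refine ENNReal.mul_le_mul_iff_right ?_ ?_
  · rw [Ne, ENNReal.rpow_eq_zero_iff]
    simp [hc]
  · exact ENNReal.rpow_ne_top_of_nonneg ENNReal.toReal_nonneg ENNReal.ofReal_ne_top

theorem existsUnique_isLpMinimizer {p : ℝ≥0∞} (hp : 1 < p) (x : Coord k v) {ε : ℝ} (hε : 0 < ε)
    {u : Coord k v → ℝ} (hu : ContinuousOn (fun z => u (G.param x ε z)) (unitBall k v)) :
    ∃! m, IsLpMinimizer p (G.closedBall x ε) u m := by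
  simp_rw [G.isLpMinimizer_closedBall_iff x hε]
  exact existsUnique_isLpMin_unitBall hp hu

theorem isLpMin_median {p : ℝ≥0∞} (hp : 1 < p) (x : Coord k v) {ε : ℝ} (hε : 0 < ε)
    {u : Coord k v → ℝ} (hu : ContinuousOn (fun z => u (G.param x ε z)) (unitBall k v)) :
    IsLpMin p ((volume : Measure (Coord k v)).restrict (unitBall k v))
      (fun z => u (G.param x ε z)) (G.median p ε u x) := by
  rw [← G.isLpMinimizer_closedBall_iff x hε]
  exact Classical.epsilon_spec (G.existsUnique_isLpMinimizer hp x hε hu).exists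

theorem param_mem_closedBall {x z : Coord k v} {ε : ℝ} (hε : 0 < ε) (hz : z ∈ unitBall k v) :
    G.param x ε z ∈ G.closedBall x ε := by
  rwa [← Set.mem_preimage, G.param_preimage_closedBall x hε]

/-- The median of a function with a second order expansion along the pseudoballs about `x`. -/
theorem median_isLittleO {p : ℝ≥0∞} (hp : 1 < p) (x : Coord k v) {ξ : EuclideanSpace ℝ (Fin (v 1))}
    (hξ : ξ ≠ 0) (η : EuclideanSpace ℝ (Fin (v 2))) (A : Matrix (Fin (v 1)) (Fin (v 1)) ℝ)
    {u : Coord k v → ℝ} {a : ℝ}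
    (hu : ∀ᶠ ε in 𝓝[>] (0 : ℝ), ContinuousOn (fun z => u (G.param x ε z)) (unitBall k v))
    (happ : ∀ δ > 0, ∀ᶠ ε in 𝓝[>] (0 : ℝ), ∀ z ∈ unitBall k v,
      |u (G.param x ε z) - (a + ε * linPart ξ z + ε ^ 2 * quadPart η A z)| ≤ δ * ε ^ 2) :
    (fun ε : ℝ => G.median p ε u x - (a + ε ^ 2 * (medianConst p k v * normTrace p A ξ)))
      =o[𝓝[>] 0] (fun ε : ℝ => ε ^ 2) := by
  refine isLpMin_unitBall_isLittleO hp G.one_le_step G.dim_pos hξ η A hu happ ?_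
  filter_upwards [hu, self_mem_nhdsWithin] with ε hε hε0
  exact G.isLpMin_median hp x hε0 hε

theorem quadratic_param {x : Coord k v} {ξ : EuclideanSpace ℝ (Fin (v 1))}
    {η : EuclideanSpace ℝ (Fin (v 2))} {A : Matrix (Fin (v 1)) (Fin (v 1)) ℝ}
    {q : Coord k v → ℝ} {ε₀ : ℝ}
    (hq : ∀ y ∈ G.ball x ε₀, q y = q x + inner ℝ ξ (layer (G.mul (-x) y) 1)
      + inner ℝ η (layer (G.mul (-x) y) 2) + 1 / 2 * quadForm A (layer (G.mul (-x) y) 1))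
    {ε : ℝ} (hε : ε ∈ Set.Ioo 0 ε₀) {z : Coord k v} (hz : z ∈ unitBall k v) :
    q (G.param x ε z) = q x + ε * linPart ξ z + ε ^ 2 * quadPart η A z := by
  have hmem : G.param x ε z ∈ G.ball x ε₀ :=
    lt_of_le_of_lt (G.param_mem_closedBall hε.1 hz) hε.2
  rw [hq _ hmem, param, neg_mul_cancel, layer_dil, layer_dil, quadForm_smul, inner_smul_right,
    inner_smul_right, linPart, quadPart]
  ring

end CarnotGroup

end Carnot

/-! ### Second order Taylor expansion along dilations -/

theorem ContDiffAt.taylor_two_isLittleO {E : Type*} [NormedAddCommGroup E] [NormedSpace ℝ E]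
    {w : E → ℝ} (hw : ContDiffAt ℝ 2 w 0) :
    (fun z => w z - (w 0 + fderiv ℝ w 0 z + 1 / 2 * fderiv ℝ (fderiv ℝ w) 0 z z))
      =o[𝓝 0] fun z => ‖z‖ ^ 2 := by
  have hD : HasFDerivAt (fderiv ℝ w) (fderiv ℝ (fderiv ℝ w) 0) 0 :=
    ((hw.fderiv_right (m := 1) (by norm_num)).differentiableAt (by simp)).hasFDerivAt
  have hsymm : IsSymmSndFDerivAt ℝ w 0 := hw.isSymmSndFDerivAt (by simp)
  set T := fderiv ℝ (fderiv ℝ w) 0 with hT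
  set R : E → ℝ := fun z => w z - (w 0 + fderiv ℝ w 0 z + 1 / 2 * T z z) with hR
  have hdiff : ∀ᶠ z in 𝓝 (0 : E), DifferentiableAt ℝ w z := by
    filter_upwards [hw.eventually (by simp)] with z hz using hz.differentiableAt (by simp)
  have hRd : ∀ᶠ z in 𝓝 (0 : E), HasFDerivAt R (fderiv ℝ w z - fderiv ℝ w 0 - T z) z := by
    filter_upwards [hdiff] with z hz
    have h1 : HasFDerivAt (fun z => T z z) (T.flip z + T z) z := by
      have h := T.hasFDerivAt.clm_apply (hasFDerivAt_id (𝕜 := ℝ) z)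
      refine h.congr_fderiv ?_
      ext y
      simp [add_comm]
    have h2 : HasFDerivAt R (fderiv ℝ w z - (fderiv ℝ w 0 + (1 / 2 : ℝ) • (T.flip z + T z))) z :=
      hz.hasFDerivAt.sub (((fderiv ℝ w 0).hasFDerivAt.const_add (w 0)).add (h1.const_mul (1 / 2)))
    refine h2.congr_fderiv ?_
    ext y
    have : T y z = T z y := hsymm y z
    simp [this]
    ring
  refine isLittleO_iff.2 fun c hc => ?_
  have ho := (hasFDerivAt_iff_isLittleO_nhds_zero.1 hD).def hc
  simp only [zero_add] at ho
  obtain ⟨r, hr, hball⟩ := Metric.eventually_nhds_iff_ball.1 (hRd.and ho)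
  filter_upwards [Metric.ball_mem_nhds (0 : E) hr] with z hz
  have hsub : ∀ y ∈ Metric.closedBall (0 : E) ‖z‖, y ∈ Metric.ball (0 : E) r := fun y hy => by
    rw [mem_closedBall_zero_iff] at hy
    rw [mem_ball_zero_iff] at hz ⊢
    exact hy.trans_lt hz
  -- On the ball of radius ‖z‖ the derivative of R is the first order remainder of the derivative of
  -- w, at most c ‖z‖. The mean value inequality supplies the second factor ‖z‖.
  have h := Convex.norm_image_sub_le_of_norm_hasFDerivWithin_le (𝕜 := ℝ) (f := R)
    (s := Metric.closedBall (0 : E) ‖z‖) (C := c * ‖z‖) (x := 0) (y := z)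
    (fun y hy => (hball y (hsub y hy)).1.hasFDerivWithinAt)
    (fun y hy => ((hball y (hsub y hy)).2).trans (by
      rw [mem_closedBall_zero_iff] at hy; gcongr))
    (convex_closedBall _ _) (by simp) (by simp)
  have hR0 : R 0 = 0 := by simp [hR]
  rw [hR0, sub_zero, sub_zero] at h
  rw [norm_pow, norm_norm, pow_two, ← mul_assoc]
  exact h

namespace Carnot

variable {k : ℕ} {v : ℕ → ℕ}

/-- The inclusion of the `j`-th layer as a linear map. -/
def ofLayerL (k : ℕ) (v : ℕ → ℕ) (j : ℕ) : EuclideanSpace ℝ (Fin (v j)) →L[ℝ] Coord k v :=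
  LinearMap.toContinuousLinearMap
    (if h : j ∈ Finset.Icc 1 k then
      LinearMap.single ℝ (fun i : Finset.Icc 1 k => EuclideanSpace ℝ (Fin (v i))) ⟨j, h⟩ else 0)

theorem ofLayerL_apply (j : ℕ) (a : EuclideanSpace ℝ (Fin (v j))) :
    ofLayerL k v j a = ofLayer j a := by
  by_cases h : j ∈ Finset.Icc 1 k <;> simp [ofLayerL, ofLayer, h]

theorem norm_dil_sub_le {r : ℝ} (hr : 0 ≤ r) (hr1 : r ≤ 1) {x : Coord k v}
    (hx : x ∈ unitBall k v) :
    ‖dil r x - r • ofLayer 1 (layer x 1) - r ^ 2 • ofLayer 2 (layer x 2)‖ ≤ r ^ 3 := by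
  rw [pi_norm_le_iff_of_nonneg (by positivity)]
  rintro ⟨j, hj⟩
  have hoff : ∀ i, i ≠ j → ∀ a : EuclideanSpace ℝ (Fin (v i)),
      (ofLayer i a : Coord k v) ⟨j, hj⟩ = 0 := fun i hi a => by
    by_cases h : i ∈ Finset.Icc 1 k
    · rw [ofLayer, dif_pos h]
      exact Pi.single_eq_of_ne (M := fun i : Finset.Icc 1 k => EuclideanSpace ℝ (Fin (v i)))
        (i := ⟨i, h⟩) (i' := ⟨j, hj⟩) (fun h' => hi (congrArg Subtype.val h').symm) a
    · rw [ofLayer, dif_neg h]; rfl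
  have hon : ∀ a : EuclideanSpace ℝ (Fin (v j)), (ofLayer j a : Coord k v) ⟨j, hj⟩ = a :=
    fun a => by rw [ofLayer, dif_pos hj, Pi.single_eq_same]
  rw [Pi.sub_apply, Pi.sub_apply, dil_apply, Pi.smul_apply, Pi.smul_apply]
  have hj1 := (Finset.mem_Icc.1 hj).1
  rcases eq_or_ne j 1 with rfl | h1
  · rw [hon, hoff 2 (by norm_num), layer_eq hj, pow_one, sub_self, smul_zero, sub_zero, norm_zero]
    positivity
  rcases eq_or_ne j 2 with rfl | h2
  · rw [hon, hoff 1 (by norm_num), layer_eq hj, smul_zero, sub_zero, sub_self, norm_zero]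
    positivity
  rw [hoff 1 h1.symm, hoff 2 h2.symm, smul_zero, smul_zero, sub_zero, sub_zero, norm_smul,
    norm_pow, Real.norm_of_nonneg hr]
  calc r ^ j * ‖x ⟨j, hj⟩‖ ≤ r ^ 3 * 1 :=
        mul_le_mul (pow_le_pow_of_le_one hr hr1 (by omega))
          (norm_le_one_of_mem_unitBall hx _) (norm_nonneg _) (by positivity)
    _ = r ^ 3 := mul_one _

theorem norm_ofLayer_layer_le (x : Coord k v) (hx : x ∈ unitBall k v) (j : ℕ) :
    ‖(ofLayer j (layer x j) : Coord k v)‖ ≤ 1 := by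
  by_cases h : j ∈ Finset.Icc 1 k
  · rw [ofLayer, dif_pos h, Pi.norm_single, layer_eq h]
    exact norm_le_one_of_mem_unitBall hx _
  · rw [ofLayer, dif_neg h, norm_zero]; exact zero_le_one

/-- Second order expansion of a `C²` function along the dilations. -/
theorem eventually_abs_dil_taylor_le {w : Coord k v → ℝ} (hw : ContDiffAt ℝ 2 w 0) {δ : ℝ}
    (hδ : 0 < δ) : ∀ᶠ ε in 𝓝[>] (0 : ℝ), ∀ z ∈ unitBall k v,
      |w (dil ε z) - (w 0 + ε * fderiv ℝ w 0 (ofLayer 1 (layer z 1)) +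
        ε ^ 2 * (fderiv ℝ w 0 (ofLayer 2 (layer z 2)) + 1 / 2 *
          fderiv ℝ (fderiv ℝ w) 0 (ofLayer 1 (layer z 1)) (ofLayer 1 (layer z 1))))|
        ≤ δ * ε ^ 2 := by
  have ho := hw.taylor_two_isLittleO.def (show 0 < δ / 2 by positivity)
  set D := fderiv ℝ w 0
  set T := fderiv ℝ (fderiv ℝ w) 0
  obtain ⟨r, hr, hball⟩ := Metric.eventually_nhds_iff_ball.1 ho
  have hden : 0 < ‖D‖ + 2 * ‖T‖ + 1 := by positivity
  filter_upwards [Ioo_mem_nhdsGT (zero_lt_one (α := ℝ)), Ioo_mem_nhdsGT hr,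
    Ioo_mem_nhdsGT (show 0 < δ / 2 / (‖D‖ + 2 * ‖T‖ + 1) by positivity)] with ε h1 h2 h3 z hz
  have hε : 0 < ε := h1.1
  have hε1 : ε ≤ 1 := h1.2.le
  have hnz := norm_dil_le hε.le hε1 hz
  have hR := hball (dil ε z) (by rw [mem_ball_zero_iff]; exact hnz.trans_lt h2.2)
  rw [norm_pow, norm_norm, Real.norm_eq_abs] at hR
  have hR' : δ / 2 * ‖dil ε z‖ ^ 2 ≤ δ / 2 * ε ^ 2 := by gcongr
  set a : Coord k v := ofLayer 1 (layer z 1)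
  set b : Coord k v := ofLayer 2 (layer z 2)
  have ha : ‖a‖ ≤ 1 := norm_ofLayer_layer_le z hz 1
  have hb : ‖b‖ ≤ 1 := norm_ofLayer_layer_le z hz 2
  -- The layers of degree at least 3 make up r2, which is O(ε³). Besides the Taylor remainder, the
  -- discarded terms contribute at most (‖D‖ + 2‖T‖) ε³.
  set r2 : Coord k v := dil ε z - ε • a - ε ^ 2 • b with hr2
  have hr2n : ‖r2‖ ≤ ε ^ 3 := norm_dil_sub_le hε.le hε1 hz
  set r1 : Coord k v := ε ^ 2 • b + r2 with hr1
  have hr1n : ‖r1‖ ≤ 2 * ε ^ 2 := by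
    refine (norm_add_le _ _).trans ?_
    rw [norm_smul, norm_pow, Real.norm_of_nonneg hε.le]
    have : ε ^ 3 ≤ ε ^ 2 := pow_le_pow_of_le_one hε.le hε1 (by norm_num)
    nlinarith [mul_le_mul_of_nonneg_left hb (by positivity : 0 ≤ ε ^ 2)]
  have hz1 : dil ε z = ε • a + r1 := by simp only [hr1, hr2]; abel
  have hDz : D (dil ε z) = ε * D a + ε ^ 2 * D b + D r2 := by
    rw [hz1, hr1]; simp only [map_add, map_smul, smul_eq_mul]; ring
  have hTz : T (dil ε z) (dil ε z) = ε ^ 2 * T a a + (ε * T a r1 + T r1 (dil ε z)) := by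
    conv_lhs => rw [hz1]
    conv_rhs => rw [hz1]
    simp only [map_add, map_smul, smul_eq_mul, add_apply, smul_apply]
    ring
  have e1 : |D r2| ≤ ‖D‖ * ε ^ 3 := (D.le_opNorm r2).trans (by gcongr)
  have e2 : |T a r1| ≤ ‖T‖ * (2 * ε ^ 2) := by
    refine (T.le_opNorm₂ a r1).trans ?_
    calc ‖T‖ * ‖a‖ * ‖r1‖ ≤ ‖T‖ * 1 * (2 * ε ^ 2) := by gcongr
      _ = _ := by ring
  have e3 : |T r1 (dil ε z)| ≤ ‖T‖ * (2 * ε ^ 2) * ε := by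
    refine (T.le_opNorm₂ _ _).trans ?_
    gcongr
  have e4 : |ε * T a r1 + T r1 (dil ε z)| ≤ 4 * ‖T‖ * ε ^ 3 := by
    refine (abs_add_le _ _).trans ?_
    rw [abs_mul, abs_of_pos hε]
    nlinarith [mul_le_mul_of_nonneg_left e2 hε.le]
  have e5 : (‖D‖ + 2 * ‖T‖) * ε ^ 3 ≤ δ / 2 * ε ^ 2 := by
    have h4 : ε * (‖D‖ + 2 * ‖T‖ + 1) ≤ δ / 2 := ((lt_div_iff₀ hden).1 h3.2).le
    have h5 : ε * (‖D‖ + 2 * ‖T‖) ≤ δ / 2 := by linarith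
    calc (‖D‖ + 2 * ‖T‖) * ε ^ 3 = ε * (‖D‖ + 2 * ‖T‖) * ε ^ 2 := by ring
      _ ≤ _ := by gcongr
  have hsplit : w (dil ε z) - (w 0 + ε * D a + ε ^ 2 * (D b + 1 / 2 * T a a)) =
      (w (dil ε z) - (w 0 + D (dil ε z) + 1 / 2 * T (dil ε z) (dil ε z))) + D r2 +
        1 / 2 * (ε * T a r1 + T r1 (dil ε z)) := by
    rw [hDz, hTz]; ring
  rw [hsplit]
  have hR2 := abs_le.1 (hR.trans hR')
  have e1' := abs_le.1 e1
  have e4' := abs_le.1 e4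
  rw [abs_le]
  constructor <;> linarith

end Carnot

/-! ### Horizontal derivatives and the normalized p-Laplacian -/

theorem inner_eq_of_apply_single {n : ℕ} {F : EuclideanSpace ℝ (Fin n) →L[ℝ] ℝ}
    {ξ : EuclideanSpace ℝ (Fin n)} (h : ∀ i, F (EuclideanSpace.single i 1) = ξ i)
    (y : EuclideanSpace ℝ (Fin n)) : F y = inner ℝ ξ y := by
  have hy := (EuclideanSpace.basisFun (Fin n) ℝ).sum_repr y
  simp only [EuclideanSpace.basisFun_apply, EuclideanSpace.basisFun_repr] at hy
  conv_lhs => rw [← hy]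
  rw [map_sum, PiLp.inner_apply]
  refine Finset.sum_congr rfl fun i _ => ?_
  rw [map_smul, h, smul_eq_mul]
  simp

namespace Carnot

variable {k : ℕ} {v : ℕ → ℕ}

theorem quadForm_eq_of_apply_single {n : ℕ}
    {T : EuclideanSpace ℝ (Fin n) →L[ℝ] EuclideanSpace ℝ (Fin n) →L[ℝ] ℝ}
    {A : Matrix (Fin n) (Fin n) ℝ}
    (h : ∀ i j, T (EuclideanSpace.single i 1) (EuclideanSpace.single j 1) = A i j)
    (y : EuclideanSpace ℝ (Fin n)) : T y y = quadForm A y := by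
  have hy := (EuclideanSpace.basisFun (Fin n) ℝ).sum_repr y
  simp only [EuclideanSpace.basisFun_apply, EuclideanSpace.basisFun_repr] at hy
  conv_lhs => rw [← hy]
  simp only [map_sum, map_smul, _root_.sum_apply, smul_apply, h, smul_eq_mul, Finset.mul_sum]
  rw [quadForm_eq_sum, Finset.sum_comm]
  refine Finset.sum_congr rfl fun i _ => Finset.sum_congr rfl fun j _ => ?_
  ring

namespace CarnotGroup

variable (G : CarnotGroup k v)

/-- The vector of the Lie algebra that spans the `i`-th horizontal direction. -/
def horizVec (k : ℕ) (v : ℕ → ℕ) (i : Fin (v 1)) : Coord k v :=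
  ofLayer 1 (EuclideanSpace.single i 1)

theorem horizDeriv_eq (i : Fin (v 1)) (f : Coord k v → ℝ) (x : Coord k v) :
    G.horizDeriv i f x = fderiv ℝ f x (G.frame x (horizVec k v i)) := rfl

/-- Left invariance of the frame, from L_{xy} = L_x ∘ L_y. It allows horizontal derivatives at x to
be computed at 0 for w = u ∘ L_x. -/
theorem fderiv_comp_mul_left {f : Coord k v → ℝ} (x y : Coord k v)
    (hf : DifferentiableAt ℝ f (G.mul x y)) (a : Coord k v) :
    fderiv ℝ (fun z => f (G.mul x z)) y (G.frame y a) =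
      fderiv ℝ f (G.mul x y) (G.frame (G.mul x y) a) := by
  have h1 : HasFDerivAt (fun z => f (G.mul x z))
      ((fderiv ℝ f (G.mul x y)).comp (fderiv ℝ (G.mul x) y)) y :=
    hf.hasFDerivAt.comp y (G.hasFDerivAt_mul_left x y)
  have h2 : HasFDerivAt (G.mul (G.mul x y)) ((fderiv ℝ (G.mul x) y).comp (G.frame y)) 0 := by
    have h3 : HasFDerivAt (G.mul x) (fderiv ℝ (G.mul x) y) (G.mul y 0) := by
      rw [G.mul_zero]; exact G.hasFDerivAt_mul_left x y
    have h4 := h3.comp (0 : Coord k v) (G.hasFDerivAt_mul_left y 0)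
    have h5 : G.mul x ∘ G.mul y = G.mul (G.mul x y) := funext fun z => (G.mul_assoc x y z).symm
    rw [h5] at h4
    exact h4
  have h6 : G.frame (G.mul x y) = (fderiv ℝ (G.mul x) y).comp (G.frame y) := h2.fderiv
  rw [h1.fderiv, h6]
  rfl

theorem horizDeriv_eq_fderiv_zero (i : Fin (v 1)) {f : Coord k v → ℝ} {x : Coord k v}
    (hf : DifferentiableAt ℝ f x) :
    G.horizDeriv i f x = fderiv ℝ (fun z => f (G.mul x z)) 0 (horizVec k v i) := by
  have h := G.fderiv_comp_mul_left x 0 (f := f) (by rwa [G.mul_zero]) (horizVec k v i)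
  rw [G.mul_zero, frame_zero, ContinuousLinearMap.id_apply] at h
  rw [h, horizDeriv_eq]

variable {u : Coord k v → ℝ} {x : Coord k v}

theorem contDiffAt_comp_mul_left (hu : ContDiffAt ℝ 2 u x) :
    ContDiffAt ℝ 2 (fun z => u (G.mul x z)) 0 := by
  have h : ContDiffAt ℝ 2 u (G.mul x 0) := by rwa [G.mul_zero]
  exact h.comp (0 : Coord k v) ((G.contDiff_mul_comp (n := 2) contDiff_const
    contDiff_id).contDiffAt)

theorem differentiableAt_horizDeriv (hu : ContDiffAt ℝ 2 u x) (j : Fin (v 1)) :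
    DifferentiableAt ℝ (G.horizDeriv j u) x := by
  have h1 : DifferentiableAt ℝ (fderiv ℝ u) x :=
    (hu.fderiv_right (m := 1) (by norm_num)).differentiableAt (by simp)
  have h2 : DifferentiableAt ℝ (fun y => G.frame y (horizVec k v j)) x :=
    (G.differentiable_frame x).clm_apply (differentiableAt_const _)
  exact h1.clm_apply h2

/-- In terms of w = u ∘ L_x the function X_j u is z ↦ Dw(z)(frame z e_j). The product rule at 0
gives the second derivative of w and, from the derivative of the frame, the `bil` term. -/
theorem horizDeriv_horizDeriv (hu : ContDiffAt ℝ 2 u x) (i j : Fin (v 1)) :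
    G.horizDeriv i (G.horizDeriv j u) x =
      fderiv ℝ (fderiv ℝ fun z => u (G.mul x z)) 0 (horizVec k v i) (horizVec k v j) +
        fderiv ℝ (fun z => u (G.mul x z)) 0 (G.bil (horizVec k v i) (horizVec k v j)) := by
  rw [G.horizDeriv_eq_fderiv_zero i (G.differentiableAt_horizDeriv hu j)]
  set w : Coord k v → ℝ := fun z => u (G.mul x z)
  have hw := G.contDiffAt_comp_mul_left hu
  have hev : (fun z => G.horizDeriv j u (G.mul x z)) =ᶠ[𝓝 0]
      fun z => fderiv ℝ w z (G.frame z (horizVec k v j)) := by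
    have h1 : ∀ᶠ y in 𝓝 x, DifferentiableAt ℝ u y := by
      filter_upwards [hu.eventually (by simp)] with y hy using hy.differentiableAt (by simp)
    have h2 : Tendsto (G.mul x) (𝓝 0) (𝓝 x) := by
      have := (G.contDiff_mul_left x).continuous.tendsto 0
      rwa [G.mul_zero] at this
    filter_upwards [h2.eventually h1] with z hz
    rw [horizDeriv_eq]
    exact (G.fderiv_comp_mul_left x z hz _).symm
  rw [hev.fderiv_eq]
  have hD : HasFDerivAt (fderiv ℝ w) (fderiv ℝ (fderiv ℝ w) 0) 0 :=
    ((hw.fderiv_right (m := 1) (by norm_num)).differentiableAt (by simp)).hasFDerivAt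
  have h := hD.clm_apply (G.hasFDerivAt_frame_apply (horizVec k v j))
  rw [h.fderiv]
  simp [add_comm]

/-- Symmetrization cancels the `bil` terms, since `bil` is antisymmetric. -/
theorem symHess_apply (hu : ContDiffAt ℝ 2 u x) (i j : Fin (v 1)) :
    G.symHess u x i j =
      fderiv ℝ (fderiv ℝ fun z => u (G.mul x z)) 0 (horizVec k v i) (horizVec k v j) := by
  have hsymm : IsSymmSndFDerivAt ℝ (fun z => u (G.mul x z)) 0 :=
    (G.contDiffAt_comp_mul_left hu).isSymmSndFDerivAt (by simp)
  have h1 : fderiv ℝ (fderiv ℝ fun z => u (G.mul x z)) 0 (horizVec k v j) (horizVec k v i) =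
      fderiv ℝ (fderiv ℝ fun z => u (G.mul x z)) 0 (horizVec k v i) (horizVec k v j) :=
    hsymm _ _
  rw [symHess, Matrix.of_apply, G.horizDeriv_horizDeriv hu, G.horizDeriv_horizDeriv hu, h1,
    G.bil_antisymm (horizVec k v j), map_neg]
  ring

theorem horizGrad_apply (i : Fin (v 1)) (y : Coord k v) :
    G.horizGrad u y i = G.horizDeriv i u y := rfl

theorem trace_symHess : (G.symHess u x).trace = ∑ i, G.horizDeriv i (G.horizDeriv i u) x := by
  refine Finset.sum_congr rfl fun i _ => ?_
  rw [Matrix.diag_apply, symHess, Matrix.of_apply]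
  ring

theorem quadForm_symHess (y : EuclideanSpace ℝ (Fin (v 1))) :
    quadForm (G.symHess u x) y =
      ∑ i, ∑ j, G.horizDeriv i (G.horizDeriv j u) x * (y i * y j) := by
  have h1 : ∑ i, ∑ j, G.horizDeriv j (G.horizDeriv i u) x * (y i * y j) =
      ∑ i, ∑ j, G.horizDeriv i (G.horizDeriv j u) x * (y i * y j) := by
    rw [Finset.sum_comm]
    refine Finset.sum_congr rfl fun i _ => Finset.sum_congr rfl fun j _ => ?_
    ring
  have h2 : quadForm (G.symHess u x) y =
      (∑ i, ∑ j, G.horizDeriv i (G.horizDeriv j u) x * (y i * y j) +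
        ∑ i, ∑ j, G.horizDeriv j (G.horizDeriv i u) x * (y i * y j)) / 2 := by
    rw [quadForm_eq_sum, ← Finset.sum_add_distrib, Finset.sum_div]
    refine Finset.sum_congr rfl fun i _ => ?_
    rw [← Finset.sum_add_distrib, Finset.sum_div]
    refine Finset.sum_congr rfl fun j _ => ?_
    rw [symHess, Matrix.of_apply]
    ring
  rw [h2, h1]
  ring

theorem norm_horizGrad_rpow (y : Coord k v) (s : ℝ) :
    ‖G.horizGrad u y‖ ^ s = (∑ j, G.horizDeriv j u y ^ 2) ^ (s / 2) := by
  have h : ∑ j, G.horizDeriv j u y ^ 2 = ‖G.horizGrad u y‖ ^ 2 := by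
    rw [EuclideanSpace.norm_sq_eq]
    simp [horizGrad_apply]
  rw [h, ← Real.rpow_natCast, ← Real.rpow_mul (norm_nonneg _)]
  congr 1
  push_cast
  ring

/-- |∇u|^{P-2} = S^{(P-2)/2} with S = Σ (X_j u)², nonzero at x, so the divergence expands by the
product and chain rules. Only the diagonal X_i X_i u and a contraction of X_i X_j u with a symmetric
tensor occur, and neither is changed by symmetrizing the Hessian. -/
theorem normPLaplacian_eq_normTrace (p : ℝ≥0∞) (hu : ContDiffAt ℝ 2 u x)
    (hξ : G.horizGrad u x ≠ 0) :
    G.normPLaplacian p u x = normTrace p (G.symHess u x) (G.horizGrad u x) := by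
  by_cases hp : p = ⊤
  · rw [normPLaplacian, if_pos hp, normTrace, if_pos hp, quadForm_normalize]
  rw [normPLaplacian, if_neg hp, normTrace, if_neg hp]
  set P := p.toReal
  have hn : 0 < ‖G.horizGrad u x‖ := norm_pos_iff.2 hξ
  set S : Coord k v → ℝ := fun y => ∑ j, G.horizDeriv j u y ^ 2 with hS
  have hSx : S x = ‖G.horizGrad u x‖ ^ 2 := by
    simp only [hS]
    rw [EuclideanSpace.norm_sq_eq]
    simp [horizGrad_apply]
  have hS0 : S x ≠ 0 := by rw [hSx]; positivity
  have hg := fun j => (G.differentiableAt_horizDeriv hu j).hasFDerivAt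
  have hSd : HasFDerivAt S
      (∑ j, (2 * G.horizDeriv j u x) • fderiv ℝ (G.horizDeriv j u) x) x := by
    refine HasFDerivAt.fun_sum fun j _ => ?_
    refine ((hg j).pow 2).congr_fderiv ?_
    simp
  have hNd := hSd.rpow_const (p := (P - 2) / 2) (Or.inl hS0)
  have hfield : ∀ i, (fun y => (‖G.horizGrad u y‖ ^ (P - 2) • G.horizGrad u y) i) =
      fun y => S y ^ ((P - 2) / 2) * G.horizDeriv i u y := fun i => by
    funext y
    rw [PiLp.smul_apply, smul_eq_mul, horizGrad_apply, norm_horizGrad_rpow]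
  have hdiv : ∀ i, G.horizDeriv i
      (fun y => (‖G.horizGrad u y‖ ^ (P - 2) • G.horizGrad u y) i) x =
      S x ^ ((P - 2) / 2) * G.horizDeriv i (G.horizDeriv i u) x +
        (P - 2) * S x ^ ((P - 2) / 2 - 1) * ∑ j, G.horizDeriv i (G.horizDeriv j u) x *
          (G.horizGrad u x i * G.horizGrad u x j) := fun i => by
    rw [hfield, horizDeriv_eq, (hNd.fun_mul (hg i)).fderiv]
    simp only [add_apply, smul_apply, _root_.sum_apply, smul_eq_mul, ← horizDeriv_eq,
      horizGrad_apply]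
    rw [Finset.mul_sum, Finset.mul_sum, Finset.mul_sum]
    congr 1
    refine Finset.sum_congr rfl fun j _ => ?_
    ring
  have hpow : S x ^ ((P - 2) / 2 - 1) = ‖G.horizGrad u x‖ ^ (P - 2) / ‖G.horizGrad u x‖ ^ 2 := by
    rw [Real.rpow_sub_one hS0, hSx, norm_horizGrad_rpow, ← hSx]
  have hpow' : S x ^ ((P - 2) / 2) = ‖G.horizGrad u x‖ ^ (P - 2) := by
    rw [norm_horizGrad_rpow]
  have hN : ‖G.horizGrad u x‖ ^ (P - 2) ≠ 0 := (Real.rpow_pos_of_pos hn _).ne'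
  rw [horizDiv]
  simp_rw [hdiv]
  rw [Finset.sum_add_distrib, ← Finset.mul_sum, ← Finset.mul_sum, ← trace_symHess,
    ← quadForm_symHess, hpow, hpow']
  field_simp

/-- For w = u ∘ L_x, the restriction of Dw(0) to V_1 is the horizontal gradient and that of D²w(0)
is the symmetrized Hessian. The vector η is the Riesz representative of Dw(0) on V_2; its value is
immaterial, as the asymptotics of the median hold for every η. -/
theorem eventually_abs_param_taylor_le (hu : ContDiffAt ℝ 2 u x) :
    ∃ η : EuclideanSpace ℝ (Fin (v 2)), ∀ δ > 0, ∀ᶠ ε in 𝓝[>] (0 : ℝ), ∀ z ∈ unitBall k v,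
      |u (G.param x ε z) - (u x + ε * linPart (G.horizGrad u x) z +
        ε ^ 2 * quadPart η (G.symHess u x) z)| ≤ δ * ε ^ 2 := by
  set w : Coord k v → ℝ := fun z => u (G.mul x z) with hw
  have hwc : ContDiffAt ℝ 2 w 0 := G.contDiffAt_comp_mul_left hu
  have hud : DifferentiableAt ℝ u x := hu.differentiableAt (by simp)
  refine ⟨(InnerProductSpace.toDual ℝ _).symm ((fderiv ℝ w 0).comp (ofLayerL k v 2)),
    fun δ hδ => ?_⟩
  filter_upwards [eventually_abs_dil_taylor_le hwc hδ] with ε hε z hz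
  have h := hε z hz
  have e0 : w 0 = u x := by simp only [hw, G.mul_zero]
  have e1 : fderiv ℝ w 0 (ofLayer 1 (layer z 1)) = linPart (G.horizGrad u x) z := by
    rw [linPart, ← inner_eq_of_apply_single (F := (fderiv ℝ w 0).comp (ofLayerL k v 1))]
    · rw [ContinuousLinearMap.comp_apply, ofLayerL_apply]
    · intro i
      rw [ContinuousLinearMap.comp_apply, ofLayerL_apply, horizGrad_apply,
        G.horizDeriv_eq_fderiv_zero i hud]
      rfl
  have e2 : fderiv ℝ w 0 (ofLayer 2 (layer z 2)) = inner ℝ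
      ((InnerProductSpace.toDual ℝ _).symm ((fderiv ℝ w 0).comp (ofLayerL k v 2)))
      (layer z 2) := by
    rw [InnerProductSpace.toDual_symm_apply, ContinuousLinearMap.comp_apply, ofLayerL_apply]
  have e3 : fderiv ℝ (fderiv ℝ w) 0 (ofLayer 1 (layer z 1)) (ofLayer 1 (layer z 1)) =
      quadForm (G.symHess u x) (layer z 1) := by
    rw [← quadForm_eq_of_apply_single
      (T := (fderiv ℝ (fderiv ℝ w) 0).bilinearComp (ofLayerL k v 1) (ofLayerL k v 1))]
    · rw [ContinuousLinearMap.bilinearComp_apply, ofLayerL_apply]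
    · intro i j
      rw [ContinuousLinearMap.bilinearComp_apply, ofLayerL_apply, ofLayerL_apply,
        G.symHess_apply hu]
      rfl
  rw [e0, e1, e2, e3] at h
  exact h

theorem eventually_closedBall_subset {U : Set (Coord k v)} (hU : IsOpen U) (hx : x ∈ U) :
    ∀ᶠ ε in 𝓝[>] (0 : ℝ), G.closedBall x ε ⊆ U := by
  have h2 : Tendsto (G.mul x) (𝓝 0) (𝓝 x) := by
    have := (G.contDiff_mul_left x).continuous.tendsto 0
    rwa [G.mul_zero] at this
  obtain ⟨r, hr, hball⟩ := Metric.eventually_nhds_iff_ball.1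
    (h2.eventually (hU.mem_nhds hx))
  filter_upwards [Ioo_mem_nhdsGT (zero_lt_one (α := ℝ)), Ioo_mem_nhdsGT hr] with ε h1 h2 y hy
  obtain ⟨z, rfl⟩ := G.param_surjective x h1.1 y
  have hz : z ∈ unitBall k v := by
    rw [← G.param_preimage_closedBall x h1.1]; exact hy
  refine hball _ ?_
  rw [mem_ball_zero_iff]
  exact (norm_dil_le h1.1.le h1.2.le hz).trans_lt h2.2

theorem continuousOn_param_of_closedBall_subset {U : Set (Coord k v)} (hu : ContinuousOn u U)
    {ε : ℝ} (hε : 0 < ε) (hU : G.closedBall x ε ⊆ U) :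
    ContinuousOn (fun z => u (G.param x ε z)) (unitBall k v) :=
  hu.comp (G.continuous_param x ε).continuousOn fun _ hz => hU (G.param_mem_closedBall hε hz)

end CarnotGroup

end Carnot

end

theorem lemma3p1 {k : ℕ} {v : ℕ → ℕ} (G : Carnot.CarnotGroup k v) (p : ℝ≥0∞) (hp : 1 < p)
    (x : Carnot.Coord k v) :
    (∀ (ξ : EuclideanSpace ℝ (Fin (v 1))) (η : EuclideanSpace ℝ (Fin (v 2)))
        (A : Matrix (Fin (v 1)) (Fin (v 1)) ℝ) (q : Carnot.Coord k v → ℝ) (ε₀ : ℝ),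
        ξ ≠ 0 → A.IsSymm → 0 < ε₀ →
        (∀ y ∈ G.ball x ε₀,
          q y = q x + inner ℝ ξ (Carnot.layer (G.mul (-x) y) 1)
            + inner ℝ η (Carnot.layer (G.mul (-x) y) 2)
            + 1 / 2 * Carnot.quadForm A (Carnot.layer (G.mul (-x) y) 1)) →
        (∀ ε ∈ Set.Ioo 0 ε₀,
          ∃! m : ℝ, Carnot.IsLpMinimizer p (G.closedBall x ε) q m) ∧
        (fun ε : ℝ => G.median p ε q x
            - (q x + ε ^ 2 * (Carnot.medianConst p k v * Carnot.normTrace p A ξ)))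
          =o[𝓝[>] 0] (fun ε : ℝ => ε ^ 2)) ∧
    (∀ (Ω : Set (Carnot.Coord k v)) (u : Carnot.Coord k v → ℝ),
        IsOpen Ω → x ∈ Ω → ContDiffOn ℝ 2 u Ω → G.horizGrad u x ≠ 0 →
        (∀ᶠ ε in 𝓝[>] (0 : ℝ), G.closedBall x ε ⊆ Ω) ∧
        (∀ ε : ℝ, 0 < ε → G.closedBall x ε ⊆ Ω →
          ∃! m : ℝ, Carnot.IsLpMinimizer p (G.closedBall x ε) u m) ∧
        (fun ε : ℝ => G.median p ε u x
            - (u x + Carnot.medianConst p k v * G.normPLaplacian p u x * ε ^ 2))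
          =o[𝓝[>] 0] (fun ε : ℝ => ε ^ 2)) := by
  refine ⟨fun ξ η A q ε₀ hξ _ hε₀ hq => ?_, fun Ω u hΩ hx hu hgrad => ?_⟩
  · have hcont : ∀ ε ∈ Set.Ioo 0 ε₀,
        ContinuousOn (fun z => q (G.param x ε z)) (Carnot.unitBall k v) := fun ε hε => by
      -- Continuity of q is not assumed: on the pseudoball q coincides with a continuous expression
      -- in the parameter z.
      have hc : Continuous fun z : Carnot.Coord k v =>
          q x + ε * Carnot.linPart ξ z + ε ^ 2 * Carnot.quadPart η A z := by fun_prop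
      exact hc.continuousOn.congr fun z hz => G.quadratic_param hq hε hz
    refine ⟨fun ε hε => G.existsUnique_isLpMinimizer hp x hε.1 (hcont ε hε),
      G.median_isLittleO hp x hξ η A ?_ fun δ hδ => ?_⟩
    · filter_upwards [Ioo_mem_nhdsGT hε₀] with ε hε using hcont ε hε
    · filter_upwards [Ioo_mem_nhdsGT hε₀] with ε hε z hz
      rw [G.quadratic_param hq hε hz, sub_self, abs_zero]
      positivity
  · have hux : ContDiffAt ℝ 2 u x := hu.contDiffAt (hΩ.mem_nhds hx)
    have hsub := G.eventually_closedBall_subset hΩ hx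
    have hcont : ∀ ε : ℝ, 0 < ε → G.closedBall x ε ⊆ Ω →
        ContinuousOn (fun z => u (G.param x ε z)) (Carnot.unitBall k v) := fun ε hε h =>
      G.continuousOn_param_of_closedBall_subset hu.continuousOn hε h
    refine ⟨hsub, fun ε hε h => G.existsUnique_isLpMinimizer hp x hε (hcont ε hε h), ?_⟩
    obtain ⟨η, happ⟩ := G.eventually_abs_param_taylor_le hux
    have hev : ∀ᶠ ε in 𝓝[>] (0 : ℝ),
        ContinuousOn (fun z => u (G.param x ε z)) (Carnot.unitBall k v) := by
      filter_upwards [hsub, self_mem_nhdsWithin] with ε h hε using hcont ε hε h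
    have h := G.median_isLittleO hp x hgrad η (G.symHess u x) hev happ
    rw [← G.normPLaplacian_eq_normTrace p hux hgrad] at h
    refine h.congr_left fun ε => ?_
    ring
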